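/- **Setting.** Let $\mathbb F_{\mathfrak p}$ be a finite field with $\hat q$ elements, and put $A_{\mathfrak p}=\mathbb F_{\mathfrak p}[[z]]$ and $Q_{\mathfrak p}=\mathbb F_{\mathfrak p}((z))$. Let $\mathcal O$ be a complete discrete valuation ring with perfect residue field and fraction field $L$, and let $\gamma\colon A_{\mathfrak p}\to\mathcal O$ be an injective continuous ring homomorphism such that $\zeta:=\gamma(z)$ is a non-zero element of the maximal ideal of $\mathcal O$. Let $e=\operatorname{ord}_L(\zeta)$ be the ramification index of $L/\gamma(Q_{\mathfrak p})$. Let $L^{\rm sep}$ be a separable closure of $L$, $G_L=\mathrm{Gal}(L^{\rm sep}/L)$, and $I_L\subset G_L$ the inertia subgroup. Let $\hat\sigma$ be the endomorphism of $\mathcal O[[z]]$ (and of $L^{\rm sep}[[z]]$) that fixes $z$ and raises coefficients to the $\hat q$-th power. **Local shtukas.** A local shtuka over $\mathcal O$ is a pair $\hat{\underline M}=(\hat M,\tau)$ of a finite free $\mathcal O[[z]]$-module $\hat M$ and an isomorphism $\tau\colon \hat\sigma^*\hat M[\frac1{z-\zeta}]\to\hat M[\frac1{z-\zeta}]$ of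 $\mathcal O[[z]][\frac1{z-\zeta}]$-modules. It is effective of height $\le h$ if $(z-\zeta)^h\hat M\subset\tau(\hat\sigma^*\hat M)\subset\hat M$. Its dimension is the integer $d=\dim\hat{\underline M}$ with $\det\tau\in(z-\zeta)^d\,\mathcal O[[z]]^\times$. Put $\check T=\{m\in\hat M\otimes_{\mathcal O[[z]]}L^{\rm sep}[[z]] : \tau(\hat\sigma^*m)=m\}$ with its $G_L$-action, $T_{\mathfrak p}\hat{\underline M}=\mathrm{Hom}_{A_{\mathfrak p}}(\check T,A_{\mathfrak p})$ and $V_{\mathfrak p}\hat{\underline M}=T_{\mathfrak p}\hat{\underline M}\otimes_{A_{\mathfrak p}}Q_{\mathfrak p}$. **Tame inertia weights.** For $r\ge1$ let $\theta_r(s)=s(\varpi)/\varpi$ $(s\in I_L)$ be the fundamental character of level $r$, where $\varpi\in L^{\rm sep}$ is a root of $X^{\hat q^r-1}-\pi$ and $\pi$ is a uniformizer of $L$. Let $\mathbb F/\mathbb F_{\mathfrak p}$ be a finite extension of degree $r$, embedded into $L^{\rm sep}$ over $\mathbb F_{\mathfrak p}$. If a character $\psi\colon I_L\to\mathbb F^\times$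 is written $\psi=\theta_r^n$ with $0\le n<\hat q^r-1$ and $n=n_0\hat q^{r-1}+n_1\hat q^{r-2}+\dots+n_{r-1}$, $0\le n_i\le\hat q-1$, its multiset of tame inertia weights is $\{n_0,\dots,n_{r-1}\}$. For a $Q_{\mathfrak p}$-representation $V$ of $G_L$ take a $G_L$-stable $A_{\mathfrak p}$-lattice $T\subset V$ and a Jordan–Hölder filtration of the $\mathbb F_{\mathfrak p}$-representation $T/zT$ of $I_L$; each factor is a one-dimensional representation, given by a character $\psi_i\colon I_L\to\mathbb F_i^\times$, over a finite extension $\mathbb F_i$ of $\mathbb F_{\mathfrak p}$. The multiset $\mathrm{TI}(V)$ is the union of the multisets of tame inertia weights of the $\psi_i$. **Statement.** Let $h\ge0$ be an integer and let $\hat{\underline M}$ be an effective local shtuka of height $\le h$ over $\mathcal O$. If $eh<\hat q-1$, then $\dim\hat{\underline M}$ and $\mathrm{TI}(V_{\mathfrak p}\hat{\underline M})$ exist, and (for every choice of the lattice, the filtration and the other auxiliary data) every element of $\mathrm{TI}(V_{\mathfrak p}\hat{\underline M})$ lies in $[0,eh]$, and $$\sum_{n\in \mathrm{TI}(V_{\mathfrak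 p}\hat{\underline M})} n \;=\; e\cdot\dim\hat{\underline M}.$$ -/

import Mathlib

open scoped PowerSeries LaurentSeries TensorProduct

set_option linter.unusedSectionVars false

noncomputable section

/-! ### Scalars

Throughout, `F` is the finite field `𝔽_𝔭` with `q̂` elements, `A_𝔭 = F⟦X⟧` and `Q_𝔭 = F⸨X⸩` (the
variable `X` is `z`), `O` is the valuation ring of `L`, and `Ω` is a separable closure of `L`. The
structure map `γ : A_𝔭 → O` is the continuous ring homomorphism given by `F → O` and `z ↦ ζ`. -/

namespace LocalTame

/-- The endomorphism `σ̂` of `A⟦z⟧`: `σ̂(z) = z` and `σ̂(a) = a ^ q̂` for `a ∈ A`, `q̂ = #F`. -/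
def frob (F : Type*) [Field F] [Fintype F] (A : Type*) [CommRing A] [Algebra F A] :
    A⟦X⟧ →+* A⟦X⟧ :=
  PowerSeries.map (FiniteField.frobeniusAlgHom F A : A →+* A)

/-- The element `z - ζ` of `O⟦z⟧`. -/
def zSub {O : Type*} [CommRing O] (ζ : O) : O⟦X⟧ := PowerSeries.X - PowerSeries.C ζ

/-- The multiplicative set of powers of `z - ζ`. -/
abbrev zSubPowers {O : Type*} [CommRing O] (ζ : O) : Submonoid O⟦X⟧ := Submonoid.powers (zSub ζ)

/-- The ring `O⟦z⟧[1/(z - ζ)]`. -/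
abbrev ZSubLoc {O : Type*} [CommRing O] (ζ : O) : Type _ := Localization (zSubPowers ζ)

/-- The localization `N[1/(z - ζ)]` of an `O⟦z⟧`-module `N`. -/
abbrev ZSubLocMod {O : Type*} [CommRing O] (ζ : O) (N : Type*) [AddCommGroup N] [Module O⟦X⟧ N] :
    Type _ :=
  LocalizedModule (zSubPowers ζ) N

/-- The element `z - ζ`, as a unit of `O⟦z⟧[1/(z - ζ)]`. -/
def zSubUnit {O : Type*} [CommRing O] (ζ : O) : (ZSubLoc ζ)ˣ :=
  (IsLocalization.map_units (ZSubLoc ζ)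
    (⟨zSub ζ, Submonoid.mem_powers _⟩ : zSubPowers ζ)).unit

/-- The coefficientwise algebra structures on power series rings are compatible in towers. -/
theorem powerSeries_isScalarTower (A B C : Type*) [CommRing A] [CommRing B] [CommRing C]
    [Algebra A B] [Algebra B C] [Algebra A C] [IsScalarTower A B C] :
    IsScalarTower A⟦X⟧ B⟦X⟧ C⟦X⟧ :=
  IsScalarTower.of_algebraMap_eq fun f => by
    ext n
    simp [PowerSeries.algebraMap_apply'', IsScalarTower.algebraMap_apply A B C]

/-! ### Pullback along a ring endomorphism -/

section Pullback

variable {R : Type*} [CommRing R]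

/-- The ring `R`, seen as an algebra over `R` via `σ : R → R`. -/
def Twist (_σ : R →+* R) : Type _ := R

instance (σ : R →+* R) : CommRing (Twist σ) := inferInstanceAs (CommRing R)

instance (σ : R →+* R) : Algebra R (Twist σ) := σ.toAlgebra

/-- The identity map `R → Twist σ`, which is a ring isomorphism. -/
def Twist.of (σ : R →+* R) : R ≃+* Twist σ := RingEquiv.refl R

/-- The pullback `σ^* M = R ⊗_{σ, R} M`, an `R`-module through the left factor. -/
def Pullback (σ : R →+* R) (M : Type*) [AddCommGroup M] [Module R M] : Type _ :=
  Twist σ ⊗[R] M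

instance (σ : R →+* R) (M : Type*) [AddCommGroup M] [Module R M] : AddCommGroup (Pullback σ M) :=
  inferInstanceAs (AddCommGroup (Twist σ ⊗[R] M))

instance (σ : R →+* R) (M : Type*) [AddCommGroup M] [Module R M] : Module R (Pullback σ M) :=
  Module.compHom (Twist σ ⊗[R] M) (Twist.of σ : R →+* Twist σ)

/-- The canonical `σ`-semilinear map `σ^* : M → σ^* M`, `m ↦ 1 ⊗ m`. -/
def Pullback.of (σ : R →+* R) (M : Type*) [AddCommGroup M] [Module R M] :
    M →ₛₗ[σ] Pullback σ M where
  toFun m := (1 : Twist σ) ⊗ₜ[R] m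
  map_add' m m' := TensorProduct.tmul_add _ m m'
  map_smul' r m := by
    change (1 : Twist σ) ⊗ₜ[R] (r • m) = (Twist.of σ (σ r)) • ((1 : Twist σ) ⊗ₜ[R] m)
    rw [← TensorProduct.smul_tmul, TensorProduct.smul_tmul', Algebra.smul_def, smul_eq_mul]
    rfl

end Pullback

/-! ### Local shtukas -/

/-- A local shtuka over `O`: a finite free `O⟦z⟧`-module `M` with an isomorphism
`τ : (σ̂^* M)[1/(z - ζ)] ≃ M[1/(z - ζ)]` of `O⟦z⟧[1/(z - ζ)]`-modules. -/
structure LocalShtuka (F : Type*) [Field F] [Fintype F] (O : Type*) [CommRing O] [Algebra F O]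
    (ζ : O) where
  /-- the underlying module -/
  M : Type*
  [addCommGroup : AddCommGroup M]
  [module : Module O⟦X⟧ M]
  [free : Module.Free O⟦X⟧ M]
  [finite : Module.Finite O⟦X⟧ M]
  /-- the Frobenius isomorphism -/
  τ : ZSubLocMod ζ (Pullback (frob F O) M) ≃ₗ[ZSubLoc ζ] ZSubLocMod ζ M

namespace LocalShtuka

attribute [instance] addCommGroup module free finite

section

variable {F : Type*} [Field F] [Fintype F] {O : Type*} [CommRing O] [Algebra F O] {ζ : O}
  (S : LocalShtuka F O ζ)

/-- The canonical image of `M` in `M[1/(z - ζ)]`. -/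
def lattice : Submodule O⟦X⟧ (ZSubLocMod ζ S.M) :=
  LinearMap.range (LocalizedModule.mkLinearMap (zSubPowers ζ) S.M)

/-- The map `σ̂^* M → M[1/(z - ζ)]` given by `τ`. -/
def τInt : Pullback (frob F O) S.M →ₗ[O⟦X⟧] ZSubLocMod ζ S.M :=
  (S.τ.toLinearMap.restrictScalars O⟦X⟧).comp
    (LocalizedModule.mkLinearMap (zSubPowers ζ) (Pullback (frob F O) S.M))

/-- The local shtuka is effective: `τ(σ̂^* M) ⊆ M`. -/
def IsEffective : Prop := LinearMap.range S.τInt ≤ S.lattice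

/-- The local shtuka is effective of height `≤ h`: `(z - ζ)^h M ⊆ τ(σ̂^* M) ⊆ M`. -/
def IsEffectiveOfHeightLE (h : ℕ) : Prop :=
  S.IsEffective ∧ ∀ x ∈ S.lattice, zSub ζ ^ h • x ∈ LinearMap.range S.τInt

/-- The matrix of `τ` with respect to the bases of `σ̂^* M` and `M` given by a basis `b` of `M`. -/
def τMatrix {ι : Type*} [Fintype ι] [DecidableEq ι] (b : Module.Basis ι O⟦X⟧ S.M) :
    Matrix ι ι (ZSubLoc ζ) :=
  Matrix.of fun i j =>
    (b.ofIsLocalizedModule (ZSubLoc ζ) (zSubPowers ζ)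
      (LocalizedModule.mkLinearMap (zSubPowers ζ) S.M)).repr
      (S.τInt (Pullback.of (frob F O) S.M (b j))) i

/-- The local shtuka has dimension `d`: `det τ ∈ (z - ζ)^d · O⟦z⟧ˣ`, the determinant being taken
with respect to any basis of `M` (another basis changes it by an element of `O⟦z⟧ˣ`). -/
def HasDimension (d : ℤ) : Prop :=
  ∀ (r : ℕ) (b : Module.Basis (Fin r) O⟦X⟧ S.M), ∃ u : O⟦X⟧ˣ,
    (S.τMatrix b).det = ((zSubUnit ζ ^ d : (ZSubLoc ζ)ˣ) : ZSubLoc ζ) *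
      algebraMap O⟦X⟧ (ZSubLoc ζ) u

end

/-! ### The Tate module -/

section Tate

variable {F : Type*} [Field F] [Fintype F] {O : Type*} [CommRing O] [Algebra F O] {ζ : O}
  (S : LocalShtuka F O ζ) (L : Type*) [Field L] [Algebra O L]
  (Ω : Type*) [Field Ω] [Algebra O Ω] [Algebra L Ω] [IsScalarTower O L Ω]

/-- The `Ω⟦z⟧`-module `M ⊗_{O⟦z⟧} Ω⟦z⟧`. -/
abbrev Ext : Type _ := Ω⟦X⟧ ⊗[O⟦X⟧] S.M

/-- `z - ζ` is invertible in `Ω⟦z⟧` if the image of `ζ` in `Ω` is not zero. -/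
theorem isUnit_zSub (hζ : algebraMap O Ω ζ ≠ 0) : IsUnit (algebraMap O⟦X⟧ Ω⟦X⟧ (zSub ζ)) := by
  rw [PowerSeries.isUnit_iff_constantCoeff, PowerSeries.algebraMap_apply'']
  simpa [zSub, isUnit_iff_ne_zero] using hζ

theorem isUnit_zSubPowers (hζ : algebraMap O Ω ζ ≠ 0) (N : Type*) [AddCommGroup N]
    [Module O⟦X⟧ N] (x : zSubPowers ζ) :
    IsUnit (algebraMap O⟦X⟧ (Module.End O⟦X⟧ (Ω⟦X⟧ ⊗[O⟦X⟧] N)) x) := by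
  obtain ⟨x, n, rfl⟩ := x
  simp only [map_pow]
  apply IsUnit.pow
  obtain ⟨u, hu⟩ := isUnit_zSub Ω hζ
  have key (y : Ω⟦X⟧ ⊗[O⟦X⟧] N) : zSub ζ • y = (u : Ω⟦X⟧) • y := by
    rw [hu, algebraMap_smul]
  rw [Module.End.isUnit_iff]
  constructor
  · intro y y' hyy
    have h : (u : Ω⟦X⟧) • y = (u : Ω⟦X⟧) • y' := by rw [← key, ← key]; exact hyy
    have h' := congrArg (fun t => (↑u⁻¹ : Ω⟦X⟧) • t) h
    simpa [smul_smul] using h'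
  · intro y
    refine ⟨(↑u⁻¹ : Ω⟦X⟧) • y, ?_⟩
    change zSub ζ • ((↑u⁻¹ : Ω⟦X⟧) • y) = y
    rw [key, smul_smul, Units.mul_inv, one_smul]

/-- The canonical map `N[1/(z - ζ)] → N ⊗_{O⟦z⟧} Ω⟦z⟧`. -/
def locToExt (hζ : algebraMap O Ω ζ ≠ 0) (N : Type*) [AddCommGroup N] [Module O⟦X⟧ N] :
    ZSubLocMod ζ N →ₗ[O⟦X⟧] Ω⟦X⟧ ⊗[O⟦X⟧] N :=
  LocalizedModule.lift (zSubPowers ζ) (TensorProduct.mk O⟦X⟧ Ω⟦X⟧ N 1)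
    (isUnit_zSubPowers Ω hζ N)

/-- The `Ω⟦z⟧`-linear map `σ̂^* M ⊗ Ω⟦z⟧ → M ⊗ Ω⟦z⟧` induced by `τ`. -/
def τExt (hζ : algebraMap O Ω ζ ≠ 0) :
    Ω⟦X⟧ ⊗[O⟦X⟧] Pullback (frob F O) S.M →ₗ[Ω⟦X⟧] S.Ext Ω :=
  LinearMap.liftBaseChange Ω⟦X⟧ ((locToExt Ω hζ S.M).comp S.τInt)

variable [Algebra F Ω] [IsScalarTower F O Ω]

/-- `σ̂` on `Ω⟦z⟧`, as a `σ̂`-semilinear map over `O⟦z⟧`. -/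
def frobSemilinear : Ω⟦X⟧ →ₛₗ[frob F O] Ω⟦X⟧ where
  toFun := frob F Ω
  map_add' := map_add _
  map_smul' r x := by
    rw [Algebra.smul_def, Algebra.smul_def, map_mul]
    congr 1
    ext n
    simp [frob, PowerSeries.algebraMap_apply'']

/-- The semilinear map `σ̂^* : M ⊗ Ω⟦z⟧ → σ̂^* (M ⊗ Ω⟦z⟧) = σ̂^* M ⊗ Ω⟦z⟧`, which sends `f ⊗ m` to
`σ̂(f) ⊗ σ̂^* m`. -/
def pullExt : S.Ext Ω →ₛₗ[frob F O] Ω⟦X⟧ ⊗[O⟦X⟧] Pullback (frob F O) S.M :=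
  TensorProduct.map (frobSemilinear (F := F) (O := O) Ω) (Pullback.of (frob F O) S.M)

/-- The tensor product `M ⊗ Ω⟦z⟧` is an `A_𝔭`-module through `A_𝔭 = F⟦z⟧ ⊆ Ω⟦z⟧`. -/
instance : SMulCommClass O⟦X⟧ F⟦X⟧ Ω⟦X⟧ := ⟨fun a b c => by
  simp only [Algebra.smul_def]; ring⟩

theorem frob_algebraMap (a : F⟦X⟧) :
    frob F Ω (algebraMap F⟦X⟧ Ω⟦X⟧ a) = algebraMap F⟦X⟧ Ω⟦X⟧ a := by
  ext n
  simp [frob, PowerSeries.algebraMap_apply'']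

theorem τExt_pullExt_smul (hζ : algebraMap O Ω ζ ≠ 0) (a : F⟦X⟧) (x : S.Ext Ω) :
    S.τExt Ω hζ (S.pullExt Ω (a • x)) = a • S.τExt Ω hζ (S.pullExt Ω x) := by
  have key (y : S.Ext Ω) : algebraMap F⟦X⟧ Ω⟦X⟧ a • y = a • y := by
    induction y using TensorProduct.induction_on with
    | zero => simp
    | add y z hy hz => rw [smul_add, smul_add, hy, hz]
    | tmul f m => rw [TensorProduct.smul_tmul', TensorProduct.smul_tmul', algebraMap_smul]
  induction x using TensorProduct.induction_on with
  | zero => simp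
  | add x y hx hy => simp only [smul_add, map_add, hx, hy]
  | tmul f m =>
    rw [← key, ← key, ← map_smul]
    congr 1
    simp only [TensorProduct.smul_tmul', pullExt, TensorProduct.map_tmul, smul_eq_mul]
    congr 1
    change frob F Ω _ = _ * frob F Ω _
    rw [map_mul, frob_algebraMap]

/-- The dual Tate module `(M ⊗ Ω⟦z⟧)^τ = {m | τ(σ̂^* m) = m}`, an `A_𝔭`-module. -/
def dualTate (hζ : algebraMap O Ω ζ ≠ 0) : Submodule F⟦X⟧ (S.Ext Ω) where
  carrier := {m | S.τExt Ω hζ (S.pullExt Ω m) = m}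
  zero_mem' := by simp
  add_mem' {a b} ha hb := by
    simp only [Set.mem_ofPred_eq, map_add] at ha hb ⊢
    rw [ha, hb]
  smul_mem' a x hx := by
    simp only [Set.mem_ofPred_eq] at hx ⊢
    rw [τExt_pullExt_smul, hx]

/-- The action of `s ∈ Gal(Ω/L)` on the coefficients of `Ω⟦z⟧`, as an `O⟦z⟧`-linear map. -/
def galPowerSeries (s : Ω ≃ₐ[L] Ω) : Ω⟦X⟧ →ₗ[O⟦X⟧] Ω⟦X⟧ where
  toFun := PowerSeries.map (s : Ω →+* Ω)
  map_add' := map_add _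
  map_smul' r x := by
    rw [Algebra.smul_def, RingHom.id_apply, Algebra.smul_def, map_mul]
    congr 1
    ext n
    simp [PowerSeries.algebraMap_apply'', IsScalarTower.algebraMap_apply O L Ω]

/-- The action of `s ∈ Gal(Ω/L)` on `M ⊗ Ω⟦z⟧`: trivial on `M`, natural on `Ω⟦z⟧`. -/
def galExt (s : Ω ≃ₐ[L] Ω) : S.Ext Ω →ₗ[O⟦X⟧] S.Ext Ω :=
  LinearMap.rTensor S.M (galPowerSeries L Ω s)

theorem galExt_smul (s : Ω ≃ₐ[L] Ω) (f : Ω⟦X⟧) (x : S.Ext Ω) :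
    S.galExt L Ω s (f • x) = PowerSeries.map (s : Ω →+* Ω) f • S.galExt L Ω s x := by
  induction x using TensorProduct.induction_on with
  | zero => simp
  | add x y hx hy => simp only [smul_add, map_add, hx, hy]
  | tmul g m =>
    change galPowerSeries (O := O) L Ω s (f * g) ⊗ₜ[O⟦X⟧] m =
      (PowerSeries.map (s : Ω →+* Ω) f * PowerSeries.map (s : Ω →+* Ω) g) ⊗ₜ[O⟦X⟧] m
    rw [← map_mul]
    rfl

theorem galExt_locToExt (hζ : algebraMap O Ω ζ ≠ 0) (s : Ω ≃ₐ[L] Ω) (y : ZSubLocMod ζ S.M) :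
    S.galExt L Ω s (locToExt Ω hζ S.M y) = locToExt Ω hζ S.M y := by
  have h : (S.galExt L Ω s).comp (locToExt Ω hζ S.M) = locToExt Ω hζ S.M := by
    refine IsLocalizedModule.ext (zSubPowers ζ)
      (LocalizedModule.mkLinearMap (zSubPowers ζ) S.M) (isUnit_zSubPowers Ω hζ S.M) ?_
    ext m
    simp only [LinearMap.comp_apply, LocalizedModule.mkLinearMap_apply, locToExt,
      LocalizedModule.lift_mk_one, TensorProduct.mk_apply]
    change galPowerSeries (O := O) L Ω s 1 ⊗ₜ[O⟦X⟧] m = 1 ⊗ₜ[O⟦X⟧] m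
    congr 1
    exact map_one (PowerSeries.map (s : Ω →+* Ω))
  exact LinearMap.congr_fun h y

theorem galExt_τExt_pullExt (hζ : algebraMap O Ω ζ ≠ 0) (s : Ω ≃ₐ[L] Ω) (x : S.Ext Ω) :
    S.τExt Ω hζ (S.pullExt Ω (S.galExt L Ω s x)) =
      S.galExt L Ω s (S.τExt Ω hζ (S.pullExt Ω x)) := by
  induction x using TensorProduct.induction_on with
  | zero => simp
  | add x y hx hy => simp only [map_add, hx, hy]
  | tmul f m =>
    have h (g : Ω⟦X⟧) : S.τExt Ω hζ (S.pullExt Ω (g ⊗ₜ m)) =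
        frob F Ω g • locToExt Ω hζ S.M (S.τInt (Pullback.of (frob F O) S.M m)) := rfl
    change S.τExt Ω hζ (S.pullExt Ω (PowerSeries.map (s : Ω →+* Ω) f ⊗ₜ m)) = _
    rw [h, h, galExt_smul, galExt_locToExt]
    congr 1
    ext n
    simp [frob]

/-- The action of `Gal(Ω/L)` on the dual Tate module. -/
def dualTateRep [Algebra F L] [IsScalarTower F L Ω] (hζ : algebraMap O Ω ζ ≠ 0) :
    Representation F⟦X⟧ (Ω ≃ₐ[L] Ω) (S.dualTate Ω hζ) where
  toFun s :=
    { toFun := fun x => ⟨S.galExt L Ω s x, by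
        have hx : S.τExt Ω hζ (S.pullExt Ω (x : S.Ext Ω)) = x := x.2
        change S.τExt Ω hζ (S.pullExt Ω (S.galExt L Ω s x)) = S.galExt L Ω s x
        rw [galExt_τExt_pullExt, hx]⟩
      map_add' := fun x y => Subtype.ext (map_add (S.galExt L Ω s) (x : S.Ext Ω) y)
      map_smul' := fun a x => Subtype.ext (by
        change S.galExt L Ω s (a • (x : S.Ext Ω)) = a • S.galExt L Ω s (x : S.Ext Ω)
        rw [← algebraMap_smul Ω⟦X⟧ a, galExt_smul, ← algebraMap_smul Ω⟦X⟧ a]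
        congr 1
        ext n
        simp [PowerSeries.algebraMap_apply'', IsScalarTower.algebraMap_apply F L Ω]) }
  map_one' := by
    ext x
    change S.galExt L Ω 1 (x : S.Ext Ω) = x
    have h : S.galExt L Ω 1 = LinearMap.id := by
      have h1 : galPowerSeries (O := O) L Ω 1 = LinearMap.id := by
        ext f n
        simp [galPowerSeries]
      rw [galExt, h1, LinearMap.rTensor_id]
    rw [h, LinearMap.id_apply]
  map_mul' s t := by
    ext x
    change S.galExt L Ω (s * t) (x : S.Ext Ω) = S.galExt L Ω s (S.galExt L Ω t x)
    have h : S.galExt L Ω (s * t) = (S.galExt L Ω s).comp (S.galExt L Ω t) := by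
      have h1 : galPowerSeries (O := O) L Ω (s * t) =
          (galPowerSeries L Ω s).comp (galPowerSeries L Ω t) := by
        ext f n
        simp [galPowerSeries]
      rw [galExt, h1, LinearMap.rTensor_comp]
      rfl
    rw [h, LinearMap.comp_apply]

/-- The Tate module `T_𝔭 = Hom_{A_𝔭}(Ť_𝔭, A_𝔭)` of a local shtuka. -/
abbrev Tate (hζ : algebraMap O Ω ζ ≠ 0) : Type _ := Module.Dual F⟦X⟧ (S.dualTate Ω hζ)

/-- The rational Tate module `V_𝔭 = T_𝔭 ⊗_{A_𝔭} Q_𝔭` of a local shtuka. -/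
abbrev RatTate (hζ : algebraMap O Ω ζ ≠ 0) : Type _ := F⸨X⸩ ⊗[F⟦X⟧] S.Tate Ω hζ

/-- The action of `Gal(Ω/L)` on the rational Tate module. -/
def ratTateRep [Algebra F L] [IsScalarTower F L Ω] (hζ : algebraMap O Ω ζ ≠ 0) :
    Representation F⸨X⸩ (Ω ≃ₐ[L] Ω) (S.RatTate Ω hζ) where
  toFun s := ((S.dualTateRep L Ω hζ).dual s).baseChange F⸨X⸩
  map_one' := by rw [map_one]; exact LinearMap.baseChange_id
  map_mul' s t := by rw [map_mul]; exact LinearMap.baseChange_comp _ _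

end Tate

end LocalShtuka

/-! ### Tame inertia weights -/

section Inertia

variable (O : Type*) [CommRing O] (L : Type*) [Field L] [Algebra O L]
  (Ω : Type*) [Field Ω] [Algebra O Ω] [Algebra L Ω] [IsScalarTower O L Ω]

instance galSMulCommClass : SMulCommClass (Ω ≃ₐ[L] Ω) O Ω := ⟨fun s a x => by
  simp only [AlgEquiv.smul_def, Algebra.smul_def, map_mul]
  congr 1
  rw [IsScalarTower.algebraMap_apply O L Ω, s.commutes]⟩

/-- The inertia group: the automorphisms in `Gal(Ω/L)` which act trivially on the residue field of
the integral closure of `O` in `Ω`. (If `O` is complete, this integral closure is a local ring, and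
its Jacobson radical is the maximal ideal.) -/
def inertia : Subgroup (Ω ≃ₐ[L] Ω) :=
  (((⊥ : Ideal (integralClosure O Ω)).jacobson).toAddSubgroup).inertia (Ω ≃ₐ[L] Ω)

/-- `θ` is a fundamental character of level `r`, with values in `μ_{q ^ r - 1}(Ω)`:
`θ(s) = s(ϖ) / ϖ` for a root `ϖ` of `X ^ (q ^ r - 1) - π`, where `π` is a uniformizer of `O`. -/
def IsFundamentalCharacter (q r : ℕ) (θ : inertia O L Ω → Ω) : Prop :=
  ∃ (π : O) (ϖ : Ω), Irreducible π ∧ ϖ ^ (q ^ r - 1) = algebraMap O Ω π ∧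
    ∀ s : inertia O L Ω, θ s = (s : Ω ≃ₐ[L] Ω) ϖ / ϖ

/-- The multiset of the `r` digits `n_i ∈ [0, q - 1]` of `n = ∑ n_i q ^ (r - 1 - i)`. -/
def digits (q r n : ℕ) : Multiset ℕ := (Multiset.range r).map fun i => n / q ^ i % q

variable (F : Type*) [Field F] [Fintype F] [Algebra F Ω]

/-- `w` is the multiset of tame inertia weights of the character `ψ : I_L → Eˣ`, where `E` is a
finite extension of `F` of degree `r`, embedded into `Ω` over `F`: if `ψ = θ_r ^ n` with
`0 ≤ n < q̂ ^ r - 1`, then `w` consists of the `r` digits of `n` in base `q̂`. -/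
def IsCharacterWeights (E : IntermediateField F Ω) (ψ : inertia O L Ω →* Eˣ)
    (w : Multiset ℕ) : Prop :=
  ∃ (θ : inertia O L Ω → Ω) (n : ℕ),
    IsFundamentalCharacter O L Ω (Fintype.card F) (Module.finrank F E) θ ∧
    n < Fintype.card F ^ Module.finrank F E - 1 ∧
    (∀ s, ((ψ s : E) : Ω) = θ s ^ n) ∧
    w = digits (Fintype.card F) (Module.finrank F E) n

variable {F}

/-- For subrepresentations `U ≤ U'` of an `F`-representation of `I_L`: the subquotient `U' / U` is
isomorphic to a one-dimensional representation over a finite extension `E` of `F` (embedded into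
`Ω`) on which `I_L` acts by a character `ψ : I_L → Eˣ`, and `w` is the multiset of tame inertia
weights of `ψ`. -/
def IsFactorWeights {W : Type*} [AddCommGroup W] [Module F W]
    {ρ : Representation F (inertia O L Ω) W} (U U' : Subrepresentation ρ)
    (w : Multiset ℕ) : Prop :=
  ∃ (E : IntermediateField F Ω) (ψ : inertia O L Ω →* Eˣ) (φ : U'.toSubmodule →ₗ[F] E),
    FiniteDimensional F E ∧ Function.Surjective φ ∧
    LinearMap.ker φ = U.toSubmodule.submoduleOf U'.toSubmodule ∧
    (∀ s x, φ (U'.toRepresentation s x) = ψ s * φ x) ∧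
    IsCharacterWeights O L Ω F E ψ w

/-- `w` is the multiset of tame inertia weights of the `F`-representation `ρ` of `I_L`: the union
of the tame inertia weights of the factors of a Jordan-Hölder filtration
`0 = U 0 ⊂ U 1 ⊂ ⋯ ⊂ U m = W` by subrepresentations. -/
def IsResidualWeights {W : Type*} [AddCommGroup W] [Module F W]
    (ρ : Representation F (inertia O L Ω) W) (w : Multiset ℕ) : Prop :=
  ∃ (m : ℕ) (U : ℕ → Subrepresentation ρ) (v : ℕ → Multiset ℕ),
    U 0 = ⊥ ∧ U m = ⊤ ∧ (∀ i < m, U i ⋖ U (i + 1)) ∧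
    (∀ i < m, IsFactorWeights O L Ω (U i) (U (i + 1)) (v i)) ∧
    w = ∑ i ∈ Finset.range m, v i

end Inertia

section Residual

variable {F : Type*} [Field F] {G : Type*} [Group G] {V : Type*} [AddCommGroup V]
  [Module F⸨X⸩ V] [Module F⟦X⟧ V] [IsScalarTower F⟦X⟧ F⸨X⸩ V]

/-- The reduction `T / 𝔭 T` of an `A_𝔭`-submodule `T` of `V`, where `𝔭 A_𝔭 = (z)`. -/
def Residual (T : Submodule F⟦X⟧ V) : Type _ :=
  T ⧸ (Ideal.span {(PowerSeries.X : F⟦X⟧)} • ⊤ : Submodule F⟦X⟧ T)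

instance (T : Submodule F⟦X⟧ V) : AddCommGroup (Residual T) :=
  inferInstanceAs (AddCommGroup (T ⧸ (Ideal.span {(PowerSeries.X : F⟦X⟧)} • ⊤ :
    Submodule F⟦X⟧ T)))

instance (T : Submodule F⟦X⟧ V) : Module F⟦X⟧ (Residual T) :=
  inferInstanceAs (Module F⟦X⟧ (T ⧸ (Ideal.span {(PowerSeries.X : F⟦X⟧)} • ⊤ :
    Submodule F⟦X⟧ T)))

/-- The `F`-vector space structure of `T / 𝔭 T`. -/
instance (T : Submodule F⟦X⟧ V) : Module F (Residual T) :=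
  Module.compHom (Residual T) (PowerSeries.C (R := F))

/-- The action of `G` on a `G`-stable `A_𝔭`-submodule `T` of `V`. -/
def latticeRep (ρ : Representation F⸨X⸩ G V) (T : Submodule F⟦X⟧ V)
    (hT : ∀ g, ∀ x ∈ T, ρ g x ∈ T) : Representation F⟦X⟧ G T where
  toFun g := ((ρ g).restrictScalars F⟦X⟧).restrict (hT g)
  map_one' := by ext; simp
  map_mul' g g' := by
    ext x
    change ρ (g * g') (x : V) = ρ g (ρ g' (x : V))
    rw [map_mul, Module.End.mul_apply]

/-- The action of `G` on `T / 𝔭 T`, for a `G`-stable `A_𝔭`-submodule `T` of `V`. -/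
def residualRep (ρ : Representation F⸨X⸩ G V) (T : Submodule F⟦X⟧ V)
    (hT : ∀ g, ∀ x ∈ T, ρ g x ∈ T) : Representation F G (Residual T) where
  toFun g :=
    let f : Residual T →ₗ[F⟦X⟧] Residual T :=
      (latticeRep ρ T hT).quotient (Ideal.span {(PowerSeries.X : F⟦X⟧)} • ⊤)
        (fun g => by
          rw [← Submodule.map_le_iff_le_comap, Submodule.map_smul'']
          exact smul_mono_right _ le_top) g
    { toFun := f
      map_add' := map_add f
      map_smul' := fun a x => map_smul f (PowerSeries.C a) x }
  map_one' := by
    ext x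
    obtain ⟨x, rfl⟩ := Submodule.Quotient.mk_surjective _ x
    change Submodule.Quotient.mk (latticeRep ρ T hT 1 x) = Submodule.Quotient.mk x
    rw [map_one, Module.End.one_apply]
  map_mul' g g' := by
    ext x
    obtain ⟨x, rfl⟩ := Submodule.Quotient.mk_surjective _ x
    change Submodule.Quotient.mk (latticeRep ρ T hT (g * g') x) =
      Submodule.Quotient.mk (latticeRep ρ T hT g (latticeRep ρ T hT g' x))
    rw [map_mul, Module.End.mul_apply]

end Residual

/-- `w` is the multiset of tame inertia weights of the `𝔭`-adic representation `ρ` of `Gal(Ω/L)` on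
`V`: it is the multiset of tame inertia weights of the restriction to `I_L` of `T / 𝔭 T`, for some
Galois-stable `A_𝔭`-lattice `T` in `V`. -/
def IsTameInertiaWeights (O : Type*) [CommRing O] (L : Type*) [Field L] [Algebra O L]
    (Ω : Type*) [Field Ω] [Algebra O Ω] [Algebra L Ω] [IsScalarTower O L Ω]
    {F : Type*} [Field F] [Fintype F] [Algebra F Ω]
    {V : Type*} [AddCommGroup V] [Module F⸨X⸩ V] [Module F⟦X⟧ V] [IsScalarTower F⟦X⟧ F⸨X⸩ V]
    (ρ : Representation F⸨X⸩ (Ω ≃ₐ[L] Ω) V) (w : Multiset ℕ) : Prop :=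
  ∃ (T : Submodule F⟦X⟧ V) (_ : T.IsLattice F⸨X⸩) (hT : ∀ g, ∀ x ∈ T, ρ g x ∈ T),
    IsResidualWeights O L Ω ((residualRep ρ T hT).comp (inertia O L Ω).subtype) w

/-- The ramification index `e = ord_L(ζ)` of `L / γ(Q_𝔭)`. -/
def ramIndex {O : Type*} [CommRing O] [IsDomain O] [IsDiscreteValuationRing O] (ζ : O) : ℕ :=
  (IsDiscreteValuationRing.addVal O ζ).toNat

/-- If `ζ ≠ 0` in `O`, then its image in the extension `Ω` of the fraction field is not zero. -/
theorem algebraMap_ne_zero {O : Type*} [CommRing O] (L : Type*) [Field L] [Algebra O L]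
    [IsFractionRing O L] (Ω : Type*) [Field Ω] [Algebra O Ω] [Algebra L Ω] [IsScalarTower O L Ω]
    {ζ : O} (hζ : ζ ≠ 0) : algebraMap O Ω ζ ≠ 0 := by
  have hinj : Function.Injective (algebraMap O Ω) := by
    rw [IsScalarTower.algebraMap_eq O L Ω]
    exact (algebraMap L Ω).injective.comp (IsFractionRing.injective O L)
  rw [← map_zero (algebraMap O Ω)]
  exact hinj.ne hζ

end LocalTame

end

noncomputable section

namespace LocalTame

/-! ### Integral extensions of complete local rings -/

/-! In a basis of `M` the Frobenius is a matrix `A` over `O⟦z⟧` with `A B = (z - ζ)^h`. As `z - ζ`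
is prime, `det A` is a unit times `(z - ζ)^a`, and `a` is the dimension. Over `Ω⟦z⟧` the element `z
- ζ` is invertible, so Lang's theorem (`exists_lang_powerSeries`) gives an invertible `X = A σ̂(X)`.
Its columns form an `F⟦z⟧`-basis of the dual Tate module, on which Galois acts by matrices `ρ(s)`
with `s(X) = X ρ(s)` (`LocalShtuka.exists_tate_basis`).

Modulo `z` this becomes `X = A X^(q)` over the valued field `Ω`, where `A` is integral and divides a
scalar of order `eh`, and `det A` has order `e a`. The inertia group `G` preserves the valuation,
fixes the algebraic closure `k` of `F` in `Ω`, and has a fixed field of uniformizer `π`. It has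
common eigenvectors over `k`, so `X g = Z U` with `g` constant over `k`, `Z` integral, invertible
and `G`-fixed, and `U` upper triangular (`IsInertial.exists_triangular`). Choose `R` such that the
`q^R`-Frobenius fixes `g`. Iterating the equation `R` times turns it into `U = C U^(q^R)` with `C`
upper triangular, integral and `G`-fixed. The diagonal entries satisfy `c_j u_j^(q^R - 1) = 1`. If
`c_j` has order `m_j`, then `G` acts on `u_j` by the `(-m_j)`-th power of the tame character `θ_R`
of level `R`, hence by `θ_R^{m_j}` after passing to the dual. With `g_R = 1 + q + ⋯ + q^(R-1)` the
iteration also shows `m_j ≤ e h g_R` and `∑ m_j = e a g_R` (`IsInertial.exists_exponents`).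

So inertia acts on the reduction of the Tate module with characteristic polynomials `∏ (T -
θ_R(s)^{m_j})`, and the same holds for every stable lattice, since the polynomial over `F⸨z⸩`
already has coefficients in `F⟦z⟧`. On the other hand, a Jordan–Hölder factor with character
`θ_r^n`, `r ∣ R`, contributes the exponents `c (n q^l mod (q^r - 1))` for `0 ≤ l < r`, where `c =
(q^R - 1) / (q^r - 1)`. All exponents are below `Q = q^R - 1`; for the `m_j` this is where `eh < q -
1` enters. Evaluating at a single `s` for which `θ_R(s)` has exact order `Q` therefore identifies
the two multisets (`HasExponents.weights`).

The map `m ↦ ⌊q m / Q⌋` reads off the leading base-`q` digit and sends the contribution of a factor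
to its tame inertia weights. The bound on `m_j` makes this digit at most `eh`. Summing `q x = x' + Q
· digit` around each cycle of shifts gives `(q - 1) ∑ m_j = Q ∑ weights`, so the weights sum to `e
a`.

Existence of the weights amounts to showing that each irreducible factor is a character of a finite
extension of `F` (`exists_character`). -/

theorem isPrecomplete_of_finite {R : Type*} [CommRing R] [IsNoetherianRing R] (I : Ideal R)
    [IsAdicComplete I R] (M : Type*) [AddCommGroup M] [Module R M] [Module.Finite R M] :
    IsPrecomplete I M := by
  rw [← AdicCompletion.of_surjective_iff]
  intro y
  obtain ⟨t, rfl⟩ := AdicCompletion.ofTensorProduct_surjective_of_finite I M y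
  induction t using TensorProduct.induction_on with
  | zero => exact ⟨0, by simp⟩
  | add a b ha hb =>
    obtain ⟨a', ha⟩ := ha
    obtain ⟨b', hb⟩ := hb
    exact ⟨a' + b', by rw [map_add, ha, hb, map_add]⟩
  | tmul r m =>
    obtain ⟨r, rfl⟩ := AdicCompletion.of_surjective I R r
    refine ⟨r • m, ?_⟩
    rw [AdicCompletion.ofTensorProduct_tmul, map_smul]
    ext n
    rfl

theorem henselianRing_of_finite {R : Type*} [CommRing R] [IsNoetherianRing R] [IsLocalRing R]
    [IsAdicComplete (IsLocalRing.maximalIdeal R) R] (C : Type*) [CommRing C] [Algebra R C]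
    [Module.Finite R C] :
    HenselianRing C ((IsLocalRing.maximalIdeal R).map (algebraMap R C)) := by
  have h1 : IsPrecomplete ((IsLocalRing.maximalIdeal R).map (algebraMap R C)) C :=
    IsPrecomplete.map_algebraMap_iff.mpr (isPrecomplete_of_finite _ C)
  have h2 : IsHausdorff ((IsLocalRing.maximalIdeal R).map (algebraMap R C)) C :=
    IsHausdorff.map_algebraMap_iff.mpr inferInstance
  have : IsAdicComplete ((IsLocalRing.maximalIdeal R).map (algebraMap R C)) C := { h1, h2 with }
  infer_instance

/-- A finite extension domain of a complete Noetherian local ring is local. -/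
theorem isUnit_or_isUnit_one_sub_of_finite {R : Type*} [CommRing R] [IsNoetherianRing R]
    [IsLocalRing R] [IsAdicComplete (IsLocalRing.maximalIdeal R) R] {C : Type*} [CommRing C]
    [IsDomain C] [Algebra R C] [Module.Finite R C] (b : C) : IsUnit b ∨ IsUnit (1 - b) := by
  set J := (IsLocalRing.maximalIdeal R).map (algebraMap R C) with hJ
  have hH : HenselianRing C J := henselianRing_of_finite C
  have hunit (x : C) (hx : IsUnit (Ideal.Quotient.mk J x)) : IsUnit x :=
    (isLocalHom_of_le_jacobson_bot J hH.jac).map_nonunit x hx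
  let k := IsLocalRing.ResidueField R
  let alg : Algebra k (C ⧸ J) := Ideal.Quotient.algebraQuotientOfLEComap
    (Ideal.le_comap_map : IsLocalRing.maximalIdeal R ≤ J.comap (algebraMap R C))
  have : IsScalarTower R k (C ⧸ J) := IsScalarTower.of_algebraMap_eq fun x => rfl
  have : Module.Finite k (C ⧸ J) := Module.Finite.of_restrictScalars_finite R k (C ⧸ J)
  have : IsArtinianRing (C ⧸ J) := isArtinian_of_tower k inferInstance
  set β := Ideal.Quotient.mk J b
  -- Powers of `β` stabilize in the Artinian ring `C ⧸ J`: from `β^(n+1) c = β^n` it follows that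
  -- `β^n c^n` is idempotent. Hensel lifts it to a root of `X² - X` in the domain `C`, so to `0` or
  -- `1`; the first makes `β` nilpotent, the second makes it a unit.
  obtain ⟨n, c, hc⟩ := IsArtinian.exists_pow_succ_smul_dvd (M := C ⧸ J) β 1
  simp only [smul_eq_mul, mul_one] at hc
  have key (i : ℕ) : β ^ (n + i) * c ^ i = β ^ n := by
    induction i with
    | zero => simp
    | succ i ih =>
      calc β ^ (n + (i + 1)) * c ^ (i + 1) = β ^ i * c ^ i * (β ^ (n + 1) * c) := by ring
        _ = β ^ (n + i) * c ^ i := by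
          rw [show β ^ (n + 1) * c = β ^ n from hc]; ring
        _ = _ := ih
  obtain ⟨e, he⟩ := Ideal.Quotient.mk_surjective (β ^ n * c ^ n)
  have hee : β ^ n * c ^ n * (β ^ n * c ^ n) = β ^ n * c ^ n := by
    calc _ = β ^ (n + n) * c ^ n * c ^ n := by ring
      _ = _ := by rw [key]
  have hidem : Ideal.Quotient.mk J (e * e - e) = 0 := by
    rw [map_sub, map_mul, he, hee, sub_self]
  obtain ⟨a, ha, hae⟩ := hH.is_henselian (Polynomial.X ^ 2 - Polynomial.X)
    (Polynomial.monic_X_pow_sub (by simp)) e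
    (by
      rw [← Ideal.Quotient.eq_zero_iff_mem, ← hidem]
      simp [pow_two])
    (by
      refine IsUnit.of_mul_eq_one (Ideal.Quotient.mk J (2 * e - 1)) ?_
      simp only [Polynomial.derivative_sub, Polynomial.derivative_X_pow, Polynomial.derivative_X,
        Polynomial.eval_sub, Polynomial.eval_mul, Polynomial.eval_pow, Polynomial.eval_X,
        Polynomial.eval_one, Polynomial.eval_C, ← map_mul]
      -- The derivative `2e - 1` is its own inverse modulo `J`.
      have : (((2 : ℕ) : C) * e ^ (2 - 1) - 1) * (2 * e - 1) = 4 * (e * e - e) + 1 := by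
        push_cast; ring
      rw [this, map_add, map_mul, hidem]
      simp)
  have ha' : a * (a - 1) = 0 := by
    have : a ^ 2 - a = 0 := by simpa [Polynomial.IsRoot] using ha
    linear_combination this
  have hae' : Ideal.Quotient.mk J a = β ^ n * c ^ n := by
    rw [← he, ← sub_eq_zero, ← map_sub]
    exact Ideal.Quotient.eq_zero_iff_mem.mpr hae
  rcases mul_eq_zero.mp ha' with h | h
  · right
    apply hunit
    have h0 : β ^ n = 0 := by
      rw [← key n, pow_add, mul_assoc, ← hae', h, map_zero, mul_zero]
    rw [map_sub, map_one]
    exact IsNilpotent.isUnit_one_sub ⟨n, h0⟩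
  -- For `n = 0` the idempotent is `1` whatever `β` is; invertibility then comes from `β c = 1`
  -- directly.
  · rcases Nat.eq_zero_or_pos n with rfl | hn
    · left
      apply hunit
      refine IsUnit.of_mul_eq_one c ?_
      simpa using hc
    · left
      apply hunit
      rw [sub_eq_zero.mp h, map_one] at hae'
      have : IsUnit (β ^ n) := IsUnit.of_mul_eq_one _ hae'.symm
      exact (isUnit_pow_iff hn.ne').mp this

theorem isLocalRing_of_isIntegral (R : Type*) [CommRing R] [IsNoetherianRing R]
    [IsLocalRing R] [IsAdicComplete (IsLocalRing.maximalIdeal R) R] (D : Type*) [CommRing D]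
    [IsDomain D] [Algebra R D] [Algebra.IsIntegral R D] : IsLocalRing D := by
  refine IsLocalRing.of_isUnit_or_isUnit_one_sub_self fun b => ?_
  let C := Algebra.adjoin R {b}
  have : Module.Finite R C :=
    Algebra.finite_adjoin_simple_of_isIntegral (Algebra.IsIntegral.isIntegral b)
  have hb : b ∈ C := Algebra.subset_adjoin rfl
  rcases isUnit_or_isUnit_one_sub_of_finite (R := R) (⟨b, hb⟩ : C) with h | h
  · exact Or.inl (h.map C.val)
  · exact Or.inr (h.map C.val)

/-! ### The valuation on the separable closure, and the fixed field of inertia -/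

section

variable (O : Type*) [CommRing O] [IsDomain O] [IsDiscreteValuationRing O]
    [IsAdicComplete (IsLocalRing.maximalIdeal O) O]
    (L : Type*) [Field L] [Algebra O L] [IsFractionRing O L]
    (Ω : Type*) [Field Ω] [Algebra L Ω] [Algebra O Ω] [IsScalarTower O L Ω]

theorem isLocalRing_integralClosure : IsLocalRing (integralClosure O Ω) :=
  isLocalRing_of_isIntegral O _

/-- In the finite separable extension `L(x)` the integral closure of `O` is Dedekind, and local by
completeness, hence a valuation ring. -/
theorem mem_integralClosure_or_inv_mem [Algebra.IsSeparable L Ω] (x : Ω) :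
    x ∈ integralClosure O Ω ∨ x⁻¹ ∈ integralClosure O Ω := by
  let E := IntermediateField.adjoin L {x}
  have hint : IsIntegral L x := (Algebra.IsSeparable.isSeparable L x).isIntegral
  have : FiniteDimensional L E := IntermediateField.adjoin.finiteDimensional hint
  have : Algebra.IsSeparable L E := inferInstance
  have : IsScalarTower O L E := inferInstance
  have : IsScalarTower O E Ω := IsScalarTower.of_algebraMap_eq fun r => by
    rw [IsScalarTower.algebraMap_apply O L Ω, IsScalarTower.algebraMap_apply O L E]
    rfl
  have h1 : IsDedekindDomain (integralClosure O E) := integralClosure.isDedekindDomain O L E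
  have : IsNoetherianRing (integralClosure O E) := h1.toIsNoetherian
  have h2 : IsLocalRing (integralClosure O E) := isLocalRing_integralClosure O E
  have h3 : IsFractionRing (integralClosure O E) E :=
    integralClosure.isFractionRing_of_finite_extension L E
  have h4 : ValuationRing (integralClosure O E) :=
    ((tfae_of_isNoetherianRing_of_isLocalRing_of_isDomain (integralClosure O E)).out 2 1).mp h1
  let y : E := ⟨x, IntermediateField.mem_adjoin_simple_self L x⟩
  rcases (ValuationRing.isInteger_or_isInteger (integralClosure O E) y) with ⟨z, hz⟩ | ⟨z, hz⟩
  · left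
    have : IsIntegral O (y : E) := hz ▸ z.2
    exact this.map (IsScalarTower.toAlgHom O E Ω)
  · right
    have : IsIntegral O (y⁻¹ : E) := hz ▸ z.2
    exact this.map (IsScalarTower.toAlgHom O E Ω)

variable [IsSepClosure L Ω]

/-- The valuation ring of the separable closure: the integral closure of `O`. -/
def intVal : ValuationSubring Ω :=
  have := (IsSepClosure.separable : Algebra.IsSeparable L Ω)
  ValuationSubring.ofSubring (integralClosure O Ω).toSubring (mem_integralClosure_or_inv_mem O L Ω)

variable {Ω} in
theorem valuation_le_one_iff_integral {x : Ω} :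
    (intVal O L Ω).valuation x ≤ 1 ↔ x ∈ integralClosure O Ω :=
  ValuationSubring.valuation_le_one_iff _ x

theorem mem_maximalIdeal_iff [IsLocalRing (integralClosure O Ω)] (b : integralClosure O Ω) :
    b ∈ IsLocalRing.maximalIdeal (integralClosure O Ω) ↔ (intVal O L Ω).valuation b < 1 := by
  refine Iff.trans ?_ (ValuationSubring.valuation_lt_one_iff (intVal O L Ω) ⟨b, b.2⟩)
  exact Iff.rfl

instance finite_orbit (x : Ω) : Finite (MulAction.orbit (Ω ≃ₐ[L] Ω) x) := by
  have hx : IsIntegral L x := (IsGalois.integral L x)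
  refine Set.Finite.subset (Polynomial.rootSet_finite (minpoly L x) Ω) ?_
  rintro _ ⟨s, rfl⟩
  rw [Polynomial.mem_rootSet]
  refine ⟨minpoly.ne_zero hx, ?_⟩
  change Polynomial.aeval (s x) _ = 0
  rw [← AlgEquiv.coe_toAlgHom, Polynomial.aeval_algHom_apply, minpoly.aeval, map_zero]

theorem smul_mem_integralClosure {x : Ω} (s : Ω ≃ₐ[L] Ω) (hx : x ∈ integralClosure O Ω) :
    s x ∈ integralClosure O Ω :=
  (s • (⟨x, hx⟩ : integralClosure O Ω)).2

theorem valuation_galois_le (s : Ω ≃ₐ[L] Ω) {x y : Ω}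
    (h : (intVal O L Ω).valuation x ≤ (intVal O L Ω).valuation y) :
    (intVal O L Ω).valuation (s x) ≤ (intVal O L Ω).valuation (s y) := by
  rw [ValuationSubring.valuation_le_iff] at h ⊢
  obtain ⟨a, rfl⟩ := h
  exact ⟨⟨s a, smul_mem_integralClosure O L Ω s a.2⟩, by simp⟩

/-- Some power `s^n`, `n > 0`, fixes `x`. Since `s` preserves the order, the valuations of `x, s x,
s² x, …` are monotone; returning to the start forces them to be constant. -/
theorem valuation_galois (s : Ω ≃ₐ[L] Ω) (x : Ω) :
    (intVal O L Ω).valuation (s x) = (intVal O L Ω).valuation x := by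
  obtain ⟨n, hn, h⟩ : ∃ n, 0 < n ∧ (s ^ n) x = x := by
    have hf : (Set.range fun n : ℕ => (s ^ n) x).Finite :=
      (Set.toFinite (MulAction.orbit (Ω ≃ₐ[L] Ω) x)).subset (by
        rintro _ ⟨n, rfl⟩
        exact ⟨s ^ n, rfl⟩)
    obtain ⟨a, b, hab, h⟩ : ∃ a b, a < b ∧ (s ^ a) x = (s ^ b) x := by
      by_contra! hne
      refine Set.infinite_range_of_injective (f := fun n : ℕ => (s ^ n) x) ?_ hf
      intro a b h
      rcases lt_trichotomy a b with h' | h' | h'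
      · exact absurd h (hne _ _ h')
      · exact h'
      · exact absurd h.symm (hne _ _ h')
    refine ⟨b - a, Nat.sub_pos_of_lt hab, (s ^ a).injective ?_⟩
    rw [← AlgEquiv.mul_apply, ← pow_add, Nat.add_sub_cancel' hab.le, h]
  have key (t : Ω ≃ₐ[L] Ω) (ht : (intVal O L Ω).valuation (t x) ≤ (intVal O L Ω).valuation x)
      (m : ℕ) : (intVal O L Ω).valuation ((t ^ (m + 1)) x) ≤ (intVal O L Ω).valuation (t x) := by
    induction m with
    | zero => simp
    | succ m ih =>
      rw [pow_succ', AlgEquiv.mul_apply]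
      exact valuation_galois_le O L Ω t (ih.trans ht)
  have key' (t : Ω ≃ₐ[L] Ω) (ht : (intVal O L Ω).valuation x ≤ (intVal O L Ω).valuation (t x))
      (m : ℕ) : (intVal O L Ω).valuation (t x) ≤ (intVal O L Ω).valuation ((t ^ (m + 1)) x) := by
    induction m with
    | zero => simp
    | succ m ih =>
      rw [pow_succ' t (m + 1), AlgEquiv.mul_apply]
      exact valuation_galois_le O L Ω t (ht.trans ih)
  obtain ⟨m, rfl⟩ := Nat.exists_eq_succ_of_ne_zero hn.ne'
  rcases le_total ((intVal O L Ω).valuation (s x)) ((intVal O L Ω).valuation x) with h' | h'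
  · refine le_antisymm h' ?_
    have := key s h' m
    rwa [← Nat.succ_eq_add_one, h] at this
  · refine le_antisymm ?_ h'
    have := key' s h' m
    rwa [← Nat.succ_eq_add_one, h] at this

theorem mem_inertia_iff {s : Ω ≃ₐ[L] Ω} : s ∈ inertia O L Ω ↔
    ∀ x ∈ integralClosure O Ω, (intVal O L Ω).valuation (s x - x) < 1 := by
  have := isLocalRing_integralClosure O Ω
  have h (x : integralClosure O Ω) : (s • x - x ∈ (⊥ : Ideal (integralClosure O Ω)).jacobson) ↔
      (intVal O L Ω).valuation (s x - x) < 1 := by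
    rw [IsLocalRing.jacobson_eq_maximalIdeal ⊥ bot_ne_top, mem_maximalIdeal_iff O L Ω]
    rfl
  constructor
  · intro hs x hx
    exact (h ⟨x, hx⟩).mp (hs ⟨x, hx⟩)
  · intro hs x
    exact (h x).mpr (hs x x.2)

theorem isOpen_setOf_apply_eq (x c : Ω) : IsOpen {g : Ω ≃ₐ[L] Ω | g x = c} := by
  rw [isOpen_iff_forall_mem_open]
  intro g hg
  have hint : IsIntegral L x := IsGalois.integral L x
  have : FiniteDimensional L (IntermediateField.adjoin L {x}) :=
    IntermediateField.adjoin.finiteDimensional hint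
  refine ⟨(fun t => g⁻¹ * t) ⁻¹' ((IntermediateField.adjoin L {x}).fixingSubgroup), ?_, ?_, ?_⟩
  · intro t ht
    have h := (IntermediateField.mem_fixingSubgroup_iff _ _).mp ht x
      (IntermediateField.mem_adjoin_simple_self L x)
    have h2 : g (g⁻¹ (t x)) = t x := by rw [← AlgEquiv.mul_apply, mul_inv_cancel]; rfl
    change t x = c
    have h' : g⁻¹ (t x) = x := h
    rw [← h2, h']
    exact hg
  · exact (IntermediateField.fixingSubgroup_isOpen _).preimage (continuous_const_mul g⁻¹)
  · simp [one_mem]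

/-- The automorphism of the residue field induced by `s` is trivial on the residues of integers of
`E`. The profinite group `Gal(Ω/E)` acts on the integral closure and its decomposition group
surjects onto the residual automorphisms over the invariants, so some `g` fixing `E` induces the
same residual automorphism as `s`. -/
theorem exists_fixing_mul_mem_inertia (E : IntermediateField L Ω) (s : Ω ≃ₐ[L] Ω)
    (hs : ∀ x ∈ E, x ∈ integralClosure O Ω → (intVal O L Ω).valuation (s x - x) < 1) :
    ∃ g ∈ E.fixingSubgroup, g⁻¹ * s ∈ inertia O L Ω := by
  have hloc := isLocalRing_integralClosure O Ω
  let H := E.fixingSubgroup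
  let B := integralClosure O Ω
  let Q := IsLocalRing.maximalIdeal B
  let A := FixedPoints.subalgebra O B H
  let P := Q.under A
  have : Q.LiesOver P := ⟨rfl⟩
  have : CompactSpace H := isCompact_iff_compactSpace.mp
    (InfiniteGalois.fixingSubgroup_isClosed E).isCompact
  -- The discrete topology: stabilizers of elements are open, so the action is continuous.
  let : TopologicalSpace B := ⊥
  have : DiscreteTopology B := ⟨rfl⟩
  have : ContinuousSMul H B := by
    refine ⟨continuous_prod_of_discrete_right.mpr fun b => ?_⟩
    refine continuous_discrete_rng.mpr fun c => ?_
    have h := (isOpen_setOf_apply_eq L Ω (b : Ω) c).preimage (continuous_subtype_val (p := (· ∈ H)))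
    convert h using 1
    ext g
    exact Subtype.ext_iff
  have : Algebra.IsInvariant A B H := ⟨fun b hb => ⟨⟨b, hb⟩, rfl⟩⟩
  have hQ : Q = Q.map (MulSemiringAction.toRingEquiv _ B s : B →+* B) := by
    exact (IsLocalRing.map_maximalIdeal_of_surjective
      (MulSemiringAction.toRingEquiv _ B s : B →+* B)
      (MulSemiringAction.toRingEquiv _ B s).surjective).symm
  let e : (B ⧸ Q) ≃ₐ[A ⧸ P] (B ⧸ Q) := AlgEquiv.ofRingEquiv
    (f := Ideal.quotientEquiv Q Q (MulSemiringAction.toRingEquiv _ B s) hQ) (by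
      intro a
      obtain ⟨a, rfl⟩ := Ideal.Quotient.mk_surjective a
      change Ideal.Quotient.mk Q (s • (a : B)) = Ideal.Quotient.mk Q (a : B)
      rw [Ideal.Quotient.eq, mem_maximalIdeal_iff O L Ω]
      have ha : ∀ g ∈ H, g ((a : B) : Ω) = ((a : B) : Ω) := fun g hg =>
        congrArg Subtype.val (a.2 ⟨g, hg⟩)
      refine hs _ ?_ (a : B).2
      rw [← InfiniteGalois.fixedField_fixingSubgroup E]
      exact fun g => ha g.1 g.2)
  obtain ⟨g, hg⟩ := Ideal.Quotient.stabilizerHom_surjective_of_profinite (G := H) P Q e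
  refine ⟨g.1, g.1.2, ?_⟩
  rw [mem_inertia_iff]
  intro x hx
  have h1 : Ideal.Quotient.mk Q (g.1 • (⟨x, hx⟩ : B)) = Ideal.Quotient.mk Q (s • (⟨x, hx⟩ : B)) :=
    AlgEquiv.congr_fun hg (Ideal.Quotient.mk Q ⟨x, hx⟩)
  rw [eq_comm, Ideal.Quotient.eq, mem_maximalIdeal_iff O L Ω] at h1
  rw [← valuation_galois O L Ω (g.1 : Ω ≃ₐ[L] Ω), map_sub, ← AlgEquiv.mul_apply,
    mul_inv_cancel_left]
  exact h1

theorem exists_algEquiv_extending (E : IntermediateField L Ω) (σ : E →ₐ[L] Ω) :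
    ∃ s : Ω ≃ₐ[L] Ω, ∀ x : E, s x = σ x := by
  let τ : Ω →ₐ[L] Ω := AlgHom.liftNormal σ Ω
  have hτ : Function.Bijective τ := Algebra.IsAlgebraic.algHom_bijective τ
  exact ⟨AlgEquiv.ofBijective τ hτ, fun x => AlgHom.liftNormal_commutes σ Ω x⟩

/-- This says that `L(x)/L` is unramified. Distinct embeddings of `E = L(x)` into `Ω` stay distinct
after reduction: if two agree residually, they differ by an element fixing `E` times an inertia
element, and both fix `x`. By independence of characters the matrix of reduced embeddings on an
`O`-basis of the integers is invertible. It kills the reduced coordinates of `y` when `v y < 1`, so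
these coordinates are divisible by `π`. -/
theorem exists_mul_eq_of_fixed {x : Ω} (hfix : ∀ s ∈ inertia O L Ω, s x = x) {π : O}
    (hπ : Irreducible π) {E : IntermediateField L Ω} (hE : E = IntermediateField.adjoin L {x})
    (y : integralClosure O E) (hy : (intVal O L Ω).valuation (y : E) < 1) :
    algebraMap O _ π ∣ y := by
  have hint : IsIntegral L x := IsGalois.integral L x
  have : FiniteDimensional L E := hE ▸ IntermediateField.adjoin.finiteDimensional hint
  have : IsScalarTower O L E := inferInstance
  have : IsScalarTower O E Ω := IsScalarTower.of_algebraMap_eq fun r => by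
    rw [IsScalarTower.algebraMap_apply O L Ω, IsScalarTower.algebraMap_apply O L E]
    rfl
  let R := integralClosure O E
  let B := integralClosure O Ω
  have hloc : IsLocalRing B := isLocalRing_integralClosure O Ω
  let κ := IsLocalRing.ResidueField B
  have hTF : Module.IsTorsionFree O E := by
    have := (IsFractionRing.injective O L)
    exact Module.IsTorsionFree.trans_faithfulSMul O L E
  have hfree : Module.Free O R := IsIntegralClosure.module_free O L E R
  have hfinite : Module.Finite O R := IsIntegralClosure.finite O L E R
  -- By separability there are as many embeddings as basis elements, so the matrix below is square.
  have hrank : Nat.card (E →ₐ[L] Ω) = Module.finrank O R := by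
    rw [IsIntegralClosure.rank O L E R]
    exact AlgHom.natCard_of_splits L E Ω
      (fun z => (IsSepClosure.sep_closed L).splits_codomain _ (Algebra.IsSeparable.isSeparable L z))
  have hfin : Finite (E →ₐ[L] Ω) := inferInstance
  let ε : Fin (Module.finrank O R) ≃ (E →ₐ[L] Ω) := (Finite.equivFinOfCardEq hrank).symm
  let b : Module.Basis (Fin (Module.finrank O R)) O R := Module.finBasis O R
  have hmem (σ : E →ₐ[L] Ω) (r : R) : σ r ∈ B :=
    IsIntegral.map (σ.restrictScalars O) r.2
  let red (σ : E →ₐ[L] Ω) : R →+* κ := (IsLocalRing.residue B).comp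
    (((σ : E →+* Ω).comp (algebraMap R E)).codRestrict B.toSubring (hmem σ))
  have hred0 (σ : E →ₐ[L] Ω) (r : R) : red σ r = IsLocalRing.residue B ⟨σ r, hmem σ r⟩ := rfl
  have hredalg (σ : E →ₐ[L] Ω) (a : O) : red σ (algebraMap O R a) =
      IsLocalRing.residue B (algebraMap O B a) := by
    rw [hred0]
    congr 1
    apply Subtype.ext
    change σ (algebraMap O E a) = algebraMap O Ω a
    rw [IsScalarTower.algebraMap_apply O L E, σ.commutes, ← IsScalarTower.algebraMap_apply O L Ω]
  have hinj : Function.Injective fun σ => (red σ : R →* κ) := by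
    intro σ τ h
    obtain ⟨s, hs⟩ := exists_algEquiv_extending L Ω E σ
    obtain ⟨t, ht⟩ := exists_algEquiv_extending L Ω E τ
    obtain ⟨g, hg, hgi⟩ := exists_fixing_mul_mem_inertia O L Ω E (s⁻¹ * t) (by
      intro z hz hzint
      have hz' : IsIntegral O (⟨z, hz⟩ : E) := (isIntegral_algHom_iff
        (IsScalarTower.toAlgHom O E Ω) (algebraMap E Ω).injective).mp hzint
      have h1 : red τ ⟨⟨z, hz⟩, hz'⟩ = red σ ⟨⟨z, hz⟩, hz'⟩ := (DFunLike.congr_fun h _).symm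
      rw [hred0, hred0, ← sub_eq_zero, ← map_sub, IsLocalRing.residue_eq_zero_iff,
        mem_maximalIdeal_iff O L Ω] at h1
      rw [← valuation_galois O L Ω s, map_sub, AlgEquiv.mul_apply, ← AlgEquiv.mul_apply s,
        mul_inv_cancel, AlgEquiv.one_apply, hs ⟨z, hz⟩, ht ⟨z, hz⟩]
      exact h1)
    have hxE : x ∈ E := hE ▸ IntermediateField.mem_adjoin_simple_self L x
    have h2 := hfix _ hgi
    have h4 : t x = s (g x) := by
      nth_rewrite 2 [← h2]
      rw [← AlgEquiv.mul_apply, ← AlgEquiv.mul_apply]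
      congr 1
      group
    have hgx : g x = x := (IntermediateField.mem_fixingSubgroup_iff _ _).mp hg x hxE
    rw [hgx, hs ⟨x, hxE⟩, ht ⟨x, hxE⟩] at h4
    refine IntermediateField.algHom_ext_of_eq_adjoin L hE ?_
    intro z hz
    obtain rfl : z = x := hz
    exact h4.symm
  have hli : LinearIndependent κ fun σ : E →ₐ[L] Ω => (red σ : R → κ) :=
    (linearIndependent_monoidHom R κ).comp _ hinj
  have hexp (σ : E →ₐ[L] Ω) (r : R) : red σ r = ∑ j, IsLocalRing.residue B
      (algebraMap O B (b.repr r j)) * red σ (b j) := by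
    conv_lhs => rw [← b.sum_repr r, map_sum]
    refine Finset.sum_congr rfl fun j _ => ?_
    rw [Algebra.smul_def, map_mul, hredalg]
  let M : Matrix (Fin (Module.finrank O R)) (Fin (Module.finrank O R)) κ :=
    Matrix.of fun i j => red (ε i) (b j)
  have hM : IsUnit M := by
    rw [← Matrix.linearIndependent_rows_iff_isUnit, Fintype.linearIndependent_iff]
    intro c hc
    refine Fintype.linearIndependent_iff.mp (hli.comp ε ε.injective) c ?_
    ext r
    have h1 (j) : ∑ i, c i * red (ε i) (b j) = 0 := by
      have := congrFun hc j
      rw [Finset.sum_apply] at this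
      exact this
    rw [Finset.sum_apply, Pi.zero_apply]
    have h2 (i) : (c i • (fun σ : E →ₐ[L] Ω => (red σ : R → κ)) (ε i)) r = ∑ j, c i *
        (IsLocalRing.residue B (algebraMap O B (b.repr r j)) * red (ε i) (b j)) := by
      rw [← Finset.mul_sum, ← hexp]
      rfl
    refine (Finset.sum_congr rfl fun i _ => h2 i).trans ?_
    rw [Finset.sum_comm]
    refine Finset.sum_eq_zero fun j _ => ?_
    have := congrArg (fun t => IsLocalRing.residue B (algebraMap O B (b.repr r j)) * t) (h1 j)
    simp only [mul_zero, Finset.mul_sum] at this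
    rw [← this]
    exact Finset.sum_congr rfl fun i _ => by ring
  have hzero : M.mulVec (fun j => IsLocalRing.residue B (algebraMap O B (b.repr y j))) = 0 := by
    ext i
    have h1 : red (ε i) y = 0 := by
      obtain ⟨s, hs⟩ := exists_algEquiv_extending L Ω E (ε i)
      rw [hred0, IsLocalRing.residue_eq_zero_iff, mem_maximalIdeal_iff O L Ω]
      change (intVal O L Ω).valuation (ε i y) < 1
      rw [← hs, valuation_galois]
      exact hy
    rw [Pi.zero_apply, ← h1, hexp]
    simp only [Matrix.mulVec, dotProduct]
    exact Finset.sum_congr rfl fun j _ => mul_comm (red (ε i) (b j)) _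
  have hcoef (j) : π ∣ b.repr y j := by
    have h1 := congrFun (Matrix.mulVec_injective_of_isUnit hM (hzero.trans (Matrix.mulVec_zero M).symm)) j
    rw [Pi.zero_apply, IsLocalRing.residue_eq_zero_iff] at h1
    rw [← Ideal.mem_span_singleton, ← (IsDiscreteValuationRing.irreducible_iff_uniformizer π).mp hπ]
    by_contra hn
    rw [IsLocalRing.mem_maximalIdeal, mem_nonunits_iff, not_not] at hn
    exact h1 (hn.map (algebraMap O B))
  choose c hc using hcoef
  refine ⟨∑ j, c j • b j, ?_⟩
  conv_lhs => rw [← b.sum_repr y]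
  rw [Finset.mul_sum]
  refine Finset.sum_congr rfl fun j _ => ?_
  rw [hc j, mul_smul, Algebra.smul_def π]

theorem valuation_uniformizer_lt_one {π : O} (hπ : Irreducible π) :
    (intVal O L Ω).valuation (algebraMap O Ω π) < 1 := by
  have hlocB : IsLocalRing (integralClosure O Ω) := isLocalRing_integralClosure O Ω
  have hinj : Function.Injective (algebraMap O Ω) := by
    rw [IsScalarTower.algebraMap_eq O L Ω]
    exact (algebraMap L Ω).injective.comp (IsFractionRing.injective O L)
  refine (mem_maximalIdeal_iff O L Ω (algebraMap O (integralClosure O Ω) π)).mp ?_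
  rw [IsLocalRing.mem_maximalIdeal, mem_nonunits_iff]
  have hloc : IsLocalHom (algebraMap O (integralClosure O Ω)) := by
    refine RingHom.IsIntegral.isLocalHom (algebraMap_isIntegral_iff.mpr inferInstance) ?_
    exact fun a b h => hinj (congrArg Subtype.val h)
  exact fun h => hπ.not_isUnit (hloc.map_nonunit _ h)

/-- In the integers of `L(x)` every element of valuation `< 1` is divisible by `π`, so extracting
the maximal power of `π` leaves an element of valuation `1`; then pass to fractions. -/
theorem exists_valuation_eq_zpow_of_fixed {x : Ω} (hx : x ≠ 0)
    (hfix : ∀ s ∈ inertia O L Ω, s x = x) {π : O} (hπ : Irreducible π) :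
    ∃ k : ℤ, (intVal O L Ω).valuation x = (intVal O L Ω).valuation (algebraMap O Ω π) ^ k := by
  set E := IntermediateField.adjoin L {x} with hE
  have hint : IsIntegral L x := IsGalois.integral L x
  have : FiniteDimensional L E := IntermediateField.adjoin.finiteDimensional hint
  have : IsScalarTower O L E := inferInstance
  have : IsScalarTower O E Ω := IsScalarTower.of_algebraMap_eq fun r => by
    rw [IsScalarTower.algebraMap_apply O L Ω, IsScalarTower.algebraMap_apply O L E]
    rfl
  let R := integralClosure O E
  have hded : IsDedekindDomain R := integralClosure.isDedekindDomain O L E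
  have hnoeth : IsNoetherianRing R := hded.toIsNoetherian
  have hloc : IsLocalRing R := isLocalRing_integralClosure O E
  have hfrac : IsFractionRing R E := integralClosure.isFractionRing_of_finite_extension L E
  set v := (intVal O L Ω).valuation
  have hinjO : Function.Injective (algebraMap O Ω) := by
    rw [IsScalarTower.algebraMap_eq O L Ω]
    exact (algebraMap L Ω).injective.comp (IsFractionRing.injective O L)
  have hπ0 : algebraMap O Ω π ≠ 0 := by
    rw [← map_zero (algebraMap O Ω)]
    exact hinjO.ne hπ.ne_zero
  have hle (r : R) : v (r : E) ≤ 1 :=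
    (valuation_le_one_iff_integral O L).mpr (r.2.map (IsScalarTower.toAlgHom O E Ω))
  have hπR : ((algebraMap O R π : R) : E) = algebraMap O Ω π :=
    (IsScalarTower.algebraMap_apply O E Ω π).symm
  have hnu : ¬ IsUnit (algebraMap O R π) := by
    intro h
    obtain ⟨r, hr⟩ := h.exists_right_inv
    have h1 : v (algebraMap O Ω π) * v (r : E) = 1 := by
      rw [← hπR, ← map_mul, ← map_one v]
      exact congrArg v (congrArg (fun z : R => ((z : E) : Ω)) hr)
    exact absurd h1 (mul_lt_one_of_lt_of_le (valuation_uniformizer_lt_one O L Ω hπ) (hle r)).ne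
  have hpow (r : R) (hr : r ≠ 0) : ∃ k : ℕ, v (r : E) = v (algebraMap O Ω π) ^ k := by
    obtain ⟨c, hc, hcd⟩ := (FiniteMultiplicity.of_not_isUnit hnu hr).exists_eq_pow_mul_and_not_dvd
    refine ⟨multiplicity (algebraMap O R π) r, ?_⟩
    have h1 : v (c : E) = 1 := by
      refine le_antisymm (hle c) (not_lt.mp fun h => hcd ?_)
      exact exists_mul_eq_of_fixed O L Ω hfix hπ hE c h
    have h2 : ((r : E) : Ω) = algebraMap O Ω π ^ multiplicity (algebraMap O R π) r * (c : E) := by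
      rw [← hπR]
      exact congrArg (fun z : R => ((z : E) : Ω)) hc
    rw [h2, map_mul, map_pow, h1, mul_one]
  have hxE : x ∈ E := IntermediateField.mem_adjoin_simple_self L x
  obtain ⟨a, b, hb, hab⟩ := IsFractionRing.div_surjective (A := R) (⟨x, hxE⟩ : E)
  have hx' : x = ((a : E) : Ω) / ((b : E) : Ω) := (congrArg (fun z : E => (z : Ω)) hab).symm
  have hb0 : b ≠ 0 := nonZeroDivisors.ne_zero hb
  have ha0 : a ≠ 0 := by
    rintro rfl
    exact hx (by simpa using hx')
  obtain ⟨k, hk⟩ := hpow a ha0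
  obtain ⟨l, hl⟩ := hpow b hb0
  refine ⟨k - l, ?_⟩
  rw [hx', map_div₀, hk, hl, zpow_sub₀ ((Valuation.ne_zero_iff v).mpr hπ0), zpow_natCast,
    zpow_natCast]

end

/-! ### Groups acting like an inertia group on a valued field -/

/-- The group `G` acts on the valued field `Ω` like an inertia group: it preserves the valuation,
acts trivially on the residue field, has finite orbits, and the fixed field has uniformizer `π`. -/
structure IsInertial {Ω Γ : Type*} [Field Ω] [LinearOrderedCommGroupWithZero Γ]
    (v : Valuation Ω Γ) (π : Ω) (G : Type*) [Group G] [MulSemiringAction G Ω] : Prop where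
  map_smul (s : G) (x : Ω) : v (s • x) = v x
  sub_lt (s : G) (x : Ω) (hx : v x ≤ 1) : v (s • x - x) < 1
  fixed (x : Ω) (hx : x ≠ 0) (h : ∀ s : G, s • x = x) : ∃ k : ℤ, v x = v π ^ k
  finite_orbit (x : Ω) : (MulAction.orbit G x).Finite
  uniformizer_ne_zero : π ≠ 0
  uniformizer_lt : v π < 1
  uniformizer_fixed (s : G) : s • π = π

/-! ### Elements of `Ω` algebraic over the finite field -/

section Algebraic

variable {F : Type*} [Field F] [Fintype F] {Ω : Type*} [Field Ω] [Algebra F Ω]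

theorem exists_pow_eq_one {a : Ω} (ha : IsAlgebraic F a) (h0 : a ≠ 0) : ∃ n, 0 < n ∧ a ^ n = 1 := by
  have := IntermediateField.adjoin.finiteDimensional ha.isIntegral
  have : Finite (IntermediateField.adjoin F {a}) := Module.finite_of_finite F
  let b : IntermediateField.adjoin F {a} := ⟨a, IntermediateField.mem_adjoin_simple_self F a⟩
  have hb : b ≠ 0 := fun h => h0 (congrArg Subtype.val h)
  have := isOfFinOrder_of_finite (Units.mk0 b hb)
  obtain ⟨n, hn, h⟩ := this.exists_pow_eq_one
  exact ⟨n, hn, congrArg (fun u : (IntermediateField.adjoin F {a})ˣ => ((u : IntermediateField.adjoin F {a}) : Ω)) h⟩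

theorem exists_pow_card_pow_eq {a : Ω} (ha : IsAlgebraic F a) :
    ∃ r, 0 < r ∧ a ^ Fintype.card F ^ r = a := by
  have := IntermediateField.adjoin.finiteDimensional ha.isIntegral
  have : Finite (IntermediateField.adjoin F {a}) := Module.finite_of_finite F
  have := Fintype.ofFinite (IntermediateField.adjoin F {a})
  let b : IntermediateField.adjoin F {a} := ⟨a, IntermediateField.mem_adjoin_simple_self F a⟩
  refine ⟨Module.finrank F (IntermediateField.adjoin F {a}), Module.finrank_pos, ?_⟩
  have h := FiniteField.pow_card b
  rw [Module.card_eq_pow_finrank (K := F)] at h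
  exact congrArg Subtype.val h

theorem pow_card_pow_mul_eq {a : Ω} {q r : ℕ} (h : a ^ q ^ r = a) (k : ℕ) :
    a ^ q ^ (r * k) = a := by
  induction k with
  | zero => simp
  | succ k ih => rw [Nat.mul_succ, pow_add, pow_mul, ih, h]

theorem exists_common_pow_card_pow_eq {ι : Type*} [Finite ι] (a : ι → Ω)
    (ha : ∀ i, IsAlgebraic F (a i)) {r₀ : ℕ} (hr₀ : 0 < r₀) :
    ∃ r, 0 < r ∧ r₀ ∣ r ∧ ∀ i, a i ^ Fintype.card F ^ r = a i := by
  have := Fintype.ofFinite ι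
  choose r hr h using fun i => exists_pow_card_pow_eq (ha i)
  refine ⟨r₀ * ∏ i, r i, Nat.mul_pos hr₀ (Finset.prod_pos fun i _ => hr i), dvd_mul_right _ _,
    fun i => ?_⟩
  obtain ⟨k, hk⟩ := Finset.dvd_prod_of_mem r (Finset.mem_univ i)
  rw [hk, mul_left_comm]
  exact pow_card_pow_mul_eq (h i) _

/-- Algebraic extensions of `F` are perfect, so irreducible polynomials over them are separable and
already have roots in the separably closed field `Ω`. -/
instance isAlgClosed_algebraicClosure [IsSepClosed Ω] : IsAlgClosed (algebraicClosure F Ω) := by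
  let k := algebraicClosure F Ω
  have : PerfectField k := Algebra.IsAlgebraic.perfectField F
  refine IsAlgClosed.of_exists_root k fun P _ hP => ?_
  have hsep : P.Separable := PerfectField.separable_of_irreducible hP
  obtain ⟨x, hx⟩ := IsSepClosed.exists_aeval_eq_zero Ω P hP.degree_pos.ne' hsep
  have hxk : IsAlgebraic k x := ⟨P, hP.ne_zero, hx⟩
  have hxF : IsAlgebraic F x := hxk.restrictScalars F
  refine ⟨⟨x, mem_algebraicClosure_iff.mpr hxF⟩, ?_⟩
  apply (algebraMap k Ω).injective
  rw [map_zero, ← hx, Polynomial.aeval_def, Polynomial.eval₂_eq_eval_map]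
  exact (Polynomial.eval_map_apply (algebraMap k Ω) _).symm

variable {Γ : Type*} [LinearOrderedCommGroupWithZero Γ] (v : Valuation Ω Γ)

theorem valuation_eq_one_of_pow_eq_one {a : Ω} {n : ℕ} (hn : 0 < n) (h : a ^ n = 1) : v a = 1 := by
  have := congrArg v h
  rw [map_pow, map_one] at this
  rcases lt_trichotomy (v a) 1 with h1 | h1 | h1
  · exact absurd this (pow_lt_one₀ zero_le h1 hn.ne').ne
  · exact h1
  · exact absurd this (one_lt_pow₀ h1 hn.ne').ne'

theorem valuation_eq_one_of_isAlgebraic {a : Ω} (ha : IsAlgebraic F a) (h0 : a ≠ 0) : v a = 1 := by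
  obtain ⟨n, hn, h⟩ := exists_pow_eq_one ha h0
  exact valuation_eq_one_of_pow_eq_one v hn h

/-- Nonzero elements algebraic over `F` are roots of unity, so have valuation `1`: reduction is
injective on them. This upgrades residual congruences to equalities throughout. -/
theorem eq_of_isAlgebraic_of_valuation_sub_lt {a b : Ω} (ha : IsAlgebraic F a)
    (hb : IsAlgebraic F b) (h : v (a - b) < 1) : a = b := by
  by_contra hne
  exact h.ne (valuation_eq_one_of_isAlgebraic v (ha.sub hb) (sub_ne_zero.mpr hne))

end Algebraic

/-! ### Wild inertia and common eigenvectors -/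

namespace IsInertial

variable {F : Type*} [Field F] [Fintype F] {Ω : Type*} [Field Ω] [Algebra F Ω]
  {Γ : Type*} [LinearOrderedCommGroupWithZero Γ] {v : Valuation Ω Γ} {π : Ω}
  {G : Type*} [Group G] [MulSemiringAction G Ω] [SMulCommClass G F Ω] (hG : IsInertial v π G)

include hG

theorem smul_eq_of_isAlgebraic {a : Ω} (ha : IsAlgebraic F a) (s : G) : s • a = a := by
  refine eq_of_isAlgebraic_of_valuation_sub_lt v
    (IsAlgebraic.algHom (MulSemiringAction.toAlgHom F Ω s) ha) ha (hG.sub_lt s a ?_)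
  rcases eq_or_ne a 0 with rfl | h0
  · simp
  · exact (valuation_eq_one_of_isAlgebraic v ha h0).le

theorem smul_mul_eq (s : G) (a : algebraicClosure F Ω) (x : Ω) :
    s • ((a : Ω) * x) = a * s • x := by
  rw [smul_mul', hG.smul_eq_of_isAlgebraic (F := F) (mem_algebraicClosure_iff.mp a.2)]

theorem valuation_smul_div_self (s : G) {x : Ω} (hx : x ≠ 0) : v (s • x / x) = 1 := by
  rw [map_div₀, hG.map_smul, div_self ((Valuation.ne_zero_iff v).mpr hx)]

/-- The wild inertia subgroup. -/
def wild : Subgroup G where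
  carrier := {s | ∀ x, x ≠ 0 → v (s • x - x) < v x}
  one_mem' x hx := by simpa [zero_lt_iff] using hx
  mul_mem' {s t} hs ht x hx := by
    have h : (s * t) • x - x = (s • t • x - t • x) + (t • x - x) := by rw [mul_smul]; ring
    rw [h]
    refine v.map_add_lt ?_ (ht x hx)
    rw [← hG.map_smul t x]
    exact hs _ ((smul_ne_zero_iff_ne t).mpr hx)
  inv_mem' {s} hs x hx := by
    rw [← hG.map_smul s (s⁻¹ • x - x), smul_sub, smul_inv_smul, Valuation.map_sub_swap]
    exact hs x hx

instance wild_normal : hG.wild.Normal := ⟨fun s hs t x hx => by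
  have h := hs (t⁻¹ • x) ((smul_ne_zero_iff_ne _).mpr hx)
  rwa [← hG.map_smul t, smul_sub, smul_inv_smul, hG.map_smul, ← mul_smul, ← mul_smul] at h⟩

/-- As `t x / x` has valuation `1` and `s` acts trivially on residues, `s t x / x ≡ (t x / x)(s x /
x)`, which is symmetric in `s` and `t`. Hence `s t x` and `t s x` agree to leading order. -/
theorem commutator_mem_wild (s t : G) : (t * s)⁻¹ * (s * t) ∈ hG.wild := by
  intro x hx
  rw [← hG.map_smul (t * s), smul_sub, ← mul_smul, mul_inv_cancel_left, mul_smul, mul_smul]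
  have hvx : v x ≠ 0 := (Valuation.ne_zero_iff v).mpr hx
  have key (a b : G) : v (a • b • x / x - (b • x / x) * (a • x / x)) < 1 := by
    have h := hG.sub_lt a (b • x / x) (hG.valuation_smul_div_self b hx).le
    have h' : a • b • x / x - (b • x / x) * (a • x / x) =
        (a • (b • x / x) - b • x / x) * (a • x / x) := by
      have hax : a • x ≠ 0 := (smul_ne_zero_iff_ne a).mpr hx
      rw [smul_div₀']
      field_simp
    rw [h', map_mul, hG.valuation_smul_div_self a hx, mul_one]
    exact h
  have h : s • t • x - t • s • x =
      ((s • t • x / x - (t • x / x) * (s • x / x)) -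
      (t • s • x / x - (s • x / x) * (t • x / x))) * x := by
    field_simp
    ring
  rw [h, map_mul]
  refine mul_lt_of_lt_one_left (zero_lt_iff.mpr hvx) ?_
  exact v.map_sub_lt (key s t) (key t s)

theorem exists_pow_smul_eq (s : G) (x : Ω) : ∃ n, 0 < n ∧ s ^ n • x = x := by
  have hf : Finite (Set.range fun n : ℕ => s ^ n • x) :=
    (hG.finite_orbit x).subset (by rintro _ ⟨n, rfl⟩; exact ⟨s ^ n, rfl⟩)
  obtain ⟨a, b, hab, h⟩ : ∃ a b, a < b ∧ s ^ a • x = s ^ b • x := by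
    by_contra! hne
    refine Set.infinite_range_of_injective (f := fun n : ℕ => s ^ n • x) ?_ hf
    intro a b h
    rcases lt_trichotomy a b with h' | h' | h'
    · exact absurd h (hne _ _ h')
    · exact h'
    · exact absurd h.symm (hne _ _ h')
  refine ⟨b - a, Nat.sub_pos_of_lt hab, smul_left_cancel (s ^ a) ?_⟩
  rw [← mul_smul, ← pow_add, Nat.add_sub_cancel' hab.le, h]

/-- Let `y` be the average of the `s^j x`, `j < b`; it is fixed by `s`. The translates of `x - y`
sum to zero, yet wildness makes this sum equal to `b (x - y)` to leading order, and `b` has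
valuation `1`. So `x = y`. -/
theorem smul_eq_of_mem_wild {p : ℕ} [Fact p.Prime] [CharP Ω p] {s : G} (hs : s ∈ hG.wild) {b : ℕ}
    (hb : ¬ p ∣ b) {x : Ω} (hx : s ^ b • x = x) : s • x = x := by
  have hb0 : (b : Ω) ≠ 0 := by rwa [Ne, CharP.cast_eq_zero_iff Ω p]
  have hvb : v (b : Ω) = 1 := by
    let := ZMod.algebra Ω p
    refine valuation_eq_one_of_isAlgebraic (F := ZMod p) v ?_ hb0
    rw [← map_natCast (algebraMap (ZMod p) Ω) b]
    exact isAlgebraic_algebraMap _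
  have hfixb (s : G) : s • (b : Ω) = b := map_natCast (MulSemiringAction.toRingHom G Ω s) b
  set y := (∑ j ∈ Finset.range b, s ^ j • x) / b with hy
  have hsy : s • y = y := by
    rw [hy, smul_div₀', hfixb, Finset.smul_sum]
    congr 1
    have h1 := Finset.sum_range_succ (fun j => s ^ j • x) b
    rw [Finset.sum_range_succ' (fun j => s ^ j • x) b, hx, pow_zero, one_smul] at h1
    rw [← add_right_cancel h1]
    exact Finset.sum_congr rfl fun j _ => by rw [pow_succ', mul_smul]
  have hsjy (j : ℕ) : s ^ j • y = y := by
    induction j with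
    | zero => simp
    | succ j ih => rw [pow_succ', mul_smul, ih, hsy]
  rcases eq_or_ne (x - y) 0 with h0 | h0
  · rw [sub_eq_zero.mp h0, hsy]
  exfalso
  have hsum : ∑ j ∈ Finset.range b, s ^ j • (x - y) = 0 := by
    simp only [smul_sub, hsjy, Finset.sum_sub_distrib, Finset.sum_const, Finset.card_range,
      nsmul_eq_mul]
    rw [hy, mul_div_cancel₀ _ hb0, sub_self]
  have hlt : v (∑ j ∈ Finset.range b, (s ^ j • (x - y) - (x - y))) < v (x - y) :=
    v.map_sum_lt ((Valuation.ne_zero_iff v).mpr h0) fun j _ => pow_mem hs j (x - y) h0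
  rw [Finset.sum_sub_distrib, hsum, zero_sub, Valuation.map_neg, Finset.sum_const,
    Finset.card_range, nsmul_eq_mul, map_mul, hvb, one_mul] at hlt
  exact hlt.false

theorem exists_prime_pow_smul_eq {p : ℕ} [Fact p.Prime] [CharP Ω p] {s : G} (hs : s ∈ hG.wild)
    (x : Ω) : ∃ a, s ^ p ^ a • x = x := by
  obtain ⟨n, hn, h⟩ := hG.exists_pow_smul_eq s x
  obtain ⟨a, b, hb, rfl⟩ := Nat.exists_eq_pow_mul_and_not_dvd hn.ne' p (Fact.out : p.Prime).ne_one
  refine ⟨a, hG.smul_eq_of_mem_wild (pow_mem hs _) hb ?_⟩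
  rw [← pow_mul, h]

/-- A nonzero `Ω`-vector fixed by `s ^ n` on each coordinate. -/
theorem exists_prime_pow_smul_eq_pi {p : ℕ} [Fact p.Prime] [CharP Ω p] {ι : Type*} [Finite ι]
    {s : G} (hs : s ∈ hG.wild) (x : ι → Ω) : ∃ a, s ^ p ^ a • x = x := by
  have := Fintype.ofFinite ι
  choose a ha using fun i => hG.exists_prime_pow_smul_eq hs (x i)
  refine ⟨∑ i, a i, funext fun i => ?_⟩
  obtain ⟨k, hk⟩ := Nat.le.dest (Finset.single_le_sum (fun j _ => Nat.zero_le (a j)) (Finset.mem_univ i))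
  rw [Pi.smul_apply, ← hk, pow_add, pow_mul]
  exact pow_mem (show s ^ p ^ a i ∈ MulAction.stabilizer G (x i) from ha i) _

theorem finite_orbit_pi {ι : Type*} [Finite ι] (x : ι → Ω) : (MulAction.orbit G x).Finite := by
  refine (Set.Finite.pi' fun i => hG.finite_orbit (x i)).subset ?_
  rintro _ ⟨s, rfl⟩ i
  exact ⟨s, rfl⟩

/-- The wild inertia group fixes a nonzero vector in every nonzero stable additive subgroup. -/
theorem exists_wild_fixed {p : ℕ} [Fact p.Prime] [CharP Ω p] {ι : Type*} [Finite ι]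
    {x : ι → Ω} (hx : x ≠ 0) :
    ∃ y ∈ AddSubgroup.closure (MulAction.orbit G x), y ≠ 0 ∧ ∀ s ∈ hG.wild, s • y = y := by
  let T := AddSubgroup.closure (MulAction.orbit G x)
  have hxT : x ∈ T := AddSubgroup.subset_closure (MulAction.mem_orbit_self x)
  have hstable (s : G) (y : ι → Ω) (hy : y ∈ T) : s • y ∈ T := by
    induction hy using AddSubgroup.closure_induction with
    | mem z hz =>
      obtain ⟨t, rfl⟩ := hz
      exact AddSubgroup.subset_closure ⟨s * t, mul_smul _ _ _⟩
    | zero => rw [smul_zero]; exact zero_mem _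
    | add a b _ _ ha hb => rw [smul_add]; exact add_mem ha hb
    | neg a _ ha => rw [smul_neg]; exact neg_mem ha
  have hpT (y : T) : p • y = 0 := by
    apply Subtype.ext
    ext i
    simp
  -- Finitely generated because the orbit is finite, and killed by `p`.
  have hfinT : Finite T := by
    have hfg : AddGroup.FG T := by
      rw [AddGroup.fg_iff_addSubgroup_fg, AddSubgroup.fg_iff]
      exact ⟨_, rfl, hG.finite_orbit_pi x⟩
    refine AddCommGroup.finite_of_fg_isAddTorsion T ?_
    exact fun y => isOfFinAddOrder_iff_nsmul_eq_zero.mpr ⟨p, (Fact.out : p.Prime).pos, hpT y⟩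
  let act : hG.wild →* Equiv.Perm T :=
    { toFun := fun s =>
        { toFun := fun y => ⟨s.1 • (y : ι → Ω), hstable s.1 y y.2⟩
          invFun := fun y => ⟨s.1⁻¹ • (y : ι → Ω), hstable s.1⁻¹ y y.2⟩
          left_inv := fun y => Subtype.ext (inv_smul_smul _ _)
          right_inv := fun y => Subtype.ext (smul_inv_smul _ _) }
      map_one' := by
        ext y : 2
        exact one_smul G _
      map_mul' := fun s t => by
        ext y : 2
        exact mul_smul s.1 t.1 _ }
  have hpg : IsPGroup p act.range := by
    rintro ⟨_, s, rfl⟩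
    have := Fintype.ofFinite T
    choose a ha using fun y : T => hG.exists_prime_pow_smul_eq_pi s.2 (y : ι → Ω)
    refine ⟨∑ y, a y, ?_⟩
    apply Subtype.ext
    change act s ^ p ^ (∑ y, a y) = 1
    rw [← map_pow]
    ext y : 2
    change s.1 ^ p ^ (∑ y, a y) • (y : ι → Ω) = y
    obtain ⟨k, hk⟩ := Nat.le.dest
      (Finset.single_le_sum (fun j _ => Nat.zero_le (a j)) (Finset.mem_univ y))
    rw [← hk, pow_add, pow_mul]
    exact pow_mem (show s.1 ^ p ^ a y ∈ MulAction.stabilizer G (y : ι → Ω) from ha y) _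
  have hcard : p ∣ Nat.card T := by
    have h : addOrderOf (⟨x, hxT⟩ : T) = p :=
      addOrderOf_eq_prime (hpT _) fun h => hx (congrArg Subtype.val h)
    rw [← h]
    exact addOrderOf_dvd_natCard _
  -- A `p`-group acting on a set of order divisible by `p` has a number of fixed points divisible by
  -- `p`; `0` is one, so there is another.
  obtain ⟨y, hy, hy0⟩ := hpg.exists_fixed_point_of_prime_dvd_card_of_fixed_point T hcard
    (a := 0) (by
      rintro ⟨_, s, rfl⟩
      exact Subtype.ext (smul_zero s.1))
  refine ⟨y, y.2, fun h => hy0 (Subtype.ext h).symm, fun s hs => ?_⟩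
  exact congrArg Subtype.val (hy ⟨act ⟨s, hs⟩, ⟨s, hs⟩, rfl⟩)

/-- Take a minimal nonzero stable `k`-subspace `S`, with `k` the algebraic closure of `F` in `Ω`, on
which `G` acts `k`-linearly. The vectors fixed by wild inertia form a nonzero subspace, stable
because wild inertia is normal, so they fill `S`. Commutators being wild, `G` acts on `S` through
commuting operators; each eigenspace is stable, and `k` is algebraically closed, so every `s` is a
scalar on `S`. -/
theorem exists_common_eigenvector [IsSepClosed Ω] {ι : Type*} [Finite ι]
    (D : Submodule (algebraicClosure F Ω) (ι → Ω)) [FiniteDimensional (algebraicClosure F Ω) D]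
    (hD : D ≠ ⊥) (hs : ∀ (s : G), ∀ x ∈ D, s • x ∈ D) :
    ∃ y ∈ D, y ≠ 0 ∧ ∀ s : G, ∃ c : algebraicClosure F Ω, s • y = c • y := by
  let k := algebraicClosure F Ω
  obtain ⟨p, hp⟩ := CharP.exists F
  have hprime : Fact p.Prime := ⟨(CharP.char_is_prime_or_zero F p).resolve_right
    (CharP.char_ne_zero_of_finite F p)⟩
  have : CharP Ω p := charP_of_injective_algebraMap (algebraMap F Ω).injective p
  have hsmul (s : G) (c : k) (x : ι → Ω) : s • (c • x) = c • s • x :=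
    funext fun i => hG.smul_mul_eq s c (x i)
  have hind : ∀ n, ∀ S : Submodule k (ι → Ω), S ≤ D → S ≠ ⊥ → (∀ (s : G), ∀ x ∈ S, s • x ∈ S) →
      Module.finrank k S = n → ∃ S' : Submodule k (ι → Ω), S' ≤ D ∧ S' ≠ ⊥ ∧
      (∀ (s : G), ∀ x ∈ S', s • x ∈ S') ∧ ∀ S'' ≤ S', S'' ≠ ⊥ →
      (∀ (s : G), ∀ x ∈ S'', s • x ∈ S'') → S'' = S' := by
    intro n
    induction n using Nat.strong_induction_on with
    | _ n ih =>
      intro S hSD hS hst hn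
      have : FiniteDimensional k S := Submodule.finiteDimensional_of_le hSD
      by_cases hmin : ∀ S'' ≤ S, S'' ≠ ⊥ → (∀ (s : G), ∀ x ∈ S'', s • x ∈ S'') → S'' = S
      · exact ⟨S, hSD, hS, hst, hmin⟩
      · push Not at hmin
        obtain ⟨S'', hle, h0, hst'', hne⟩ := hmin
        exact ih _ (hn ▸ Submodule.finrank_lt_finrank_of_lt (lt_of_le_of_ne hle hne)) S''
          (hle.trans hSD) h0 hst'' rfl
  obtain ⟨S, hSD, hS0, hSst, hSmin⟩ := hind _ D le_rfl hD hs rfl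
  have : FiniteDimensional k S := Submodule.finiteDimensional_of_le hSD
  have hwild : ∀ t ∈ hG.wild, ∀ x ∈ S, t • x = x := by
    let W : Submodule k (ι → Ω) :=
      { carrier := {x | x ∈ S ∧ ∀ t ∈ hG.wild, t • x = x}
        zero_mem' := ⟨zero_mem _, fun t _ => smul_zero t⟩
        add_mem' := fun ha hb => ⟨add_mem ha.1 hb.1, fun t ht => by
          rw [smul_add, ha.2 t ht, hb.2 t ht]⟩
        smul_mem' := fun c x hx => ⟨S.smul_mem c hx.1, fun t ht => by rw [hsmul, hx.2 t ht]⟩ }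
    have hW : W = S := by
      refine hSmin W (fun x hx => hx.1) ?_ ?_
      · obtain ⟨x, hxS, hx0⟩ := S.ne_bot_iff.mp hS0
        obtain ⟨y, hy, hy0, hyw⟩ := hG.exists_wild_fixed (p := p) hx0
        refine (Submodule.ne_bot_iff _).mpr ⟨y, ⟨?_, hyw⟩, hy0⟩
        have : AddSubgroup.closure (MulAction.orbit G x) ≤ S.toAddSubgroup := by
          rw [AddSubgroup.closure_le]
          rintro _ ⟨s, rfl⟩
          exact hSst s x hxS
        exact this hy
      · intro s x hx
        refine ⟨hSst s x hx.1, fun t ht => ?_⟩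
        have h := hx.2 (s⁻¹ * t * s) (by
          simpa using (hG.wild_normal).conj_mem t ht s⁻¹)
        rw [mul_assoc, mul_smul, inv_smul_eq_iff, mul_smul] at h
        exact h
    intro t ht x hx
    exact ((hW ▸ hx : x ∈ W)).2 t ht
  have hcomm (s t : G) (x : ι → Ω) (hx : x ∈ S) : s • t • x = t • s • x := by
    have h := hwild _ (hG.commutator_mem_wild s t) x hx
    rwa [mul_smul, inv_smul_eq_iff, mul_smul, mul_smul] at h
  let act (s : G) : Module.End k S :=
    { toFun := fun x => ⟨s • (x : ι → Ω), hSst s x x.2⟩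
      map_add' := fun x y => Subtype.ext (smul_add s _ _)
      map_smul' := fun c x => Subtype.ext (hsmul s c x) }
  have : Nontrivial S := Submodule.nontrivial_iff_ne_bot.mpr hS0
  have hscalar (s : G) : ∃ c : k, ∀ x ∈ S, s • x = c • x := by
    obtain ⟨c, hc⟩ := Module.End.exists_eigenvalue (act s)
    obtain ⟨x, hx⟩ := hc.exists_hasEigenvector
    let W : Submodule k (ι → Ω) :=
      { carrier := {x | x ∈ S ∧ s • x = c • x}
        zero_mem' := ⟨zero_mem _, by simp⟩
        add_mem' := fun ha hb => ⟨add_mem ha.1 hb.1, by rw [smul_add, ha.2, hb.2, smul_add]⟩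
        smul_mem' := fun b x hx => ⟨S.smul_mem b hx.1, by rw [hsmul, hx.2, smul_comm]⟩ }
    have hW : W = S := by
      refine hSmin W (fun x hx => hx.1) ?_ ?_
      · exact (Submodule.ne_bot_iff _).mpr ⟨x, ⟨x.2, congrArg Subtype.val hx.apply_eq_smul⟩,
          fun h => hx.2 (Subtype.ext h)⟩
      · intro t x hx
        exact ⟨hSst t x hx.1, by rw [hcomm s t x hx.1, hx.2, hsmul]⟩
    exact ⟨c, fun x hx => (hW ▸ hx : x ∈ W).2⟩
  obtain ⟨x, hxS, hx0⟩ := S.ne_bot_iff.mp hS0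
  exact ⟨x, hSD hxS, hx0, fun s => (hscalar s).imp fun c hc => hc x hxS⟩

end IsInertial

/-! ### Simultaneous triangularization -/

/-- Put `c` in column `i` of the identity and swap columns `0` and `i`. Controlling the entries lets
integrality and invariance pass from `c` to the matrix. -/
theorem exists_matrix_col_zero {R : Type*} [CommRing R] {n : ℕ} (c : Fin (n + 1) → R)
    (i : Fin (n + 1)) : ∃ M : Matrix (Fin (n + 1)) (Fin (n + 1)) R, (∀ j, M j 0 = c j) ∧
      (∀ j k, M j k = 0 ∨ M j k = 1 ∨ ∃ l, M j k = c l) ∧ (M.det = c i ∨ M.det = - c i) := by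
  refine ⟨((1 : Matrix _ _ R).updateCol i c).submatrix id (Equiv.swap 0 i), ?_, ?_, ?_⟩
  · intro j
    simp
  · intro j k
    rw [Matrix.submatrix_apply]
    by_cases h : Equiv.swap 0 i k = i
    · right; right
      exact ⟨j, by rw [h]; simp⟩
    · rw [Matrix.updateCol_ne h, Matrix.one_apply]
      split_ifs
      · exact Or.inr (Or.inl rfl)
      · exact Or.inl rfl
  · have h1 : ((1 : Matrix _ _ R).updateCol i c).det = c i := by
      rw [← Matrix.cramer_apply, Matrix.cramer_one]
      rfl
    rw [Matrix.det_permute', h1]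
    rcases Int.units_eq_one_or (Equiv.Perm.sign (Equiv.swap 0 i)) with h | h <;> rw [h] <;> simp

/-- The block matrix with rows `(a, w)` and `(0, M)`. -/
def blockMatrix {R : Type*} [Zero R] {n : ℕ} (a : R) (w : Fin n → R) (M : Matrix (Fin n) (Fin n) R) :
    Matrix (Fin (n + 1)) (Fin (n + 1)) R :=
  Matrix.of (Fin.cons (Fin.cons a w) fun i => Fin.cons 0 (M i))

section Block

variable {R : Type*} [CommRing R] {n : ℕ} (a : R) (w : Fin n → R) (M : Matrix (Fin n) (Fin n) R)

@[simp] theorem blockMatrix_zero_zero : blockMatrix a w M 0 0 = a := rfl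
@[simp] theorem blockMatrix_zero_succ (j) : blockMatrix a w M 0 (Fin.succ j) = w j := rfl
@[simp] theorem blockMatrix_succ_zero (i) : blockMatrix a w M (Fin.succ i) 0 = 0 := rfl
@[simp] theorem blockMatrix_succ_succ (i j) :
    blockMatrix a w M (Fin.succ i) (Fin.succ j) = M i j := rfl

theorem eq_blockMatrix (N : Matrix (Fin (n + 1)) (Fin (n + 1)) R)
    (h : ∀ i : Fin n, N i.succ 0 = 0) :
    N = blockMatrix (N 0 0) (fun j => N 0 j.succ) (N.submatrix Fin.succ Fin.succ) := by
  ext i j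
  refine Fin.cases ?_ (fun i => ?_) i <;> refine Fin.cases ?_ (fun j => ?_) j <;> simp [h]

theorem blockMatrix_mul (a' : R) (w' : Fin n → R) (M' : Matrix (Fin n) (Fin n) R) :
    blockMatrix a w M * blockMatrix a' w' M' =
      blockMatrix (a * a') (a • w' + Matrix.vecMul w M') (M * M') := by
  ext i j
  refine Fin.cases ?_ (fun i => ?_) i <;> refine Fin.cases ?_ (fun j => ?_) j <;>
    simp [Matrix.mul_apply, Fin.sum_univ_succ, Matrix.vecMul, dotProduct]

theorem det_blockMatrix : (blockMatrix a w M).det = a * M.det := by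
  rw [Matrix.det_succ_column_zero, Fin.sum_univ_succ]
  simp only [blockMatrix_succ_zero, mul_zero, zero_mul, Finset.sum_const_zero, add_zero,
    Fin.val_zero, pow_zero, one_mul, blockMatrix_zero_zero]
  rfl

theorem map_blockMatrix {S : Type*} [CommRing S] (f : R →+* S) :
    (blockMatrix a w M).map f = blockMatrix (f a) (fun j => f (w j)) (M.map f) := by
  ext i j
  refine Fin.cases ?_ (fun i => ?_) i <;> refine Fin.cases ?_ (fun j => ?_) j <;> simp

end Block

namespace IsInertial

variable {F : Type*} [Field F] [Fintype F] {Ω : Type*} [Field Ω] [Algebra F Ω]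
  {Γ : Type*} [LinearOrderedCommGroupWithZero Γ] {v : Valuation Ω Γ} {π : Ω}
  {G : Type*} [Group G] [MulSemiringAction G Ω] [SMulCommClass G F Ω] (hG : IsInertial v π G)

include hG

theorem map_algebraicClosure {m n : Type*} (M : Matrix m n (algebraicClosure F Ω)) (s : G) :
    (M.map (algebraMap _ Ω)).map (MulSemiringAction.toRingHom G Ω s) =
      M.map (algebraMap (algebraicClosure F Ω) Ω) := by
  ext i j
  exact hG.smul_eq_of_isAlgebraic (F := F) (mem_algebraicClosure_iff.mp (M i j).2) s

/-- A matrix of solutions on which `G` acts through constant matrices can be triangularized, up to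
integral invertible matrices with coefficients fixed by `G`. -/
theorem exists_triangular [IsSepClosed Ω] {n : ℕ} (X : Matrix (Fin n) (Fin n) Ω) (hX : X.det ≠ 0)
    (ρ : G → Matrix (Fin n) (Fin n) (algebraicClosure F Ω))
    (hρ : ∀ s, X.map (MulSemiringAction.toRingHom G Ω s) = X * (ρ s).map (algebraMap _ Ω)) :
    ∃ (Z : Matrix (Fin n) (Fin n) Ω) (g : Matrix (Fin n) (Fin n) (algebraicClosure F Ω))
      (U : Matrix (Fin n) (Fin n) Ω), (∀ i j, v (Z i j) ≤ 1) ∧ v Z.det = 1 ∧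
      (∀ s : G, Z.map (MulSemiringAction.toRingHom G Ω s) = Z) ∧ g.det ≠ 0 ∧
      (∀ i j, j < i → U i j = 0) ∧ X * g.map (algebraMap _ Ω) = Z * U := by
  induction n with
  | zero =>
    exact ⟨1, 1, 1, fun i => i.elim0, by simp, fun s => Subsingleton.elim _ _, by simp,
      fun i => i.elim0, Subsingleton.elim _ _⟩
  | succ n ih =>
    let k := algebraicClosure F Ω
    let ι : k →+* Ω := algebraMap k Ω
    let σ (s : G) : Ω →+* Ω := MulSemiringAction.toRingHom G Ω s
    have hunitX : IsUnit X.det := isUnit_iff_ne_zero.mpr hX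
    -- The `k`-span of the columns of `X`: it is stable because `G` acts on `X` through constant
    -- matrices.
    let T : (Fin (n + 1) → k) →ₗ[k] (Fin (n + 1) → Ω) :=
      (X.mulVecLin.restrictScalars k).comp ((Algebra.linearMap k Ω).compLeft (Fin (n + 1)))
    have hT (c) : T c = X.mulVec (ι ∘ c) := rfl
    have hsT (s : G) (c) : s • T c = T ((ρ s).mulVec c) := by
      have h1 : s • T c = (X.map (σ s)).mulVec (ι ∘ c) := by
        ext i
        simp only [hT, Pi.smul_apply, Matrix.mulVec, dotProduct, Finset.smul_sum, smul_mul']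
        refine Finset.sum_congr rfl fun j _ => ?_
        congr 1
        exact hG.smul_eq_of_isAlgebraic (F := F) (mem_algebraicClosure_iff.mp (c j).2) s
      rw [h1, hρ, ← Matrix.mulVec_mulVec, hT]
      congr 1
      ext i
      simp [Matrix.mulVec, dotProduct, ι]
    obtain ⟨y, ⟨c, hc⟩, hy0, hy⟩ := hG.exists_common_eigenvector (LinearMap.range T)
      (by
        rw [Ne, LinearMap.range_eq_bot]
        intro h
        refine hX (Matrix.det_eq_zero_of_column_eq_zero 0 fun i => ?_)
        have h1 := congrFun (LinearMap.congr_fun h (Pi.single 0 1)) i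
        rw [hT, LinearMap.zero_apply, Pi.zero_apply] at h1
        rw [← h1, Matrix.mulVec, dotProduct, Finset.sum_eq_single 0]
        · simp
        · intro b _ hb
          simp [hb]
        · simp)
      (by
        rintro s _ ⟨c, rfl⟩
        exact ⟨_, (hsT s c).symm⟩)
    have hc0 : ∃ j, c j ≠ 0 := by
      by_contra! h
      exact hy0 (by rw [← hc, show c = 0 from funext h, map_zero])
    obtain ⟨j, hj⟩ := hc0
    -- Dividing the eigenvector by its coordinate of largest valuation makes it integral with an
    -- entry `1`, so `Z₀` has determinant `±1`. The eigenvalues cancel in the ratios `y l / y i`, so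
    -- these are fixed by `G`.
    obtain ⟨i, hi⟩ := Finite.exists_max fun l => v (y l)
    have hyi : y i ≠ 0 := by
      intro h
      refine hy0 (funext fun l => ?_)
      have := hi l
      rw [h, map_zero, le_zero_iff, map_eq_zero] at this
      exact this
    obtain ⟨g₀, hg₀, -, hg₀det⟩ := exists_matrix_col_zero c j
    obtain ⟨Z₀, hZ₀, hZ₀e, hZ₀det⟩ := exists_matrix_col_zero (fun l => y l / y i) i
    have hg₀ne : g₀.det ≠ 0 := by rcases hg₀det with h | h <;> rw [h] <;> simpa using hj
    have hZ₀v : v Z₀.det = 1 := by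
      rcases hZ₀det with h | h <;> rw [h] <;> simp [hyi]
    have hZ₀ne : Z₀.det ≠ 0 := fun h => by simp [h] at hZ₀v
    have hZ₀int (l m) : v (Z₀ l m) ≤ 1 := by
      rcases hZ₀e l m with h | h | ⟨r, h⟩
      · simp [h]
      · simp [h]
      · rw [h, map_div₀]
        exact div_le_one_of_le₀ (hi r) zero_le
    have hfix (s : G) (l) : s • (y l / y i) = y l / y i := by
      obtain ⟨a, ha⟩ := hy s
      have h (m) : s • y m = (a : Ω) * y m := congrFun ha m
      have hsyi : s • y i ≠ 0 := (smul_ne_zero_iff_ne s).mpr hyi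
      have ha0 : (a : Ω) ≠ 0 := fun h0 => hsyi (by rw [h, h0, zero_mul])
      rw [smul_div₀', h, h, mul_div_mul_left _ _ ha0]
    have hZ₀fix (s : G) : Z₀.map (σ s) = Z₀ := by
      ext l m
      rw [Matrix.map_apply]
      rcases hZ₀e l m with h | h | ⟨r, h⟩
      · rw [h, map_zero]
      · rw [h, map_one]
      · rw [h]
        exact hfix s r
    have hZ₀u : IsUnit Z₀.det := isUnit_iff_ne_zero.mpr hZ₀ne
    have hg₀u : IsUnit g₀.det := isUnit_iff_ne_zero.mpr hg₀ne
    obtain ⟨X₁, hX₁⟩ : ∃ X₁, Z₀ * X₁ = X * g₀.map ι :=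
      ⟨Z₀⁻¹ * (X * g₀.map ι), Matrix.mul_nonsing_inv_cancel_left _ _ hZ₀u⟩
    have hX₁' : X₁ = Z₀⁻¹ * (X * g₀.map ι) := by
      rw [← hX₁, Matrix.nonsing_inv_mul_cancel_left _ _ hZ₀u]
    -- The first columns of `X g₀` and of `Z₀` are `y` and `y / y i`, so `Z₀⁻¹ X g₀` starts with the
    -- column `(y i, 0, …, 0)`, and its lower right block inherits the hypotheses.
    have hcol0 (l : Fin (n + 1)) :
        X₁ l 0 = (1 : Matrix (Fin (n + 1)) (Fin (n + 1)) Ω) l 0 * y i := by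
      rw [hX₁', ← Matrix.nonsing_inv_mul Z₀ hZ₀u, Matrix.mul_apply, Matrix.mul_apply, Finset.sum_mul]
      refine Finset.sum_congr rfl fun m _ => ?_
      rw [mul_assoc, hZ₀, div_mul_cancel₀ _ hyi, ← hc, hT, Matrix.mul_apply, Matrix.mulVec,
        dotProduct]
      simp [hg₀]
    have hblock := eq_blockMatrix X₁ fun l => by rw [hcol0]; simp
    let ρ₁ (s : G) := g₀⁻¹ * ρ s * g₀
    have hρ₁ (s : G) : X₁.map (σ s) = X₁ * (ρ₁ s).map ι := by
      have h1 : Z₀ * X₁.map (σ s) = Z₀ * (X₁ * (ρ₁ s).map ι) := by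
        calc Z₀ * X₁.map (σ s) = (Z₀ * X₁).map (σ s) := by rw [Matrix.map_mul, hZ₀fix]
          _ = X * (ρ s).map ι * g₀.map ι := by
            rw [hX₁, Matrix.map_mul, hρ, hG.map_algebraicClosure]
          _ = X * (g₀ * ρ₁ s).map ι := by
            rw [Matrix.mul_assoc, ← Matrix.map_mul]
            congr 2
            simp only [ρ₁]
            rw [Matrix.mul_assoc, Matrix.mul_nonsing_inv_cancel_left _ _ hg₀u]
          _ = _ := by rw [Matrix.map_mul, ← Matrix.mul_assoc, ← hX₁, Matrix.mul_assoc]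
      have h2 := congrArg (Z₀⁻¹ * ·) h1
      simpa only [Matrix.nonsing_inv_mul_cancel_left _ _ hZ₀u] using h2
    let X' := X₁.submatrix Fin.succ Fin.succ
    have hX₁det : X₁.det ≠ 0 := by
      intro h
      have h1 := congrArg Matrix.det hX₁
      rw [Matrix.det_mul, h, mul_zero, Matrix.det_mul, eq_comm, mul_eq_zero] at h1
      rcases h1 with h1 | h1
      · exact hX h1
      · rw [← RingHom.mapMatrix_apply, ← RingHom.map_det, map_eq_zero] at h1
        exact hg₀ne h1
    have hX' : X'.det ≠ 0 := by
      intro h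
      rw [hblock, det_blockMatrix, h, mul_zero] at hX₁det
      exact hX₁det rfl
    obtain ⟨Z', g', U', hZ'int, hZ'det, hZ'fix, hg', hU', hXZU⟩ := ih X' hX'
      (fun s => (ρ₁ s).submatrix Fin.succ Fin.succ) (fun s => by
        ext l m
        have h1 := congrFun (congrFun (hρ₁ s) l.succ) m.succ
        rw [Matrix.mul_apply, Fin.sum_univ_succ, hcol0] at h1
        simp only [ne_eq, Fin.succ_ne_zero, not_false_eq_true, Matrix.one_apply_ne, zero_mul,
          zero_add] at h1
        exact h1)
    refine ⟨Z₀ * blockMatrix 1 0 Z', g₀ * blockMatrix 1 0 g', blockMatrix (X₁ 0 0)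
      (Matrix.vecMul (fun j => X₁ 0 j.succ) (g'.map ι)) U', ?_, ?_, ?_, ?_, ?_, ?_⟩
    · intro l m
      rw [Matrix.mul_apply]
      refine v.map_sum_le fun r _ => ?_
      rw [map_mul]
      refine mul_le_one' (hZ₀int l r) ?_
      refine Fin.cases ?_ (fun r => ?_) r <;> refine Fin.cases ?_ (fun m => ?_) m <;>
        simp [hZ'int]
    · rw [Matrix.det_mul, det_blockMatrix, map_mul, hZ₀v, one_mul, one_mul, hZ'det]
    · intro s
      rw [Matrix.map_mul, hZ₀fix, map_blockMatrix, hZ'fix]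
      congr 2
      · simp
      · ext
        simp
    · rw [Matrix.det_mul, det_blockMatrix, one_mul]
      exact mul_ne_zero hg₀ne hg'
    · intro l m hlm
      induction l using Fin.cases with
      | zero => exact absurd hlm (Fin.not_lt_zero m)
      | succ l =>
        induction m using Fin.cases with
        | zero => rfl
        | succ m => exact hU' l m (Fin.succ_lt_succ_iff.mp hlm)
    · rw [Matrix.map_mul, ← Matrix.mul_assoc, ← hX₁, Matrix.mul_assoc, Matrix.mul_assoc]
      congr 1
      rw [hblock, map_blockMatrix, blockMatrix_mul, blockMatrix_mul]
      simp only [map_one, mul_one, one_mul, Matrix.zero_vecMul, add_zero, ← hXZU]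
      congr 1
      ext l
      simp
      rfl

end IsInertial

/-! ### Frobenius matrices over a valued field -/

section Iterate

variable {F : Type*} [Field F] [Fintype F] {Ω : Type*} [Field Ω] [Algebra F Ω]

/-- The `r`-th power of the `q`-Frobenius endomorphism, `x ↦ x ^ q ^ r`. -/
def frobPow (F : Type*) [Field F] [Fintype F] (Ω : Type*) [Field Ω] [Algebra F Ω] (r : ℕ) :
    Ω →+* Ω :=
  ((FiniteField.frobeniusAlgHom F Ω ^ r : Ω →ₐ[F] Ω) : Ω →+* Ω)

theorem frobPow_apply (r : ℕ) (x : Ω) : frobPow F Ω r x = x ^ Fintype.card F ^ r := by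
  change (FiniteField.frobeniusAlgHom F Ω ^ r) x = _
  induction r generalizing x with
  | zero => simp
  | succ r ih =>
    rw [pow_succ, AlgHom.mul_apply, ih, FiniteField.frobeniusAlgHom_apply, ← pow_mul, pow_succ,
      mul_comm]

/-- The exponent `1 + q + ⋯ + q ^ (r - 1)`. -/
def geomExp (q r : ℕ) : ℕ := ∑ i ∈ Finset.range r, q ^ i

theorem geomExp_mul {q : ℕ} (hq : 1 ≤ q) (r : ℕ) : (q - 1) * geomExp q r = q ^ r - 1 := by
  rw [geomExp, mul_comm, geom_sum_mul_of_one_le hq]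

end Iterate

theorem isAlgebraic_of_pow_eq_one (F : Type*) [Field F] {Ω : Type*} [Field Ω] [Algebra F Ω] {a : Ω}
    {Q : ℕ} (hQ : 0 < Q) (ha : a ^ Q = 1) : IsAlgebraic F a :=
  ⟨Polynomial.X ^ Q - 1, Polynomial.X_pow_sub_C_ne_zero hQ 1, by simp [ha]⟩

theorem matrix_mul_diag_of_upper {R : Type*} [CommRing R] {n : ℕ} {M N : Matrix (Fin n) (Fin n) R}
    (hM : ∀ i j, j < i → M i j = 0) (hN : ∀ i j, j < i → N i j = 0) (i : Fin n) :
    (M * N) i i = M i i * N i i := by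
  rw [Matrix.mul_apply, Finset.sum_eq_single i]
  · intro j _ hj
    rcases lt_or_gt_of_ne hj with h | h
    · rw [hM i j h, zero_mul]
    · rw [hN j i h, mul_zero]
  · simp

theorem matrix_inv_upper {K : Type*} [Field K] {n : ℕ} {M : Matrix (Fin n) (Fin n) K}
    (hM : ∀ i j, j < i → M i j = 0) (h : M.det ≠ 0) (i j) (hij : j < i) : M⁻¹ i j = 0 := by
  have := M.invertibleOfIsUnitDet (isUnit_iff_ne_zero.mpr h)
  exact Matrix.blockTriangular_inv_of_blockTriangular (M := M) (b := id)
    (fun i j hij => hM i j hij) hij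

theorem matrix_mul_upper {R : Type*} [CommRing R] {n : ℕ} {M N : Matrix (Fin n) (Fin n) R}
    (hM : ∀ i j, j < i → M i j = 0) (hN : ∀ i j, j < i → N i j = 0) (i j) (hij : j < i) :
    (M * N) i j = 0 :=
  Matrix.BlockTriangular.mul (b := id) (fun i j hij => hM i j hij) (fun i j hij => hN i j hij) hij

section Integral

variable {Ω Γ : Type*} [Field Ω] [LinearOrderedCommGroupWithZero Γ] (v : Valuation Ω Γ)

theorem valuation_mul_entry_le {n : ℕ} {M N : Matrix (Fin n) (Fin n) Ω}
    (hM : ∀ i j, v (M i j) ≤ 1) (hN : ∀ i j, v (N i j) ≤ 1) (i j) : v ((M * N) i j) ≤ 1 := by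
  rw [Matrix.mul_apply]
  refine v.map_sum_le fun k _ => ?_
  rw [map_mul]
  exact mul_le_one' (hM i k) (hN k j)

theorem valuation_inv_entry_le {n : ℕ} {M : Matrix (Fin n) (Fin n) Ω}
    (hM : ∀ i j, v (M i j) ≤ 1) (h : v M.det = 1) (i j) : v (M⁻¹ i j) ≤ 1 := by
  let M' : Matrix (Fin n) (Fin n) v.integer := fun i j => ⟨M i j, hM i j⟩
  have hM' : M = M'.map (algebraMap v.integer Ω) := rfl
  have hadj : v (M.adjugate i j) ≤ 1 := by
    have := (M'.adjugate i j).2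
    rw [hM', ← RingHom.mapMatrix_apply, ← RingHom.map_adjugate]
    exact this
  rw [Matrix.inv_def, Matrix.smul_apply, smul_eq_mul, map_mul, Ring.inverse_eq_inv', map_inv₀, h]
  simpa using hadj

end Integral

/-! ### Exponents of the inertia action on a Frobenius equation -/

namespace IsInertial

variable {F : Type*} [Field F] [Fintype F] {Ω : Type*} [Field Ω] [Algebra F Ω]
  {Γ : Type*} [LinearOrderedCommGroupWithZero Γ] {v : Valuation Ω Γ} {π : Ω}
  {G : Type*} [Group G] [MulSemiringAction G Ω] [SMulCommClass G F Ω] (hG : IsInertial v π G)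

include hG

theorem valuation_uniformizer_ne_zero : v π ≠ 0 :=
  (Valuation.ne_zero_iff v).mpr hG.uniformizer_ne_zero

theorem valuation_zpow_le_one_iff (k : ℤ) : v π ^ k ≤ 1 ↔ 0 ≤ k := by
  have h0 := zero_lt_iff.mpr hG.valuation_uniformizer_ne_zero
  rw [← zpow_zero (v π)]
  exact (zpow_right_strictAnti₀ h0 hG.uniformizer_lt).le_iff_ge

theorem valuation_zpow_inj {k l : ℤ} (h : v π ^ k = v π ^ l) : k = l := by
  have h0 := zero_lt_iff.mpr hG.valuation_uniformizer_ne_zero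
  exact (zpow_right_strictAnti₀ h0 hG.uniformizer_lt).injective h

theorem valuation_pow_inj {k l : ℕ} (h : v π ^ k = v π ^ l) : k = l := by
  rw [← zpow_natCast, ← zpow_natCast] at h
  exact_mod_cast hG.valuation_zpow_inj h

/-- Iterating the equation `X = A X^{(q)}`. -/
theorem exists_iterate {n : ℕ} {A B X : Matrix (Fin n) (Fin n) Ω} {β : Ω} {N a : ℕ}
    (hA : ∀ i j, v (A i j) ≤ 1) (hB : ∀ i j, v (B i j) ≤ 1)
    (hAfix : ∀ (s : G) i j, s • A i j = A i j) (hAB : A * B = β • 1) (hβ : v β = v π ^ N)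
    (ha : v A.det = v π ^ a) (hX : X = A * X.map (frobPow F Ω 1)) (r : ℕ) :
    ∃ (A' B' : Matrix (Fin n) (Fin n) Ω) (β' : Ω), (∀ i j, v (A' i j) ≤ 1) ∧
      (∀ i j, v (B' i j) ≤ 1) ∧ (∀ (s : G) i j, s • A' i j = A' i j) ∧ A' * B' = β' • 1 ∧
      v β' = v π ^ (N * geomExp (Fintype.card F) r) ∧
      v A'.det = v π ^ (a * geomExp (Fintype.card F) r) ∧ X = A' * X.map (frobPow F Ω r) := by
  induction r with
  | zero =>
    have h1 (i j) : v ((1 : Matrix (Fin n) (Fin n) Ω) i j) ≤ 1 := by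
      rw [Matrix.one_apply]
      split_ifs <;> simp
    refine ⟨1, 1, 1, h1, h1, fun s i j => ?_, by simp, by simp [geomExp], by simp [geomExp], ?_⟩
    · rw [Matrix.one_apply]
      split_ifs <;> simp
    · ext i j
      simp [frobPow_apply]
  | succ r ih =>
    obtain ⟨A', B', β', hA', hB', hfix, hAB', hβ', ha', hX'⟩ := ih
    have hgeom : geomExp (Fintype.card F) (r + 1) =
        geomExp (Fintype.card F) r + Fintype.card F ^ r := Finset.sum_range_succ _ _
    have hint {M : Matrix (Fin n) (Fin n) Ω} (hM : ∀ i j, v (M i j) ≤ 1) (i j) :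
        v (M.map (frobPow F Ω r) i j) ≤ 1 := by
      rw [Matrix.map_apply, frobPow_apply, map_pow]
      exact pow_le_one₀ zero_le (hM i j)
    refine ⟨A' * A.map (frobPow F Ω r), B.map (frobPow F Ω r) * B', frobPow F Ω r β * β',
      valuation_mul_entry_le v hA' (hint hA), valuation_mul_entry_le v (hint hB) hB', ?_, ?_, ?_,
      ?_, ?_⟩
    · intro s i j
      simp only [Matrix.mul_apply, Finset.smul_sum, smul_mul', hfix, Matrix.map_apply,
        frobPow_apply, smul_pow', hAfix]
    · rw [Matrix.mul_assoc, ← Matrix.mul_assoc (A.map _), ← Matrix.map_mul, hAB,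
        Matrix.map_smul' _ _ _ (map_mul _), Matrix.map_one _ (map_zero _) (map_one _),
        Matrix.smul_mul, Matrix.one_mul, Matrix.mul_smul, hAB', smul_smul]
    · rw [map_mul, frobPow_apply, map_pow, hβ, hβ', hgeom, mul_add, pow_add, mul_comm, ← pow_mul]
    · rw [Matrix.det_mul, map_mul, ha', ← RingHom.mapMatrix_apply, ← RingHom.map_det,
        frobPow_apply, map_pow, ha, hgeom, mul_add, pow_add, ← pow_mul]
    · have h1 : X.map (frobPow F Ω r) = A.map (frobPow F Ω r) * X.map (frobPow F Ω (r + 1)) := by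
        conv_lhs => rw [hX, Matrix.map_mul]
        congr 1
      rw [Matrix.mul_assoc, ← h1, ← hX']

theorem smul_root_div_pow (s : G) {ϖ : Ω} {Q : ℕ} (hϖ : ϖ ^ Q = π) : (s • ϖ / ϖ) ^ Q = 1 := by
  rw [div_pow, ← smul_pow', hϖ, hG.uniformizer_fixed, div_self hG.uniformizer_ne_zero]

theorem root_ne_zero {ϖ : Ω} {Q : ℕ} (hQ : Q ≠ 0) (hϖ : ϖ ^ Q = π) : ϖ ≠ 0 := by
  rintro rfl
  rw [zero_pow hQ] at hϖ
  exact hG.uniformizer_ne_zero hϖ.symm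

theorem smul_root_of_unity (F : Type*) [Field F] [Fintype F] [Algebra F Ω] [SMulCommClass G F Ω]
    {a : Ω} {Q : ℕ} (hQ : 0 < Q) (ha : a ^ Q = 1) (s : G) :
    s • a = a := by
  exact hG.smul_eq_of_isAlgebraic (isAlgebraic_of_pow_eq_one F hQ ha) s

/-- A `Q`-th root of the uniformizer gives a tame character with values in all of `μ_Q`. -/
theorem exists_isPrimitiveRoot (F : Type*) [Field F] [Fintype F] [Algebra F Ω]
    [SMulCommClass G F Ω] {ϖ : Ω} {Q : ℕ} (hQ : 0 < Q) (hϖ : ϖ ^ Q = π) :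
    ∃ s : G, IsPrimitiveRoot (s • ϖ / ϖ) Q := by
  have hϖ0 := hG.root_ne_zero hQ.ne' hϖ
  have : NeZero Q := ⟨hQ.ne'⟩
  let θ : G →* rootsOfUnity Q Ω := MonoidHom.mk'
    (fun s => rootsOfUnity.mkOfPowEq (s • ϖ / ϖ) (hG.smul_root_div_pow s hϖ)) (by
      intro s t
      ext
      rw [Subgroup.coe_mul, Units.val_mul, rootsOfUnity.coe_mkOfPowEq, rootsOfUnity.coe_mkOfPowEq,
        rootsOfUnity.coe_mkOfPowEq]
      have h := hG.smul_root_of_unity F hQ (hG.smul_root_div_pow t hϖ) s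
      have hs : s • ϖ ≠ 0 := (smul_ne_zero_iff_ne s).mpr hϖ0
      rw [smul_div₀'] at h
      rw [← h, mul_smul]
      field_simp)
  have hθ (s) : ((θ s : Ωˣ) : Ω) = s • ϖ / ϖ := rootsOfUnity.coe_mkOfPowEq _
  -- The image of the tame character is a subgroup of the cyclic group `μ_Q`; take a generator.
  obtain ⟨⟨_, s₀, rfl⟩, hs₀⟩ := IsCyclic.exists_generator (α := θ.range)
  refine ⟨s₀, ?_⟩
  refine ⟨hG.smul_root_div_pow s₀ hϖ, fun l hl => ?_⟩
  have hθl (s : G) : s • ϖ ^ l = ϖ ^ l := by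
    obtain ⟨k, hk⟩ := hs₀ ⟨θ s, s, rfl⟩
    have h1 : θ s₀ ^ k = θ s := congrArg Subtype.val hk
    have h2 : (θ s₀) ^ l = 1 := by
      ext
      rw [Subgroup.coe_pow, Units.val_pow_eq_pow_val, hθ, hl]
      rfl
    have h3 : (θ s) ^ l = 1 := by
      rw [← h1, ← zpow_natCast, ← zpow_mul, mul_comm, zpow_mul, zpow_natCast, h2, one_zpow]
    have h4 := congrArg (fun u : rootsOfUnity Q Ω => ((u : Ωˣ) : Ω)) h3
    simp only [Subgroup.coe_pow, Units.val_pow_eq_pow_val, hθ] at h4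
    rw [div_pow, Subgroup.coe_one, Units.val_one, div_eq_one_iff_eq (pow_ne_zero l hϖ0)] at h4
    rw [smul_pow', h4]
  -- If the generator is killed by `l`, then all of `G` fixes `ϖ^l`, so its order `l / Q` in units
  -- of `v π` is an integer and `Q ∣ l`.
  obtain ⟨k, hk⟩ := hG.fixed (ϖ ^ l) (pow_ne_zero l hϖ0) hθl
  have h1 : v π ^ (l : ℤ) = v π ^ (k * Q : ℤ) := by
    rw [zpow_mul, ← hk, zpow_natCast, zpow_natCast, ← hϖ, ← map_pow, ← map_pow, ← pow_mul,
      ← pow_mul, mul_comm]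
  have h2 := hG.valuation_zpow_inj h1
  exact Int.natCast_dvd_natCast.mp ⟨k, by rw [h2, mul_comm]⟩


/-- The characteristic polynomials of the inertia action on the solutions of `X = A X^{(q)}`. -/
theorem exists_exponents [IsSepClosed Ω] {n : ℕ} {A B X : Matrix (Fin n) (Fin n) Ω} {β : Ω}
    {N a : ℕ} (hA : ∀ i j, v (A i j) ≤ 1) (hB : ∀ i j, v (B i j) ≤ 1)
    (hAfix : ∀ (s : G) i j, s • A i j = A i j) (hAB : A * B = β • 1) (hβ : v β = v π ^ N)
    (ha : v A.det = v π ^ a) (hX : X = A * X.map (frobPow F Ω 1)) (hXdet : X.det ≠ 0)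
    (ρ : G → Matrix (Fin n) (Fin n) F)
    (hρ : ∀ s, X.map (MulSemiringAction.toRingHom G Ω s) = X * (ρ s).map (algebraMap F Ω))
    {r₀ : ℕ} (hr₀ : 0 < r₀) :
    ∃ (R : ℕ) (m : Fin n → ℕ), 0 < R ∧ r₀ ∣ R ∧
      (∀ j, m j ≤ N * geomExp (Fintype.card F) R) ∧
      ∑ j, m j = a * geomExp (Fintype.card F) R ∧
      ∀ ϖ : Ω, ϖ ^ (Fintype.card F ^ R - 1) = π → ∀ s : G,
        (ρ s⁻¹).charpoly.map (algebraMap F Ω) =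
          ∏ j, (Polynomial.X - Polynomial.C ((s • ϖ / ϖ) ^ m j)) := by
  let k := algebraicClosure F Ω
  let ι : k →+* Ω := algebraMap k Ω
  obtain ⟨Z, g, U, hZ, hZdet, hZfix, hgdet, hU, hXZU⟩ := hG.exists_triangular (F := F) X hXdet
    (fun s => (ρ s).map (algebraMap F k)) (fun s => by
      rw [hρ, Matrix.map_map]
      rfl)
  -- The finitely many entries of `g` lie in a finite field, so a suitable power of Frobenius fixes
  -- `g` and it drops out of the iterated equation.
  obtain ⟨R, hR, hr₀R, hgR⟩ := exists_common_pow_card_pow_eq (F := F)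
    (fun i : Fin n × Fin n => (g i.1 i.2 : Ω))
    (fun i => mem_algebraicClosure_iff.mp (g i.1 i.2).2) hr₀
  obtain ⟨A', B', β', hA', hB', hA'fix, hAB', hβ', ha', hX'⟩ :=
    hG.exists_iterate (F := F) hA hB hAfix hAB hβ ha hX R
  let φ := frobPow F Ω R
  have hq : 1 < Fintype.card F := Fintype.one_lt_card
  have hQ : 0 < Fintype.card F ^ R - 1 := Nat.sub_pos_of_lt (Nat.one_lt_pow hR.ne' hq)
  have hgφ : (g.map ι).map φ = g.map ι := by
    ext i j
    rw [Matrix.map_apply, Matrix.map_apply, frobPow_apply]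
    exact hgR (i, j)
  have hgι : (g.map ι).det ≠ 0 := by
    rw [← RingHom.mapMatrix_apply, ← RingHom.map_det]
    simpa using hgdet
  have hZne : Z.det ≠ 0 := fun h => by simp [h] at hZdet
  have hZu : IsUnit Z.det := isUnit_iff_ne_zero.mpr hZne
  have hUne : U.det ≠ 0 := by
    intro h
    have := congrArg Matrix.det hXZU
    rw [Matrix.det_mul, Matrix.det_mul, h, mul_zero] at this
    exact mul_ne_zero hXdet hgι this
  have hUu : IsUnit U.det := isUnit_iff_ne_zero.mpr hUne
  have hUφ (i j) (hij : j < i) : U.map φ i j = 0 := by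
    rw [Matrix.map_apply, hU i j hij, map_zero]
  have hUφdet : (U.map φ).det ≠ 0 := by
    rw [← RingHom.mapMatrix_apply, ← RingHom.map_det]
    simpa using hUne
  have hUφu : IsUnit (U.map φ).det := isUnit_iff_ne_zero.mpr hUφdet
  have hZφint (i j) : v (Z.map φ i j) ≤ 1 := by
    rw [Matrix.map_apply, frobPow_apply, map_pow]
    exact pow_le_one₀ zero_le (hZ i j)
  have hZφdet : v (Z.map φ).det = 1 := by
    rw [← RingHom.mapMatrix_apply, ← RingHom.map_det, frobPow_apply, map_pow, hZdet, one_pow]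
  have hZφu : IsUnit (Z.map φ).det :=
    isUnit_iff_ne_zero.mpr fun h => by simp [h] at hZφdet
  have hZinvfix (s : G) : (Z⁻¹).map (MulSemiringAction.toRingHom G Ω s) = Z⁻¹ := by
    refine (Matrix.inv_eq_left_inv ?_).symm
    conv_lhs => rw [← hZfix s]
    rw [← Matrix.map_mul, hZfix, Matrix.nonsing_inv_mul _ hZu]
    exact Matrix.map_one _ (map_zero _) (map_one _)
  -- Changing coordinates by `Z` turns the iterated equation into `C U^(q^R) = U`. The matrix `C`
  -- stays integral and fixed by `G` because `Z` is, and is upper triangular because `U` is.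
  obtain ⟨C, hC⟩ : ∃ C, C = Z⁻¹ * A' * Z.map φ := ⟨_, rfl⟩
  obtain ⟨D, hD⟩ : ∃ D, D = (Z.map φ)⁻¹ * B' * Z := ⟨_, rfl⟩
  have hCint : ∀ i j, v (C i j) ≤ 1 := by
    rw [hC]
    exact valuation_mul_entry_le v (valuation_mul_entry_le v
      (valuation_inv_entry_le v hZ hZdet) hA') hZφint
  have hDint : ∀ i j, v (D i j) ≤ 1 := by
    rw [hD]
    exact valuation_mul_entry_le v (valuation_mul_entry_le v
      (valuation_inv_entry_le v hZφint hZφdet) hB') hZ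
  have hCD : C * D = β' • 1 := by
    rw [hC, hD, Matrix.mul_assoc, Matrix.mul_assoc (Z.map φ)⁻¹,
      Matrix.mul_nonsing_inv_cancel_left _ _ hZφu, ← Matrix.mul_assoc, Matrix.mul_assoc Z⁻¹, hAB',
      Matrix.mul_smul, Matrix.smul_mul, Matrix.mul_one, Matrix.nonsing_inv_mul _ hZu]
  have hCfix (s : G) (i j) : s • C i j = C i j := by
    have : C.map (MulSemiringAction.toRingHom G Ω s) = C := by
      rw [hC, Matrix.map_mul, Matrix.map_mul, hZinvfix]
      congr 1
      · congr 1
        ext i j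
        exact hA'fix s i j
      · ext i j
        simp only [Matrix.map_apply, φ, frobPow_apply, MulSemiringAction.toRingHom_apply,
          smul_pow']
        have hz : s • Z i j = Z i j := congrFun (congrFun (hZfix s) i) j
        rw [hz]
    exact congrFun (congrFun this i) j
  have hCU : C * U.map φ = U := by
    have h1 : Z * (C * U.map φ) = Z * U := by
      rw [hC, Matrix.mul_assoc, Matrix.mul_assoc, Matrix.mul_nonsing_inv_cancel_left _ _ hZu,
        ← Matrix.map_mul, ← hXZU, Matrix.map_mul, hgφ, ← Matrix.mul_assoc, ← hX']
    simpa only [Matrix.nonsing_inv_mul_cancel_left _ _ hZu] using congrArg (Z⁻¹ * ·) h1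
  have hC' : C = U * (U.map φ)⁻¹ := by
    have h1 := Matrix.mul_nonsing_inv_cancel_right _ C hUφu
    rwa [hCU, eq_comm] at h1
  have hCup : ∀ i j, j < i → C i j = 0 := by
    rw [hC']
    exact matrix_mul_upper hU (matrix_inv_upper hUφ hUφdet)
  have hCdet : C.det ≠ 0 := by
    intro h
    have h1 := congrArg Matrix.det hCU
    rw [Matrix.det_mul, h, zero_mul] at h1
    exact hUne h1.symm
  have hD' : D = C⁻¹ * β' • 1 := by
    rw [← hCD, Matrix.nonsing_inv_mul_cancel_left _ _ (isUnit_iff_ne_zero.mpr hCdet)]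
  have hDup : ∀ i j, j < i → D i j = 0 := by
    intro i j hij
    rw [hD', Matrix.mul_smul, Matrix.mul_one, Matrix.smul_apply,
      matrix_inv_upper hCup hCdet i j hij, smul_zero]
  have hdetprod {M : Matrix (Fin n) (Fin n) Ω} (hM : ∀ i j, j < i → M i j = 0) :
      M.det = ∏ j, M j j := Matrix.det_of_isUpperTriangular fun i j hij => hM i j hij
  have hU0 (j) : U j j ≠ 0 := by
    rw [hdetprod hU] at hUne
    exact Finset.prod_ne_zero_iff.mp hUne j (Finset.mem_univ j)
  have hC0 (j) : C j j ≠ 0 := by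
    rw [hdetprod hCup] at hCdet
    exact Finset.prod_ne_zero_iff.mp hCdet j (Finset.mem_univ j)
  have hCk (j) : ∃ m : ℕ, v (C j j) = v π ^ m := by
    obtain ⟨m, hm⟩ := hG.fixed (C j j) (hC0 j) fun s => hCfix s j j
    have h0 : 0 ≤ m := by
      rw [← hG.valuation_zpow_le_one_iff, ← hm]
      exact hCint j j
    lift m to ℕ using h0
    exact ⟨m, by rw [hm, zpow_natCast]⟩
  choose m hm using hCk
  refine ⟨R, m, hR, hr₀R, fun j => ?_, ?_, ?_⟩
  -- Both factors are triangular, so `C D = β'` holds on the diagonal, and integrality of `D` bounds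
  -- the order of `C j j` by that of `β'`.
  · have h1 : C j j * D j j = β' := by
      rw [← matrix_mul_diag_of_upper hCup hDup, hCD]
      simp
    have h2 := congrArg v h1
    rw [map_mul, hm, hβ'] at h2
    have h3 : v π ^ (N * geomExp (Fintype.card F) R) ≤ v π ^ m j := by
      rw [← h2]
      exact mul_le_of_le_one_right' (hDint j j)
    exact (pow_le_pow_iff_right_of_lt_one₀
      (zero_lt_iff.mpr hG.valuation_uniformizer_ne_zero) hG.uniformizer_lt).mp h3
  · apply hG.valuation_pow_inj
    have h1 : v C.det = v A'.det := by
      rw [hC, Matrix.det_mul, Matrix.det_mul, map_mul, map_mul, hZφdet, mul_one,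
        Matrix.det_nonsing_inv, Ring.inverse_eq_inv', map_inv₀, hZdet, inv_one, one_mul]
    rw [← ha', ← h1, hdetprod hCup, map_prod, ← Finset.prod_pow_eq_pow_sum]
    exact Finset.prod_congr rfl fun j _ => (hm j).symm
  · intro ϖ hϖ s
    have hϖ0 := hG.root_ne_zero hQ.ne' hϖ
    have hg : IsUnit (g.map ι).det := isUnit_iff_ne_zero.mpr hgι
    let P := (ρ s⁻¹).map (algebraMap F Ω)
    -- The action of `s⁻¹` in the basis `g`: it satisfies `U V = s⁻¹(U)`, so it is triangular with
    -- diagonal entries `s⁻¹(u_j) / u_j`.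
    let V := (g.map ι)⁻¹ * P * g.map ι
    have hUV : U * V = U.map (MulSemiringAction.toRingHom G Ω s⁻¹) := by
      have h1 : Z * (U * V) = Z * U.map (MulSemiringAction.toRingHom G Ω s⁻¹) := by
        rw [← Matrix.mul_assoc, ← hXZU]
        simp only [V]
        rw [Matrix.mul_assoc, Matrix.mul_assoc, Matrix.mul_nonsing_inv_cancel_left _ _ hg,
          ← Matrix.mul_assoc, ← hρ]
        conv_rhs => rw [← hZfix s⁻¹]
        rw [← Matrix.map_mul, ← hXZU, Matrix.map_mul, hG.map_algebraicClosure]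
      simpa only [Matrix.nonsing_inv_mul_cancel_left _ _ hZu] using congrArg (Z⁻¹ * ·) h1
    have hVU : V = U⁻¹ * U.map (MulSemiringAction.toRingHom G Ω s⁻¹) := by
      rw [← hUV, Matrix.nonsing_inv_mul_cancel_left _ _ hUu]
    have hVup : ∀ i j, j < i → V i j = 0 := by
      rw [hVU]
      refine matrix_mul_upper (matrix_inv_upper hU hUne) fun i j hij => ?_
      rw [Matrix.map_apply, hU i j hij, map_zero]
    have hchar : (ρ s⁻¹).charpoly.map (algebraMap F Ω) = V.charpoly := by
      rw [← Matrix.charpoly_map]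
      exact (Matrix.charpoly_units_conj' (Matrix.nonsingInvUnit _ hg) P).symm
    rw [hchar, Matrix.charpoly_of_isUpperTriangular V fun i j hij => hVup i j hij]
    refine Finset.prod_congr rfl fun j _ => ?_
    congr 2
    have hdV : U j j * V j j = s⁻¹ • U j j := by
      rw [← matrix_mul_diag_of_upper hU hVup, hUV]
      rfl
    have hθ := hG.smul_root_div_pow s hϖ
    have hθinv := hG.smul_root_of_unity F hQ hθ
    have h1 : C j j * U j j ^ Fintype.card F ^ R = U j j := by
      have := congrFun (congrFun hCU j) j
      rw [matrix_mul_diag_of_upper hCup hUφ, Matrix.map_apply, frobPow_apply] at this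
      exact this
    have h2 : C j j * U j j ^ (Fintype.card F ^ R - 1) = 1 := by
      apply mul_right_cancel₀ (hU0 j)
      rw [mul_assoc, ← pow_succ, Nat.sub_add_cancel (Nat.one_le_pow _ _ (by omega)), h1, one_mul]
    -- The relation `c_j u_j^Q = 1` gives `(u_j ϖ^{m_j})^Q = π^{m_j} / c_j`, which has valuation `1`
    -- and is fixed by `G`. So `s⁻¹` multiplies `u_j ϖ^{m_j}` by a `Q`-th root of unity congruent to
    -- `1`, that is by `1`.
    have hdQ : v (U j j * ϖ ^ m j) = 1 := by
      have h3 : v (U j j * ϖ ^ m j) ^ (Fintype.card F ^ R - 1) = 1 := by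
        rw [← map_pow, mul_pow, map_mul, ← pow_mul, mul_comm (m j), pow_mul, hϖ, map_pow v π,
          ← hm, ← map_mul, mul_comm, h2, map_one]
      exact (pow_eq_one_iff_of_nonneg zero_le hQ.ne').mp h3
    have hy0 : U j j * ϖ ^ m j ≠ 0 := mul_ne_zero (hU0 j) (pow_ne_zero _ hϖ0)
    have hsub : v (s⁻¹ • (U j j * ϖ ^ m j) / (U j j * ϖ ^ m j) - 1) < 1 := by
      rw [div_sub_one hy0, map_div₀, hdQ, div_one]
      exact hG.sub_lt _ _ hdQ.le
    have hroot : (s⁻¹ • (U j j * ϖ ^ m j) / (U j j * ϖ ^ m j)) ^ (Fintype.card F ^ R - 1) = 1 := by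
      have h1 : (U j j * ϖ ^ m j) ^ (Fintype.card F ^ R - 1) = π ^ m j / C j j := by
        rw [eq_div_iff (hC0 j), mul_pow, ← pow_mul, mul_comm (m j), pow_mul, hϖ, mul_right_comm,
          mul_comm _ (C j j), h2, one_mul]
      rw [div_pow, ← smul_pow', h1, smul_div₀', hCfix, smul_pow', hG.uniformizer_fixed, div_self]
      exact div_ne_zero (pow_ne_zero _ hG.uniformizer_ne_zero) (hC0 j)
    have hone := eq_of_isAlgebraic_of_valuation_sub_lt (F := F) v
      (isAlgebraic_of_pow_eq_one F hQ hroot) isAlgebraic_one hsub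
    have hinv : s⁻¹ • ϖ / ϖ = (s • ϖ / ϖ)⁻¹ := by
      have h3 := hG.smul_root_of_unity F hQ (hG.smul_root_div_pow s⁻¹ hϖ) s
      rw [← h3, smul_div₀', smul_inv_smul, inv_div]
    rw [smul_mul', ← hdV, smul_pow', div_eq_one_iff_eq hy0, mul_assoc] at hone
    have h4 := mul_left_cancel₀ (hU0 j) hone
    have h5 : V j j * (s⁻¹ • ϖ / ϖ) ^ m j = 1 := by
      rw [div_pow, mul_div_assoc', h4, div_self (pow_ne_zero _ hϖ0)]
    have h6 : (s • ϖ / ϖ) ^ m j ≠ 0 :=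
      pow_ne_zero _ (div_ne_zero ((smul_ne_zero_iff_ne s).mpr hϖ0) hϖ0)
    rwa [hinv, inv_pow, mul_inv_eq_one₀ h6] at h5

end IsInertial

/-! ### Lang's theorem for `GL_n` over `Ω` and over `Ω⟦z⟧` -/

section Lang

open Polynomial in
-- The polynomial `p - X` has derivative `-1`, so it is separable with at least two distinct roots.
theorem exists_nonzero_root_of_derivative {Ω : Type*} [Field Ω] [IsSepClosed Ω] {p : Polynomial Ω}
    (hder : derivative p = 0) (hdeg : 2 ≤ p.natDegree) : ∃ t ≠ 0, p.eval t = t := by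
  let P := p - X
  have hP : P.natDegree = p.natDegree := by
    refine natDegree_sub_eq_left_of_natDegree_lt ?_
    rw [natDegree_X]
    omega
  have hsep : P.Separable := by
    refine ⟨0, -1, ?_⟩
    simp [P, hder]
  have hcard := (IsSepClosed.splits_of_separable P hsep).natDegree_eq_card_roots
  have hnodup := nodup_roots hsep
  obtain ⟨t, ht, ht0⟩ : ∃ t ∈ P.roots, t ≠ 0 := by
    by_contra! h
    have h1 : P.roots ≤ {0} := by
      refine (Multiset.le_iff_subset hnodup).mpr fun t ht => ?_
      simp [h t ht]
    have := Multiset.card_le_card h1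
    rw [Multiset.card_singleton] at this
    omega
  refine ⟨t, ht0, ?_⟩
  have := isRoot_of_mem_roots ht
  simpa [P, sub_eq_zero] using this

variable {F : Type*} [Field F] [Fintype F] {Ω : Type*} [Field Ω] [Algebra F Ω]

theorem card_cast_eq_zero (F : Type*) [Field F] [Fintype F] (A : Type*) [CommRing A]
    [Algebra F A] : (Fintype.card F : A) = 0 := by
  rw [← map_natCast (algebraMap F A), FiniteField.cast_card_eq_zero, map_zero]

theorem exists_sub_frob_eq (F : Type*) [Field F] [Fintype F] {Ω : Type*} [Field Ω] [Algebra F Ω]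
    [IsSepClosed Ω] (c : Ω) : ∃ t : Ω, t = frobPow F Ω 1 t + c := by
  obtain ⟨t, ht⟩ := IsSepClosed.exists_root_C_mul_X_pow_add_C_mul_X_add_C (n := Fintype.card F)
    (1 : Ω) (-1) c (card_cast_eq_zero F Ω) Fintype.one_lt_card (by simp)
  refine ⟨t, ?_⟩
  rw [frobPow_apply, pow_one]
  linear_combination -ht

open Polynomial in
/-- The polynomials expressing the coefficients of a fixed vector of a Frobenius-semilinear map
with respect to a cyclic basis in terms of the last coefficient. -/
def cyclicPoly (q : ℕ) (a : ℕ → Ω) : ℕ → Polynomial Ω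
  | 0 => C (a 0) * X ^ q
  | i + 1 => cyclicPoly q a i ^ q + C (a (i + 1)) * X ^ q

open Polynomial in
theorem derivative_cyclicPoly (a : ℕ → Ω) (i : ℕ) :
    derivative (cyclicPoly (Fintype.card F) a i) = 0 := by
  have h : ((Fintype.card F : ℕ) : Polynomial Ω) = 0 := card_cast_eq_zero F _
  have h' : ((Fintype.card F : ℕ) : Ω) = 0 := card_cast_eq_zero F _
  cases i <;> simp [cyclicPoly, derivative_pow, h']

open Polynomial in
theorem le_natDegree_cyclicPoly {q : ℕ} (hq : 2 ≤ q) {a : ℕ → Ω} (ha : a 0 ≠ 0) (i : ℕ) :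
    q ≤ (cyclicPoly q a i).natDegree := by
  induction i with
  | zero => rw [cyclicPoly, natDegree_C_mul_X_pow _ _ ha]
  | succ i ih =>
    have h1 : (C (a (i + 1)) * X ^ q).natDegree < (cyclicPoly q a i ^ q).natDegree := by
      refine (natDegree_C_mul_X_pow_le _ _).trans_lt ?_
      rw [natDegree_pow]
      nlinarith
    rw [cyclicPoly, natDegree_add_eq_left_of_natDegree_lt h1, natDegree_pow]
    nlinarith

/-- A left inverse of the matrix of the family stays a left inverse after applying `φ` to its
entries, and `A` is invertible. -/
theorem linearIndependent_mulVec_frob {n : ℕ} {A : Matrix (Fin n) (Fin n) Ω} (hA : A.det ≠ 0)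
    (φ : Ω →+* Ω) {ι : Type*} [Fintype ι] [DecidableEq ι] {w : ι → Fin n → Ω}
    (hw : LinearIndependent Ω w) : LinearIndependent Ω fun i => A.mulVec (φ ∘ w i) := by
  let W : Matrix (Fin n) ι Ω := Matrix.of fun j i => w i j
  have hW : Function.Injective W.mulVecLin := Matrix.mulVec_injective_iff.mpr hw
  obtain ⟨g, hg⟩ := W.mulVecLin.exists_leftInverse_of_injective (LinearMap.ker_eq_bot.mpr hW)
  have hgW : LinearMap.toMatrix' g * W = 1 := by
    conv_lhs => rw [← LinearMap.toMatrix'_toLin' W]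
    rw [← LinearMap.toMatrix'_comp, Matrix.toLin'_apply', hg, LinearMap.toMatrix'_id]
  have hleft : ((LinearMap.toMatrix' g).map φ * A⁻¹) * (A * W.map φ) = 1 := by
    rw [Matrix.mul_assoc, Matrix.nonsing_inv_mul_cancel_left _ _ (isUnit_iff_ne_zero.mpr hA),
      ← Matrix.map_mul, hgW, Matrix.map_one _ (map_zero _) (map_one _)]
  have hinj : Function.Injective (A * W.map φ).mulVec := by
    refine Function.LeftInverse.injective
      (g := ((LinearMap.toMatrix' g).map φ * A⁻¹).mulVec) fun x => ?_
    rw [Matrix.mulVec_mulVec, hleft, Matrix.one_mulVec]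
  exact Matrix.mulVec_injective_iff.mp hinj

/-- Let `Φ(y) = A y^(q)` and let `e_i` be the iterates of a vector, with first relation `e_{m+1} = ∑
a_i e_i`. A combination `∑ c_i e_i` is fixed iff `c_0 = a_0 c_m^q` and `c_{i+1} = c_i^q + a_{i+1}
c_m^q`. Each `c_i` is thus a polynomial in `t = c_m`, and what remains is one equation `c_m(t) = t`
with a nonzero solution. -/
theorem exists_fixed_vector (F : Type*) [Field F] [Fintype F] {Ω : Type*} [Field Ω] [Algebra F Ω]
    [IsSepClosed Ω] {n : ℕ} {A : Matrix (Fin (n + 1)) (Fin (n + 1)) Ω} (hA : A.det ≠ 0) :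
    ∃ y ≠ 0, A.mulVec (frobPow F Ω 1 ∘ y) = y := by
  let q := Fintype.card F
  have hq : 2 ≤ q := Fintype.one_lt_card
  let φ := frobPow F Ω 1
  have hφ (x : Ω) : φ x = x ^ q := by simp [φ, q, frobPow_apply]
  let Φ : (Fin (n + 1) → Ω) → (Fin (n + 1) → Ω) := fun y => A.mulVec (φ ∘ y)
  let e : ℕ → Fin (n + 1) → Ω := fun i => Φ^[i] (Pi.single 0 1)
  have he (i) : A.mulVec (φ ∘ e i) = e (i + 1) := (Function.iterate_succ_apply' Φ i _).symm
  have hdep : ∃ d, ¬ LinearIndependent Ω fun i : Fin d => e i := by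
    refine ⟨n + 2, fun h => ?_⟩
    have := h.fintype_card_le_finrank
    simp at this
  classical
  obtain ⟨d, hd, hmin⟩ : ∃ d, (¬ LinearIndependent Ω fun i : Fin d => e i) ∧
      ∀ d' < d, LinearIndependent Ω fun i : Fin d' => e i :=
    ⟨Nat.find hdep, Nat.find_spec hdep, fun d' h => not_not.mp (Nat.find_min hdep h)⟩
  cases d with
  | zero => exact absurd linearIndependent_empty_type hd
  | succ d =>
  have hind := hmin d d.lt_succ_self
  rw [linearIndependent_finSucc', not_and_not_right] at hd
  have hmem := hd hind
  cases d with
  | zero =>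
    exfalso
    have h0 : e 0 = 0 := by simpa using hmem
    have := congrFun h0 0
    simp [e] at this
  | succ m =>
  obtain ⟨a', ha'⟩ := (Submodule.mem_span_range_iff_exists_fun Ω).mp hmem
  obtain ⟨a, ha⟩ : ∃ a : ℕ → Ω, ∑ i ∈ Finset.range (m + 1), a i • e i = e (m + 1) := by
    refine ⟨fun i => if h : i < m + 1 then a' ⟨i, h⟩ else 0, ?_⟩
    rw [Finset.sum_range]
    refine Eq.trans (Finset.sum_congr rfl fun i _ => ?_) ha'
    simp only [i.2, dif_pos]
    rfl
  -- Otherwise `e_1, …, e_{m+1}` would be dependent, although `Φ` preserves linear independence.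
  have ha0 : a 0 ≠ 0 := by
    intro h0
    have hind' := linearIndependent_mulVec_frob hA φ hind
    simp only [he] at hind'
    rw [linearIndependent_finSucc'] at hind'
    refine hind'.2 ?_
    change e (m + 1) ∈ _
    rw [← ha, Finset.sum_range_succ', h0, zero_smul, add_zero]
    refine Submodule.sum_mem _ fun i hi => Submodule.smul_mem _ _ (Submodule.subset_span ?_)
    exact ⟨⟨i, Finset.mem_range.mp hi⟩, rfl⟩
  obtain ⟨t, ht0, ht⟩ := exists_nonzero_root_of_derivative
    (derivative_cyclicPoly (F := F) a m) (hq.trans (le_natDegree_cyclicPoly hq ha0 m))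
  let c (i : ℕ) : Ω := (cyclicPoly q a i).eval t
  have hc0 : c 0 = φ t * a 0 := by
    rw [mul_comm]
    simp [c, cyclicPoly, hφ]
  have hcs (i) : c (i + 1) = φ (c i) + φ t * a (i + 1) := by
    rw [mul_comm]
    simp [c, cyclicPoly, hφ]
  have hcm : c m = t := ht
  refine ⟨∑ i ∈ Finset.range (m + 1), c i • e i, ?_, ?_⟩
  · intro h
    rw [Finset.sum_range] at h
    have := Fintype.linearIndependent_iff.mp hind (fun i => c i) h (Fin.last m)
    rw [Fin.val_last, hcm] at this
    exact ht0 this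
  · have h1 : A.mulVec (φ ∘ ∑ i ∈ Finset.range (m + 1), c i • e i) =
        ∑ i ∈ Finset.range (m + 1), φ (c i) • e (i + 1) := by
      have h2 : (φ ∘ ∑ i ∈ Finset.range (m + 1), c i • e i) =
          ∑ i ∈ Finset.range (m + 1), φ (c i) • (φ ∘ e i) := by
        ext j
        simp [Finset.sum_apply]
      rw [h2, ← Matrix.mulVecLin_apply, map_sum]
      refine Finset.sum_congr rfl fun i _ => ?_
      rw [map_smul, Matrix.mulVecLin_apply, he]
    rw [h1, Finset.sum_range_succ, hcm, ← ha, Finset.smul_sum, Finset.sum_range_succ',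
      Finset.sum_range_succ' (fun i => c i • e i), hc0, smul_smul, ← add_assoc,
      ← Finset.sum_add_distrib]
    congr 1
    refine Finset.sum_congr rfl fun i _ => ?_
    rw [hcs, smul_smul, add_smul]

/-- Lang's theorem for `GL_n` over a separably closed field. -/
theorem exists_lang (F : Type*) [Field F] [Fintype F] {Ω : Type*} [Field Ω] [Algebra F Ω]
    [IsSepClosed Ω] {n : ℕ} (A : Matrix (Fin n) (Fin n) Ω) (hA : A.det ≠ 0) :
    ∃ X : Matrix (Fin n) (Fin n) Ω, X.det ≠ 0 ∧ X = A * X.map (frobPow F Ω 1) := by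
  let φ := frobPow F Ω 1
  induction n with
  | zero => exact ⟨1, by simp, Subsingleton.elim _ _⟩
  | succ n ih =>
    obtain ⟨y, hy0, hy⟩ := exists_fixed_vector F hA
    obtain ⟨i, hi⟩ := Function.ne_iff.mp hy0
    obtain ⟨g, hg, -, hgdet⟩ := exists_matrix_col_zero y i
    have hgne : g.det ≠ 0 := by rcases hgdet with h | h <;> rw [h] <;> simpa using hi
    have hgu : IsUnit g.det := isUnit_iff_ne_zero.mpr hgne
    obtain ⟨A', hA'⟩ : ∃ A', A' = g⁻¹ * (A * g.map φ) := ⟨_, rfl⟩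
    have hgA : g * A' = A * g.map φ := by rw [hA', Matrix.mul_nonsing_inv_cancel_left _ _ hgu]
    have hcol (l : Fin (n + 1)) :
        A' l 0 = (1 : Matrix (Fin (n + 1)) (Fin (n + 1)) Ω) l 0 := by
      have h1 (m) : (A * g.map φ) m 0 = g m 0 := by
        rw [hg, ← congrFun hy m, Matrix.mul_apply, Matrix.mulVec, dotProduct]
        simp [hg, φ]
      rw [hA', ← Matrix.nonsing_inv_mul g hgu, Matrix.mul_apply, Matrix.mul_apply]
      exact Finset.sum_congr rfl fun m _ => by rw [h1]
    -- Moving the fixed vector to the first basis vector gives a block matrix with corner `1`.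
    -- Induction solves the lower block; the remaining row consists of Artin–Schreier equations.
    have hblock := eq_blockMatrix A' fun l => by rw [hcol]; simp
    have hA'det : A'.det ≠ 0 := by
      intro h
      have h1 := congrArg Matrix.det hgA
      rw [Matrix.det_mul, h, mul_zero, Matrix.det_mul, eq_comm, mul_eq_zero] at h1
      rcases h1 with h1 | h1
      · exact hA h1
      · rw [← RingHom.mapMatrix_apply, ← RingHom.map_det, map_eq_zero] at h1
        exact hgne h1
    rw [hblock, det_blockMatrix] at hA'det
    obtain ⟨X', hX'det, hX'⟩ := ih _ (right_ne_zero_of_mul hA'det)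
    choose u hu using fun j : Fin n => exists_sub_frob_eq F
      (Matrix.vecMul (fun j => A' 0 j.succ) (X'.map φ) j)
    refine ⟨g * blockMatrix 1 u X', ?_, ?_⟩
    · rw [Matrix.det_mul, det_blockMatrix, one_mul]
      exact mul_ne_zero hgne hX'det
    · rw [Matrix.map_mul, ← Matrix.mul_assoc, ← hgA, Matrix.mul_assoc]
      congr 1
      rw [hblock, map_blockMatrix, blockMatrix_mul, hcol, ← hX', map_one]
      simp only [Matrix.one_apply_eq, mul_one, one_smul]
      congr 1
      ext j
      exact hu j

/-- Substituting `Y = X Y'` removes `A`: the equation becomes `Y' = Y'^(q) + X⁻¹ C`, an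
Artin–Schreier equation in each entry. -/
theorem exists_lang_affine (F : Type*) [Field F] [Fintype F] {Ω : Type*} [Field Ω] [Algebra F Ω]
    [IsSepClosed Ω] {n : ℕ} {A X : Matrix (Fin n) (Fin n) Ω} (hX : X.det ≠ 0)
    (hAX : X = A * X.map (frobPow F Ω 1)) (C : Matrix (Fin n) (Fin n) Ω) :
    ∃ Y : Matrix (Fin n) (Fin n) Ω, Y = A * Y.map (frobPow F Ω 1) + C := by
  choose Y hY using fun i j => exists_sub_frob_eq F ((X⁻¹ * C) i j)
  have hY' : Matrix.of Y = (Matrix.of Y).map (frobPow F Ω 1) + X⁻¹ * C := by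
    ext i j
    exact hY i j
  refine ⟨X * Matrix.of Y, ?_⟩
  rw [Matrix.map_mul, ← Matrix.mul_assoc, ← hAX]
  conv_lhs => rw [hY']
  rw [Matrix.mul_add, Matrix.mul_nonsing_inv_cancel_left _ _ (isUnit_iff_ne_zero.mpr hX)]

/-- The coefficients of a solution over `Ω⟦z⟧` of Lang's equation. -/
def langCoeff {M : Type*} [AddCommMonoid M] (X₀ : M) (mul : ℕ → M → M) (solve : M → M) : ℕ → M
  | 0 => X₀
  | k + 1 => solve (∑ j : Fin (k + 1), mul (k + 1 - j) (langCoeff X₀ mul solve j))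

theorem coeff_frob (A : Type*) [CommRing A] [Algebra F A] (f : A⟦X⟧) (k : ℕ) :
    PowerSeries.coeff k (frob F A f) = PowerSeries.coeff k f ^ Fintype.card F := by
  simp [frob]

/-- Lang's theorem for `GL_n` over the power series ring of a separably closed field. -/
theorem exists_lang_powerSeries (F : Type*) [Field F] [Fintype F] {Ω : Type*} [Field Ω]
    [Algebra F Ω] [IsSepClosed Ω] {n : ℕ} (A : Matrix (Fin n) (Fin n) Ω⟦X⟧) (hA : IsUnit A.det) :
    ∃ X : Matrix (Fin n) (Fin n) Ω⟦X⟧, IsUnit X.det ∧ X = A * X.map (frob F Ω) := by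
  let φ := frobPow F Ω 1
  let co (k : ℕ) (M : Matrix (Fin n) (Fin n) Ω⟦X⟧) : Matrix (Fin n) (Fin n) Ω :=
    M.map (PowerSeries.coeff k)
  have hdet (M : Matrix (Fin n) (Fin n) Ω⟦X⟧) : IsUnit M.det ↔ (co 0 M).det ≠ 0 := by
    rw [PowerSeries.isUnit_iff_constantCoeff, RingHom.map_det, isUnit_iff_ne_zero]
    have : (PowerSeries.constantCoeff (R := Ω)).mapMatrix M = co 0 M := by
      ext i j
      simp [co]
    rw [this]
  obtain ⟨X₀, hX₀det, hX₀⟩ := exists_lang F (co 0 A) ((hdet A).mp hA)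
  choose solve hsolve using exists_lang_affine F hX₀det hX₀
  let x := langCoeff X₀ (fun i M => co i A * M.map φ) solve
  -- The coefficient of `z^k` in `X = A σ̂(X)` is an affine Lang equation for `x k`, with linear
  -- part the constant term of `A` and inhomogeneous term formed from earlier coefficients.
  have hx (k) : x k = ∑ p ∈ Finset.HasAntidiagonal.antidiagonal k, co p.1 A * (x p.2).map φ := by
    cases k with
    | zero => simpa [x, langCoeff] using hX₀
    | succ k =>
      have h1 : x (k + 1) = solve (∑ j : Fin (k + 1), co (k + 1 - j) A * (x j).map φ) := by
        simp only [x]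
        rw [langCoeff]
      rw [← Finset.Nat.sum_antidiagonal_swap, Finset.Nat.sum_antidiagonal_eq_sum_range_succ_mk,
        Finset.sum_range_succ, Finset.sum_range, h1, hsolve, ← h1, add_comm]
      simp only [Prod.fst_swap, Prod.snd_swap, Nat.sub_self]
      rfl
  let Y : Matrix (Fin n) (Fin n) Ω⟦X⟧ := Matrix.of fun i j => PowerSeries.mk fun k => x k i j
  have hY (k) : co k Y = x k := by
    ext i j
    simp [co, Y]
  refine ⟨Y, ?_, ?_⟩
  · rw [hdet, hY]
    simpa [x, langCoeff] using hX₀det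
  · ext i j k
    have h1 := congrFun (congrFun (hY k) i) j
    have h2 : PowerSeries.coeff k (Y i j) = x k i j := h1
    rw [h2, hx, Matrix.mul_apply, map_sum, Matrix.sum_apply]
    simp only [Matrix.mul_apply, PowerSeries.coeff_mul]
    rw [Finset.sum_comm]
    refine Finset.sum_congr rfl fun l _ => Finset.sum_congr rfl fun p _ => ?_
    rw [Matrix.map_apply, Matrix.map_apply, coeff_frob, ← hY]
    simp [co, φ, frobPow_apply]

theorem exists_algebraMap_of_pow_card_eq {a : Ω} (ha : a ^ Fintype.card F = a) :
    ∃ b : F, algebraMap F Ω b = a := by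
  have h := FiniteField.roots_X_pow_card_sub_X F
  have h1 : (Polynomial.X ^ Fintype.card F - Polynomial.X : Polynomial F).Splits := by
    rw [Polynomial.splits_iff_card_roots, h,
      FiniteField.X_pow_card_sub_X_natDegree_eq F Fintype.one_lt_card]
    rfl
  have h2 : a ∈ ((Polynomial.X ^ Fintype.card F - Polynomial.X : Polynomial F).map
      (algebraMap F Ω)).roots := by
    rw [Polynomial.mem_roots (Polynomial.map_ne_zero
      (FiniteField.X_pow_card_sub_X_ne_zero F Fintype.one_lt_card))]
    simp [ha]
  rw [h1.roots_map, h, Multiset.mem_map] at h2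
  obtain ⟨b, -, hb⟩ := h2
  exact ⟨b, hb⟩

/-- The elements of `Ω⟦z⟧` fixed by `σ̂` are those of `F⟦z⟧`. -/
theorem exists_algebraMap_of_frob_eq {f : Ω⟦X⟧} (hf : frob F Ω f = f) :
    ∃ g : F⟦X⟧, algebraMap F⟦X⟧ Ω⟦X⟧ g = f := by
  choose b hb using fun k => exists_algebraMap_of_pow_card_eq (F := F)
    (a := PowerSeries.coeff k f) (by rw [← coeff_frob, hf])
  refine ⟨PowerSeries.mk b, ?_⟩
  ext k
  rw [PowerSeries.algebraMap_apply'', PowerSeries.coeff_map, PowerSeries.coeff_mk, hb]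

end Lang

/-! ### The element `z - ζ` of `O⟦z⟧` is prime -/

section ZSub

variable {O : Type*} [CommRing O] [IsDomain O] [IsLocalRing O]
  [IsAdicComplete (IsLocalRing.maximalIdeal O) O] {ζ : O}

theorem map_residue_zSub (hζ : ζ ∈ IsLocalRing.maximalIdeal O) :
    (zSub ζ).map (IsLocalRing.residue O) = PowerSeries.X := by
  simp [zSub, (IsLocalRing.residue_eq_zero_iff ζ).mpr hζ]

/-- Weierstrass division: `z - ζ` reduces to `z`, of order `1`, so the remainder is constant. -/
theorem exists_eq_zSub_mul_add (hζ : ζ ∈ IsLocalRing.maximalIdeal O) (f : O⟦X⟧) :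
    ∃ (g : O⟦X⟧) (c : O), f = zSub ζ * g + PowerSeries.C c := by
  have hg : (zSub ζ).map (IsLocalRing.residue O) ≠ 0 := by
    rw [map_residue_zSub hζ]
    exact PowerSeries.X_ne_zero
  obtain ⟨q, r, hdeg, hr⟩ := f.exists_isWeierstrassDivision hg
  have hdeg' : r.degree < ((zSub ζ).map (IsLocalRing.residue O)).order.toNat := hdeg
  rw [map_residue_zSub hζ, PowerSeries.order_X] at hdeg'
  have hcoeff := (Polynomial.degree_lt_iff_coeff_zero _ _).mp hdeg'
  have hr0 : r = Polynomial.C (r.coeff 0) := by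
    ext k
    cases k with
    | zero => simp
    | succ k => rw [hcoeff _ (by simp), Polynomial.coeff_C_succ]
  refine ⟨q, r.coeff 0, ?_⟩
  rw [hr]
  congr 1
  conv_lhs => rw [hr0]
  exact Polynomial.coe_C _

/-- Comparing coefficients in `c = (z - ζ) g` gives `c = -ζ^(k+1) g_k` for all `k`, and `O` is
separated. -/
theorem eq_zero_of_zSub_dvd (hζ : ζ ∈ IsLocalRing.maximalIdeal O) {c : O}
    (h : zSub ζ ∣ PowerSeries.C c) : c = 0 := by
  obtain ⟨g, hg⟩ := h
  have h1 (k : ℕ) : c = - (ζ ^ (k + 1) * PowerSeries.coeff k g) := by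
    induction k with
    | zero =>
      have := congrArg PowerSeries.constantCoeff hg
      simpa [zSub] using this
    | succ k ih =>
      have := congrArg (PowerSeries.coeff (k + 1)) hg
      rw [zSub, sub_mul, map_sub, PowerSeries.coeff_succ_X_mul, PowerSeries.coeff_C_mul,
        PowerSeries.coeff_C, if_neg k.succ_ne_zero] at this
      rw [ih, pow_succ _ (k + 1)]
      linear_combination ζ ^ (k + 1) * this
  refine IsHausdorff.haus (I := IsLocalRing.maximalIdeal O) inferInstance c fun k => ?_
  rw [SModEq.zero, smul_eq_mul, Ideal.mul_top, h1 k]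
  refine (Ideal.neg_mem_iff _).mpr (Ideal.mul_mem_right _ _ ?_)
  exact Ideal.pow_le_pow_right k.le_succ (Ideal.pow_mem_pow hζ _)

/-- Modulo `z - ζ` every series is congruent to a unique constant, and `O` is a domain. -/
theorem prime_zSub (hζ : ζ ∈ IsLocalRing.maximalIdeal O) : Prime (zSub ζ) := by
  refine ⟨fun h => ?_, fun h => ?_, fun f g h => ?_⟩
  · have := map_residue_zSub hζ
    rw [h, map_zero] at this
    exact PowerSeries.X_ne_zero this.symm
  · exact one_ne_zero (eq_zero_of_zSub_dvd hζ (c := (1 : O)) h.dvd)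
  · obtain ⟨f', c, rfl⟩ := exists_eq_zSub_mul_add hζ f
    obtain ⟨g', d, rfl⟩ := exists_eq_zSub_mul_add hζ g
    have h1 : zSub ζ ∣ PowerSeries.C (c * d) := by
      have h2 := dvd_sub h (dvd_mul_right (zSub ζ)
        (f' * (zSub ζ * g' + PowerSeries.C d) + PowerSeries.C c * g'))
      convert h2 using 1
      rw [map_mul]
      ring
    rcases mul_eq_zero.mp (eq_zero_of_zSub_dvd hζ h1) with rfl | rfl
    · left
      simp
    · right
      simp

end ZSub

/-! ### The matrix and the determinant of `τ` -/

namespace LocalShtuka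

section Matrix

variable {F : Type*} [Field F] [Fintype F] {O : Type*} [CommRing O] [IsDomain O] [Algebra F O]
  {ζ : O} (S : LocalShtuka F O ζ) {n : ℕ} (b : Module.Basis (Fin n) O⟦X⟧ S.M)

theorem mkLinearMap_injective (hζ : zSub ζ ≠ 0) :
    Function.Injective (LocalizedModule.mkLinearMap (zSubPowers ζ) S.M) := by
  intro x y h
  obtain ⟨⟨_, k, rfl⟩, hc⟩ := (IsLocalizedModule.eq_iff_exists (zSubPowers ζ) _).mp h
  exact smul_right_injective S.M (pow_ne_zero k hζ) hc

theorem span_pullback_of :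
    Submodule.span O⟦X⟧ (Set.range fun j => Pullback.of (frob F O) S.M (b j)) = ⊤ := by
  have hof (m : S.M) : Pullback.of (frob F O) S.M m ∈
      Submodule.span O⟦X⟧ (Set.range fun j => Pullback.of (frob F O) S.M (b j)) := by
    rw [← b.sum_repr m, map_sum]
    refine Submodule.sum_mem _ fun j _ => ?_
    rw [map_smulₛₗ]
    exact Submodule.smul_mem _ _ (Submodule.subset_span ⟨j, rfl⟩)
  refine eq_top_iff.mpr fun y _ => ?_
  induction y using TensorProduct.induction_on with
  | zero => exact Submodule.zero_mem _
  | add x y hx hy => exact Submodule.add_mem _ (hx trivial) (hy trivial)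
  | tmul t m =>
    have h : (t ⊗ₜ[O⟦X⟧] m : Pullback (frob F O) S.M) =
        (Twist.of (frob F O)).symm t • Pullback.of (frob F O) S.M m := by
      change t ⊗ₜ[O⟦X⟧] m = t • ((1 : Twist (frob F O)) ⊗ₜ[O⟦X⟧] m)
      rw [TensorProduct.smul_tmul', smul_eq_mul, mul_one]
    exact h ▸ Submodule.smul_mem _ _ (hof m)

/-- The matrices of `τ` and of `(z - ζ)^h τ⁻¹` with respect to a basis of `M`. -/
theorem exists_matrix {h : ℕ} (hS : S.IsEffectiveOfHeightLE h) (hζ : zSub ζ ≠ 0) :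
    ∃ A B : Matrix (Fin n) (Fin n) O⟦X⟧,
      (∀ j, S.τInt (Pullback.of (frob F O) S.M (b j)) =
        LocalizedModule.mkLinearMap (zSubPowers ζ) S.M (∑ i, A i j • b i)) ∧
      A * B = zSub ζ ^ h • 1 := by
  have h1 (j) : ∃ a : Fin n → O⟦X⟧, S.τInt (Pullback.of (frob F O) S.M (b j)) =
      LocalizedModule.mkLinearMap (zSubPowers ζ) S.M (∑ i, a i • b i) := by
    obtain ⟨m, hm⟩ := hS.1 (LinearMap.mem_range_self S.τInt (Pullback.of (frob F O) S.M (b j)))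
    exact ⟨fun i => b.repr m i, by rw [b.sum_repr, hm]⟩
  choose a ha using h1
  have h2 (k) : ∃ c : Fin n → O⟦X⟧, ∑ j, c j • ∑ i, a j i • b i = zSub ζ ^ h • b k := by
    obtain ⟨y, hy⟩ := hS.2 _ (LinearMap.mem_range_self _ (b k))
    have hy' : y ∈ Submodule.span O⟦X⟧ (Set.range fun j => Pullback.of (frob F O) S.M (b j)) := by
      rw [span_pullback_of]
      trivial
    obtain ⟨c, rfl⟩ := (Submodule.mem_span_range_iff_exists_fun _).mp hy'
    refine ⟨c, S.mkLinearMap_injective hζ ?_⟩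
    rw [map_smul, ← hy]
    simp only [map_sum, map_smul, ha]
  choose c hc using h2
  refine ⟨Matrix.of fun i j => a j i, Matrix.of fun j k => c k j, ha, ?_⟩
  ext1 i k
  have h3 := congrArg (fun m => b.repr m i) (hc k)
  simp only [map_sum, map_smul, Finsupp.smul_apply, Finsupp.finsetSum_apply, b.repr_self,
    Finsupp.single_apply, smul_eq_mul, mul_ite, mul_one, mul_zero, Finset.sum_ite_eq',
    Finset.mem_univ, if_true] at h3
  simp only [Matrix.mul_apply, Matrix.of_apply, Matrix.smul_apply, Matrix.one_apply, smul_eq_mul,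
    mul_ite, mul_one, mul_zero]
  rw [show (if i = k then zSub ζ ^ h else 0) = if k = i then zSub ζ ^ h else 0 by
    simp only [eq_comm], ← h3]
  exact Finset.sum_congr rfl fun j _ => mul_comm _ _

theorem τMatrix_eq {A : Matrix (Fin n) (Fin n) O⟦X⟧}
    (hA : ∀ j, S.τInt (Pullback.of (frob F O) S.M (b j)) =
        LocalizedModule.mkLinearMap (zSubPowers ζ) S.M (∑ i, A i j • b i)) :
    S.τMatrix b = A.map (algebraMap O⟦X⟧ (ZSubLoc ζ)) := by
  ext i j
  rw [τMatrix, Matrix.of_apply, hA, Module.Basis.ofIsLocalizedModule_repr_apply, Matrix.map_apply,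
    b.repr_sum_self fun i => A i j]

/-- The determinant of `τ` is a power of `z - ζ`, up to a unit. -/
theorem exists_det_eq [IsLocalRing O] [IsAdicComplete (IsLocalRing.maximalIdeal O) O]
    (hζ : ζ ∈ IsLocalRing.maximalIdeal O) {A B : Matrix (Fin n) (Fin n) O⟦X⟧} {h : ℕ}
    (hAB : A * B = zSub ζ ^ h • 1) : ∃ (a : ℕ) (u : O⟦X⟧ˣ), A.det = zSub ζ ^ a * u := by
  have h1 : A.det ∣ zSub ζ ^ (h * n) := by
    refine ⟨B.det, ?_⟩
    rw [← Matrix.det_mul, hAB, Matrix.det_smul, Matrix.det_one, mul_one, Fintype.card_fin, pow_mul]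
  obtain ⟨a, -, ha⟩ := (dvd_prime_pow (prime_zSub hζ) _).mp h1
  obtain ⟨u, hu⟩ := ha.symm
  exact ⟨a, u, hu.symm⟩

/-- Uniqueness of the dimension in one basis: `z - ζ` is a nonunit and a nonzerodivisor, so its
exponent up to units of `O⟦z⟧` is well defined. Writing `d = p - m` clears denominators. -/
theorem zSubUnit_zpow_eq_iff [IsLocalRing O] [IsAdicComplete (IsLocalRing.maximalIdeal O) O]
    (hζ : ζ ∈ IsLocalRing.maximalIdeal O) (a : ℕ) (u : O⟦X⟧ˣ) (d : ℤ) :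
    (∃ u' : O⟦X⟧ˣ, algebraMap O⟦X⟧ (ZSubLoc ζ) (zSub ζ ^ a * u) =
      ((zSubUnit ζ ^ d : (ZSubLoc ζ)ˣ) : ZSubLoc ζ) * algebraMap O⟦X⟧ (ZSubLoc ζ) u') ↔
      d = a := by
  have hprime := prime_zSub hζ
  have hunit : ((zSubUnit ζ : (ZSubLoc ζ)ˣ) : ZSubLoc ζ) = algebraMap O⟦X⟧ (ZSubLoc ζ) (zSub ζ) :=
    IsUnit.unit_spec _
  have hinj : Function.Injective (algebraMap O⟦X⟧ (ZSubLoc ζ)) :=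
    IsLocalization.injective _ (powers_le_nonZeroDivisors_of_noZeroDivisors hprime.ne_zero)
  constructor
  · rintro ⟨u', hu'⟩
    obtain ⟨p, m, rfl⟩ : ∃ p m : ℕ, d = p - m := ⟨d.toNat, (-d).toNat, by omega⟩
    have h1 : zSub ζ ^ (m + a) * u = zSub ζ ^ p * u' := by
      apply hinj
      rw [pow_add, mul_assoc, map_mul, hu', map_mul, map_pow, map_pow, ← hunit, ← mul_assoc]
      congr 1
      rw [← Units.val_pow_eq_pow_val, ← Units.val_mul, ← Units.val_pow_eq_pow_val,
        ← zpow_natCast, ← zpow_natCast, ← zpow_add, add_sub_cancel]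
    have h2 : zSub ζ ^ (m + a) ∣ zSub ζ ^ p :=
      (Units.dvd_mul_right (u := u')).mp ⟨u, h1.symm⟩
    have h3 : zSub ζ ^ p ∣ zSub ζ ^ (m + a) := (Units.dvd_mul_right (u := u)).mp ⟨u', h1⟩
    rw [pow_dvd_pow_iff hprime.ne_zero hprime.not_isUnit] at h2 h3
    omega
  · rintro rfl
    refine ⟨u, ?_⟩
    rw [map_mul, map_pow, zpow_natCast, Units.val_pow_eq_pow_val, hunit]

end Matrix

end LocalShtuka

namespace LocalShtuka

/-! ### A basis of the dual Tate module -/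

section TateBasis

variable {F : Type*} [Field F] [Fintype F] {O : Type*} [CommRing O] [Algebra F O] {ζ : O}
  (S : LocalShtuka F O ζ) (L : Type*) [Field L] [Algebra O L]
  (Ω : Type*) [Field Ω] [Algebra O Ω] [Algebra L Ω] [IsScalarTower O L Ω]
  [Algebra F Ω] [IsScalarTower F O Ω] (hζ : algebraMap O Ω ζ ≠ 0)
  {n : ℕ} (b : Module.Basis (Fin n) O⟦X⟧ S.M)

/-- The basis of `M ⊗ Ω⟦z⟧` given by a basis of `M`. -/
def extBasis : Module.Basis (Fin n) Ω⟦X⟧ (S.Ext Ω) := Algebra.TensorProduct.basis Ω⟦X⟧ b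

theorem extBasis_apply (i) : S.extBasis Ω b i = 1 ⊗ₜ b i := Algebra.TensorProduct.basis_apply b i

theorem smul_extBasis (f : Ω⟦X⟧) (i) : f • S.extBasis Ω b i = f ⊗ₜ b i := by
  rw [extBasis_apply, TensorProduct.smul_tmul', smul_eq_mul, mul_one]

variable {A : Matrix (Fin n) (Fin n) O⟦X⟧}

theorem τExt_pullExt_sum (hA : ∀ j, S.τInt (Pullback.of (frob F O) S.M (b j)) =
      LocalizedModule.mkLinearMap (zSubPowers ζ) S.M (∑ i, A i j • b i)) (f : Fin n → Ω⟦X⟧) :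
    S.τExt Ω hζ (S.pullExt Ω (∑ j, f j • S.extBasis Ω b j)) =
      ∑ i, (A.map (algebraMap O⟦X⟧ Ω⟦X⟧)).mulVec (frob F Ω ∘ f) i • S.extBasis Ω b i := by
  have h1 (j) : S.τExt Ω hζ (S.pullExt Ω (f j • S.extBasis Ω b j)) =
      ∑ i, (algebraMap O⟦X⟧ Ω⟦X⟧ (A i j) * frob F Ω (f j)) • S.extBasis Ω b i := by
    have h2 : S.τExt Ω hζ (S.pullExt Ω (f j • S.extBasis Ω b j)) =
        frob F Ω (f j) • locToExt Ω hζ S.M (S.τInt (Pullback.of (frob F O) S.M (b j))) := by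
      rw [smul_extBasis]
      rfl
    have h3 (x : S.M) : locToExt Ω hζ S.M (LocalizedModule.mkLinearMap (zSubPowers ζ) S.M x) =
        (1 : Ω⟦X⟧) ⊗ₜ[O⟦X⟧] x := by
      rw [LocalizedModule.mkLinearMap_apply, locToExt, LocalizedModule.lift_mk_one]
      rfl
    rw [h2, hA, h3, TensorProduct.tmul_sum, Finset.smul_sum]
    refine Finset.sum_congr rfl fun i _ => ?_
    rw [TensorProduct.tmul_smul, ← extBasis_apply, mul_comm, mul_smul, algebraMap_smul]
  simp only [map_sum, h1, Matrix.mulVec, dotProduct, Matrix.map_apply, Function.comp_apply,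
    Finset.sum_smul]
  rw [Finset.sum_comm]

theorem galExt_sum (s : Ω ≃ₐ[L] Ω) (f : Fin n → Ω⟦X⟧) :
    S.galExt L Ω s (∑ j, f j • S.extBasis Ω b j) =
      ∑ j, PowerSeries.map (s : Ω →+* Ω) (f j) • S.extBasis Ω b j := by
  rw [map_sum]
  refine Finset.sum_congr rfl fun j _ => ?_
  rw [galExt_smul]
  congr 1
  rw [extBasis_apply]
  change galPowerSeries (O := O) L Ω s 1 ⊗ₜ[O⟦X⟧] _ = _
  congr 1
  exact map_one (PowerSeries.map (s : Ω →+* Ω))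

theorem mem_dualTate_iff (hA : ∀ j, S.τInt (Pullback.of (frob F O) S.M (b j)) =
      LocalizedModule.mkLinearMap (zSubPowers ζ) S.M (∑ i, A i j • b i)) (f : Fin n → Ω⟦X⟧) :
    ∑ j, f j • S.extBasis Ω b j ∈ S.dualTate Ω hζ ↔
      (A.map (algebraMap O⟦X⟧ Ω⟦X⟧)).mulVec (frob F Ω ∘ f) = f := by
  change S.τExt Ω hζ (S.pullExt Ω _) = _ ↔ _
  rw [τExt_pullExt_sum S Ω hζ b hA]
  constructor
  · intro h
    rw [← Module.Basis.equivFun_symm_apply, ← Module.Basis.equivFun_symm_apply] at h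
    exact (S.extBasis Ω b).equivFun.symm.injective h
  · intro h
    rw [h]

/-- The basis consists of the columns of a Lang solution `X = A σ̂(X)`: a vector `f` is `τ`-fixed
exactly when `X⁻¹ f` is fixed by `σ̂`, that is, has entries in `F⟦z⟧`. -/
theorem exists_tate_basis [Algebra F L] [IsScalarTower F L Ω] [IsSepClosed Ω]
    (hA : ∀ j, S.τInt (Pullback.of (frob F O) S.M (b j)) =
      LocalizedModule.mkLinearMap (zSubPowers ζ) S.M (∑ i, A i j • b i))
    (hdet : IsUnit (A.map (algebraMap O⟦X⟧ Ω⟦X⟧)).det) :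
    ∃ (X : Matrix (Fin n) (Fin n) Ω⟦X⟧) (t : Module.Basis (Fin n) F⟦X⟧ (S.dualTate Ω hζ)),
      IsUnit X.det ∧ X = A.map (algebraMap O⟦X⟧ Ω⟦X⟧) * X.map (frob F Ω) ∧
      ∀ s : Ω ≃ₐ[L] Ω, X.map (PowerSeries.map (s : Ω →+* Ω)) =
        X * (LinearMap.toMatrix t t (S.dualTateRep L Ω hζ s)).map (algebraMap F⟦X⟧ Ω⟦X⟧) := by
  obtain ⟨X, hXdet, hX⟩ := exists_lang_powerSeries F _ hdet
  let e := S.extBasis Ω b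
  let t (j : Fin n) : S.dualTate Ω hζ := ⟨∑ i, X i j • e i, by
    rw [mem_dualTate_iff S Ω hζ b hA]
    ext1 i
    conv_rhs => rw [hX, Matrix.mul_apply]
    rfl⟩
  have hsum (c : Fin n → F⟦X⟧) : ((∑ j, c j • t j : S.dualTate Ω hζ) : S.Ext Ω) =
      ∑ i, X.mulVec (algebraMap F⟦X⟧ Ω⟦X⟧ ∘ c) i • e i := by
    rw [Submodule.coe_sum]
    simp only [Submodule.coe_smul, t, Matrix.mulVec, dotProduct, Finset.sum_smul,
      Function.comp_apply]
    rw [Finset.sum_comm]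
    refine Finset.sum_congr rfl fun j _ => ?_
    rw [← algebraMap_smul Ω⟦X⟧ (c j), Finset.smul_sum]
    exact Finset.sum_congr rfl fun i _ => by rw [smul_smul, mul_comm]
  have hinj (f g : Fin n → Ω⟦X⟧) (h : ∑ i, f i • e i = ∑ i, g i • e i) : f = g := by
    rw [← e.equivFun_symm_apply, ← e.equivFun_symm_apply] at h
    exact e.equivFun.symm.injective h
  have halg : Function.Injective (algebraMap F⟦X⟧ Ω⟦X⟧) := by
    intro f g h
    ext k
    have h1 := congrArg (PowerSeries.coeff k) h
    rw [PowerSeries.algebraMap_apply'', PowerSeries.algebraMap_apply'', PowerSeries.coeff_map,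
      PowerSeries.coeff_map] at h1
    exact (algebraMap F Ω).injective h1
  have hli : LinearIndependent F⟦X⟧ t := by
    refine linearIndependent_iff_injective_fintypeLinearCombination.mpr fun c c' hc => ?_
    have h1 := congrArg Subtype.val hc
    rw [Fintype.linearCombination_apply, Fintype.linearCombination_apply, hsum, hsum] at h1
    have h3 := congrArg (X⁻¹.mulVec) (hinj _ _ h1)
    rw [Matrix.mulVec_mulVec, Matrix.mulVec_mulVec, Matrix.nonsing_inv_mul _ hXdet,
      Matrix.one_mulVec, Matrix.one_mulVec] at h3
    exact funext fun i => halg (congrFun h3 i)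
  have hspan : ⊤ ≤ Submodule.span F⟦X⟧ (Set.range t) := by
    rintro ⟨x, hx⟩ -
    obtain ⟨f, rfl⟩ : ∃ f : Fin n → Ω⟦X⟧, ∑ j, f j • e j = x := ⟨e.equivFun x, e.sum_equivFun x⟩
    have hf := (mem_dualTate_iff S Ω hζ b hA f).mp hx
    -- Indeed `X σ̂(X⁻¹ f) = A σ̂(X) σ̂(X⁻¹ f) = A σ̂(f) = f`.
    have h1 : (frob F Ω ∘ X⁻¹.mulVec f) = X⁻¹.mulVec f := by
      have h2 : (X.map (frob F Ω)).mulVec (frob F Ω ∘ X⁻¹.mulVec f) = frob F Ω ∘ f := by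
        ext1 i
        have h3 : X.mulVec (X⁻¹.mulVec f) = f := by
          rw [Matrix.mulVec_mulVec, Matrix.mul_nonsing_inv _ hXdet, Matrix.one_mulVec]
        rw [Function.comp_apply]
        conv_rhs => rw [← h3]
        simp [Matrix.mulVec, dotProduct]
      have hXg (g) : X.mulVec g =
          (A.map (algebraMap O⟦X⟧ Ω⟦X⟧)).mulVec ((X.map (frob F Ω)).mulVec g) := by
        rw [Matrix.mulVec_mulVec, ← hX]
      have h4 : X.mulVec (frob F Ω ∘ X⁻¹.mulVec f) = f := by
        rw [hXg, h2, hf]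
      conv_rhs => rw [← h4]
      rw [Matrix.mulVec_mulVec, Matrix.nonsing_inv_mul _ hXdet, Matrix.one_mulVec]
    choose c hc using fun i => exists_algebraMap_of_frob_eq (congrFun h1 i)
    have h5 : (⟨∑ j, f j • e j, hx⟩ : S.dualTate Ω hζ) = ∑ j, c j • t j := by
      apply Subtype.ext
      rw [hsum, show algebraMap F⟦X⟧ Ω⟦X⟧ ∘ c = X⁻¹.mulVec f from funext hc,
        Matrix.mulVec_mulVec, Matrix.mul_nonsing_inv _ hXdet, Matrix.one_mulVec]
    rw [h5]
    exact Submodule.sum_mem _ fun j _ => Submodule.smul_mem _ _ (Submodule.subset_span ⟨j, rfl⟩)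
  refine ⟨X, Module.Basis.mk hli hspan, hXdet, hX, fun s => ?_⟩
  ext1 i j
  let t' := Module.Basis.mk hli hspan
  have ht' (j) : t' j = t j := Module.Basis.mk_apply hli hspan j
  have h1 : S.dualTateRep L Ω hζ s (t j) =
      ∑ k, LinearMap.toMatrix t' t' (S.dualTateRep L Ω hζ s) k j • t k := by
    rw [← ht' j, ← t'.sum_repr (S.dualTateRep L Ω hζ s (t' j))]
    simp only [LinearMap.toMatrix_apply, ht']
  have h2 := congrArg Subtype.val h1
  rw [hsum] at h2
  have h3 : ((S.dualTateRep L Ω hζ s (t j) : S.dualTate Ω hζ) : S.Ext Ω) =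
      ∑ i, PowerSeries.map (s : Ω →+* Ω) (X i j) • e i := galExt_sum S L Ω b s fun i => X i j
  exact congrFun (hinj _ _ (h3.symm.trans h2)) i

end TateBasis

end LocalShtuka

/-! ### Characteristic polynomials of reductions of lattices -/

section LatticeCharpoly

variable {F : Type*} [Field F] {G : Type*} [Group G] {V : Type*} [AddCommGroup V]
  [Module F⸨X⸩ V] [Module F⟦X⟧ V] [IsScalarTower F⟦X⟧ F⸨X⸩ V]

/-- The projection `T → T / 𝔭 T`. -/
def Residual.mk (T : Submodule F⟦X⟧ V) : T →ₗ[F⟦X⟧] Residual T :=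
  Submodule.mkQ (Ideal.span {(PowerSeries.X : F⟦X⟧)} • ⊤ : Submodule F⟦X⟧ T)

theorem Residual.mk_surjective (T : Submodule F⟦X⟧ V) : Function.Surjective (Residual.mk T) :=
  Submodule.mkQ_surjective _

theorem Residual.mk_eq_zero_iff {T : Submodule F⟦X⟧ V} (x : T) :
    Residual.mk T x = 0 ↔ ∃ y : T, (PowerSeries.X : F⟦X⟧) • y = x := by
  have h : Residual.mk T x = 0 ↔
      x ∈ (Ideal.span {(PowerSeries.X : F⟦X⟧)} • ⊤ : Submodule F⟦X⟧ T) :=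
    Submodule.Quotient.mk_eq_zero _
  rw [h, Submodule.ideal_span_singleton_smul, Submodule.mem_smul_pointwise_iff_exists]
  simp

theorem Residual.mk_smul {T : Submodule F⟦X⟧ V} (f : F⟦X⟧) (x : T) :
    Residual.mk T (f • x) = PowerSeries.constantCoeff f • Residual.mk T x := by
  have h1 : f = PowerSeries.C (PowerSeries.constantCoeff f) +
      PowerSeries.X * PowerSeries.mk fun k => PowerSeries.coeff (k + 1) f := by
    rw [add_comm, ← PowerSeries.eq_X_mul_shift_add_const]
  have h2 : Residual.mk T ((PowerSeries.X * PowerSeries.mk fun k =>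
      PowerSeries.coeff (k + 1) f) • x) = 0 :=
    (Residual.mk_eq_zero_iff _).mpr ⟨_, (mul_smul _ _ _).symm⟩
  conv_lhs => rw [h1, add_smul, map_add, h2, add_zero, map_smul]
  rfl

/-- A basis of a lattice gives a basis of its reduction. -/
def residualBasis {T : Submodule F⟦X⟧ V} {ι : Type*} [Fintype ι] (t : Module.Basis ι F⟦X⟧ T) :
    Module.Basis ι F (Residual T) :=
  Module.Basis.mk (v := fun i => Residual.mk T (t i)) (by
      rw [Fintype.linearIndependent_iff]
      intro c hc i
      have h1 : Residual.mk T (∑ i, PowerSeries.C (c i) • t i) = 0 := by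
        rw [map_sum, ← hc]
        exact Finset.sum_congr rfl fun i _ => by rw [Residual.mk_smul, PowerSeries.constantCoeff_C]
      obtain ⟨y, hy⟩ := (Residual.mk_eq_zero_iff _).mp h1
      have h2 := congrArg (fun x => PowerSeries.constantCoeff (t.repr x i)) hy
      simp only [map_smul, t.repr_sum_self, Finsupp.smul_apply, smul_eq_mul, map_mul,
        PowerSeries.constantCoeff_X, zero_mul, PowerSeries.constantCoeff_C] at h2
      exact h2.symm) (by
      rintro x -
      obtain ⟨x, rfl⟩ := Residual.mk_surjective T x
      rw [← t.sum_repr x, map_sum]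
      refine Submodule.sum_mem _ fun i _ => ?_
      rw [Residual.mk_smul]
      exact Submodule.smul_mem _ _ (Submodule.subset_span ⟨i, rfl⟩))

theorem residualBasis_apply {T : Submodule F⟦X⟧ V} {ι : Type*} [Fintype ι]
    (t : Module.Basis ι F⟦X⟧ T) (i : ι) : residualBasis t i = Residual.mk T (t i) :=
  Module.Basis.mk_apply _ _ i

variable (ρ : Representation F⸨X⸩ G V) {T : Submodule F⟦X⟧ V} (hT : ∀ g, ∀ x ∈ T, ρ g x ∈ T)

theorem residualRep_mk (s : G) (x : T) :
    residualRep ρ T hT s (Residual.mk T x) = Residual.mk T (latticeRep ρ T hT s x) := rfl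

theorem toMatrix_residualRep {ι : Type*} [Fintype ι] [DecidableEq ι] (t : Module.Basis ι F⟦X⟧ T)
    (s : G) : LinearMap.toMatrix (residualBasis t) (residualBasis t) (residualRep ρ T hT s) =
      (LinearMap.toMatrix t t (latticeRep ρ T hT s)).map PowerSeries.constantCoeff := by
  ext i j
  rw [LinearMap.toMatrix_apply, residualBasis_apply, residualRep_mk,
    ← t.sum_repr (latticeRep ρ T hT s (t j)), map_sum]
  simp only [Residual.mk_smul, ← residualBasis_apply t]
  rw [(residualBasis t).repr_sum_self, Matrix.map_apply, LinearMap.toMatrix_apply]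

variable [hL : T.IsLattice F⸨X⸩]

theorem toMatrix_latticeRep {ι : Type*} [Fintype ι] [DecidableEq ι] (t : Module.Basis ι F⟦X⟧ T)
    (s : G) : LinearMap.toMatrix (t.extendOfIsLattice F⸨X⸩) (t.extendOfIsLattice F⸨X⸩) (ρ s) =
      (LinearMap.toMatrix t t (latticeRep ρ T hT s)).map (algebraMap F⟦X⟧ F⸨X⸩) := by
  ext i j
  have h : ρ s (t j) = ((latticeRep ρ T hT s (t j) : T) : V) := rfl
  rw [LinearMap.toMatrix_apply, Module.Basis.extendOfIsLattice_apply, h,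
    ← t.sum_repr (latticeRep ρ T hT s (t j)), Submodule.coe_sum]
  simp only [Submodule.coe_smul, ← t.extendOfIsLattice_apply F⸨X⸩,
    ← algebraMap_smul F⸨X⸩ (t.repr _ _)]
  rw [(t.extendOfIsLattice F⸨X⸩).repr_sum_self, Matrix.map_apply, LinearMap.toMatrix_apply]

/-- The characteristic polynomial of the reduction of a lattice does not depend on the lattice. -/
theorem charpoly_residualRep {ι : Type*} [Fintype ι] [DecidableEq ι] (s : G)
    (M : Matrix ι ι F⟦X⟧) [Module.Finite F⸨X⸩ V]
    (hM : (ρ s).charpoly = M.charpoly.map (algebraMap F⟦X⟧ F⸨X⸩)) [Module.Finite F (Residual T)] :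
    (residualRep ρ T hT s).charpoly = M.charpoly.map PowerSeries.constantCoeff := by
  have : Module.Finite F⟦X⟧ T := Module.Finite.iff_fg.mpr hL.fg
  have := Submodule.IsLattice.free F⸨X⸩ T
  let t := Module.Free.chooseBasis F⟦X⟧ T
  classical
  -- A basis of `T` is also a basis of `V`, so the polynomials agree over `F⸨z⸩`, hence over `F⟦z⟧`,
  -- before any reduction.
  have h1 : (LinearMap.toMatrix t t (latticeRep ρ T hT s)).charpoly = M.charpoly := by
    apply Polynomial.map_injective (algebraMap F⟦X⟧ F⸨X⸩) (IsFractionRing.injective _ _)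
    rw [← hM, ← Matrix.charpoly_map, ← toMatrix_latticeRep, LinearMap.charpoly_toMatrix]
  rw [← LinearMap.charpoly_toMatrix _ (residualBasis t), toMatrix_residualRep,
    Matrix.charpoly_map, h1]

end LatticeCharpoly

theorem finite_residual {F V : Type*} [Field F] [AddCommGroup V]
  [Module F⸨X⸩ V] [Module F⟦X⟧ V] [IsScalarTower F⟦X⟧ F⸨X⸩ V] (T : Submodule F⟦X⟧ V)
  [hL : T.IsLattice F⸨X⸩] : Module.Finite F (Residual T) := by
  have : Module.Finite F⟦X⟧ T := Module.Finite.iff_fg.mpr hL.fg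
  have := Submodule.IsLattice.free F⸨X⸩ T
  exact Module.Finite.of_basis (residualBasis (Module.Free.chooseBasis F⟦X⟧ T))

theorem charpoly_baseChange_transpose {R K D : Type*} [CommRing R] [CommRing K] [Algebra R K]
    [AddCommGroup D] [Module R D] {n : ℕ} (t : Module.Basis (Fin n) R D) (u : D →ₗ[R] D)
    [Module.Free K (K ⊗[R] Module.Dual R D)] [Module.Finite K (K ⊗[R] Module.Dual R D)] :
    (LinearMap.baseChange K (Module.Dual.transpose (R := R) u)).charpoly =
      (LinearMap.toMatrix t t u).charpoly.map (algebraMap R K) := by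
  rw [← LinearMap.charpoly_toMatrix _ (Algebra.TensorProduct.basis K t.dualBasis),
    LinearMap.toMatrix_baseChange, Matrix.charpoly_map, LinearMap.toMatrix_transpose,
    Matrix.charpoly_transpose]

namespace LocalShtuka

section

variable {F : Type*} [Field F] [Fintype F] {O : Type*} [CommRing O] [Algebra F O] {ζ : O}
  (S : LocalShtuka F O ζ) (L : Type*) [Field L] [Algebra O L]
  (Ω : Type*) [Field Ω] [Algebra O Ω] [Algebra L Ω] [IsScalarTower O L Ω]
  [Algebra F Ω] [IsScalarTower F O Ω] (hζ : algebraMap O Ω ζ ≠ 0)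
  [Algebra F L] [IsScalarTower F L Ω] {n : ℕ} (t : Module.Basis (Fin n) F⟦X⟧ (S.dualTate Ω hζ))

/-- The dual representation of `s` is the transpose of `s⁻¹`, and transposing keeps the
characteristic polynomial. This inverse makes the exponents positive. -/
theorem charpoly_ratTateRep [Module.Finite F⸨X⸩ (S.RatTate Ω hζ)] (s : Ω ≃ₐ[L] Ω) :
    (S.ratTateRep L Ω hζ s).charpoly =
      (LinearMap.toMatrix t t (S.dualTateRep L Ω hζ s⁻¹)).charpoly.map
        (algebraMap F⟦X⟧ F⸨X⸩) := by
  convert charpoly_baseChange_transpose (R := F⟦X⟧) (K := F⸨X⸩) (D := S.dualTate Ω hζ) t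
    (S.dualTateRep L Ω hζ s⁻¹)
  rfl

/-- The lattice `T_𝔭` in `V_𝔭`. -/
def tateLattice : Submodule F⟦X⟧ (S.RatTate Ω hζ) :=
  LinearMap.range (TensorProduct.mk F⟦X⟧ F⸨X⸩ (S.Tate Ω hζ) 1)

theorem isLattice_tateLattice [Module.Finite F⟦X⟧ (S.Tate Ω hζ)] :
    (S.tateLattice Ω hζ).IsLattice F⸨X⸩ where
  fg := Submodule.fg_range _
  span_eq_top := by
    refine eq_top_iff.mpr fun x _ => ?_
    induction x using TensorProduct.induction_on with
    | zero => exact Submodule.zero_mem _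
    | add x y hx hy => exact Submodule.add_mem _ (hx trivial) (hy trivial)
    | tmul f y =>
      rw [← mul_one f, ← smul_eq_mul, ← TensorProduct.smul_tmul']
      exact Submodule.smul_mem _ _ (Submodule.subset_span ⟨y, rfl⟩)

theorem ratTateRep_mem_tateLattice (s : Ω ≃ₐ[L] Ω) (x) (hx : x ∈ S.tateLattice Ω hζ) :
    S.ratTateRep L Ω hζ s x ∈ S.tateLattice Ω hζ := by
  obtain ⟨y, rfl⟩ := hx
  exact ⟨(S.dualTateRep L Ω hζ).dual s y, rfl⟩

end

end LocalShtuka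

/-! ### The inertia action on the reduction of a Tate lattice -/

section Glue

theorem constantCoeff_map' {R S : Type*} [CommRing R] [CommRing S] (f : R →+* S) (x : R⟦X⟧) :
    PowerSeries.constantCoeff (PowerSeries.map f x) = f (PowerSeries.constantCoeff x) := by
  rw [← PowerSeries.coeff_zero_eq_constantCoeff_apply, PowerSeries.coeff_map,
    PowerSeries.coeff_zero_eq_constantCoeff_apply]

variable (O : Type*) [CommRing O] [IsDomain O] [IsDiscreteValuationRing O]
    [IsAdicComplete (IsLocalRing.maximalIdeal O) O]
    (L : Type*) [Field L] [Algebra O L] [IsFractionRing O L]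
    (Ω : Type*) [Field Ω] [Algebra L Ω] [Algebra O Ω] [IsScalarTower O L Ω]

theorem smul_eq_apply (s : inertia O L Ω) (x : Ω) : s • x = (s : Ω ≃ₐ[L] Ω) x := rfl

instance inertia_smulCommClass (F : Type*) [Field F] [Algebra F L] [Algebra F Ω]
    [IsScalarTower F L Ω] : SMulCommClass (inertia O L Ω) F Ω := ⟨fun s a x => by
  rw [smul_eq_apply, smul_eq_apply, Algebra.smul_def, Algebra.smul_def, map_mul,
    IsScalarTower.algebraMap_apply F L Ω, AlgEquiv.commutes]⟩

variable [IsSepClosure L Ω] [PerfectField (IsLocalRing.ResidueField O)]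

theorem isInertial {π : O} (hπ : Irreducible π) :
    IsInertial (intVal O L Ω).valuation (algebraMap O Ω π) (inertia O L Ω) where
  map_smul s x := valuation_galois O L Ω s x
  sub_lt s x hx := (mem_inertia_iff O L Ω).mp s.2 x ((valuation_le_one_iff_integral O L).mp hx)
  fixed x hx h := exists_valuation_eq_zpow_of_fixed O L Ω hx (fun s hs => h ⟨s, hs⟩) hπ
  finite_orbit x := (Set.toFinite (MulAction.orbit (Ω ≃ₐ[L] Ω) x)).subset (by
    rintro _ ⟨s, rfl⟩
    exact ⟨s, rfl⟩)
  uniformizer_ne_zero := algebraMap_ne_zero L Ω hπ.ne_zero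
  uniformizer_lt := valuation_uniformizer_lt_one O L Ω hπ
  uniformizer_fixed s := smul_algebraMap s π

theorem valuation_algebraMap_le (x : O) : (intVal O L Ω).valuation (algebraMap O Ω x) ≤ 1 :=
  (valuation_le_one_iff_integral O L).mpr (algebraMap_mem _ x)

theorem valuation_algebraMap_unit (u : Oˣ) : (intVal O L Ω).valuation (algebraMap O Ω u) = 1 := by
  refine le_antisymm (valuation_algebraMap_le O L Ω u) ?_
  by_contra! h
  have h1 : (intVal O L Ω).valuation (algebraMap O Ω u) *
      (intVal O L Ω).valuation (algebraMap O Ω (u⁻¹ : Oˣ)) = 1 := by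
    rw [← map_mul, ← map_mul, Units.mul_inv, map_one, map_one]
  exact (mul_lt_one_of_lt_of_le h (valuation_algebraMap_le O L Ω _)).ne h1

theorem valuation_eq_pow_ramIndex {π ζ : O} (hπ : Irreducible π) (hζ : ζ ≠ 0) :
    (intVal O L Ω).valuation (algebraMap O Ω ζ) =
      (intVal O L Ω).valuation (algebraMap O Ω π) ^ ramIndex ζ := by
  obtain ⟨k, u, rfl⟩ := IsDiscreteValuationRing.eq_unit_mul_pow_irreducible hζ hπ
  have h : ramIndex ((u : O) * π ^ k) = k := by
    rw [ramIndex, IsDiscreteValuationRing.addVal_def' u hπ k]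
    rfl
  rw [h, map_mul, map_mul, valuation_algebraMap_unit, one_mul, map_pow, map_pow]

theorem ramIndex_pos {ζ : O} (hζ : ζ ≠ 0) (hζm : ζ ∈ IsLocalRing.maximalIdeal O) :
    0 < ramIndex ζ := by
  obtain ⟨π, hπ⟩ := IsDiscreteValuationRing.exists_irreducible O
  obtain ⟨k, u, rfl⟩ := IsDiscreteValuationRing.eq_unit_mul_pow_irreducible hζ hπ
  have h : ramIndex ((u : O) * π ^ k) = k := by
    rw [ramIndex, IsDiscreteValuationRing.addVal_def' u hπ k]
    rfl
  rw [h, Nat.pos_iff_ne_zero]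
  rintro rfl
  rw [pow_zero, mul_one] at hζm
  exact (IsLocalRing.mem_maximalIdeal _).mp hζm u.isUnit

/-- The characteristic polynomials of an `F`-representation of the inertia group are products of
powers of the tame character of level `R`, the exponents being `m`. -/
def HasExponents {F : Type*} [Field F] [Fintype F] [Algebra F Ω] {W : Type*} [AddCommGroup W]
    [Module F W] [Module.Finite F W] (π : O) (ρ : Representation F (inertia O L Ω) W) (R : ℕ)
    {n : ℕ} (m : Fin n → ℕ) : Prop :=
  ∀ ϖ : Ω, ϖ ^ (Fintype.card F ^ R - 1) = algebraMap O Ω π → ∀ s : inertia O L Ω,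
    (ρ s).charpoly.map (algebraMap F Ω) =
      ∏ j, (Polynomial.X - Polynomial.C ((s • ϖ / ϖ) ^ m j))

variable {O}
variable {F : Type*} [Field F] [Fintype F] [Algebra F O] {ζ : O}
  [Algebra F L] [IsScalarTower F O L] [Algebra F Ω] [IsScalarTower F O Ω] [IsScalarTower F L Ω]

/-- Setting `z = 0` in the Lang equation and in `A B = (z - ζ)^h` puts it in the form required by
`IsInertial.exists_exponents`. There `z - ζ` becomes `-ζ`, of order `e`, so the scalar has order `e
h` and the determinant order `e a`. The resulting exponents serve all stable lattices at once. -/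
theorem LocalShtuka.exists_exponents (S : LocalShtuka F O ζ) {h : ℕ}
    (hS : S.IsEffectiveOfHeightLE h) (hζ : ζ ≠ 0) (hζm : ζ ∈ IsLocalRing.maximalIdeal O)
    {π : O} (hπ : Irreducible π) {n : ℕ} (b : Module.Basis (Fin n) O⟦X⟧ S.M) {r₀ : ℕ}
    (hr₀ : 0 < r₀) :
    ∃ (a : ℕ) (R : ℕ) (m : Fin n → ℕ),
      (∀ d : ℤ, (∃ u : O⟦X⟧ˣ, (S.τMatrix b).det = ((zSubUnit ζ ^ d : (ZSubLoc ζ)ˣ) : ZSubLoc ζ) *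
        algebraMap O⟦X⟧ (ZSubLoc ζ) u) ↔ d = a) ∧ 0 < R ∧ r₀ ∣ R ∧
      (∀ j, m j ≤ ramIndex ζ * h * geomExp (Fintype.card F) R) ∧
      ∑ j, m j = ramIndex ζ * a * geomExp (Fintype.card F) R ∧
      ∃ _ : Module.Finite F⟦X⟧ (S.dualTate Ω (algebraMap_ne_zero L Ω hζ)),
      ∃ _ : Module.Free F⟦X⟧ (S.dualTate Ω (algebraMap_ne_zero L Ω hζ)),
      ∀ (T : Submodule F⟦X⟧ (S.RatTate Ω (algebraMap_ne_zero L Ω hζ))) [T.IsLattice F⸨X⸩]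
        (hT : ∀ g, ∀ x ∈ T, S.ratTateRep L Ω (algebraMap_ne_zero L Ω hζ) g x ∈ T)
        [Module.Finite F (Residual T)], HasExponents O L Ω π
          ((residualRep (S.ratTateRep L Ω (algebraMap_ne_zero L Ω hζ)) T hT).comp
            (inertia O L Ω).subtype) R m := by
  have hsep : IsSepClosed Ω := IsSepClosure.sep_closed L
  have hζΩ := algebraMap_ne_zero L Ω hζ
  have hz0 : zSub ζ ≠ 0 := (prime_zSub hζm).ne_zero
  obtain ⟨A, B, hA, hAB⟩ := S.exists_matrix b hS hz0
  obtain ⟨a, u, hau⟩ := exists_det_eq hζm hAB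
  have hdet : IsUnit (A.map (algebraMap O⟦X⟧ Ω⟦X⟧)).det := by
    rw [← RingHom.mapMatrix_apply, ← RingHom.map_det, hau, map_mul, map_pow]
    exact ((isUnit_zSub Ω hζΩ).pow a).mul (u.isUnit.map _)
  obtain ⟨X, t, hXdet, hX, hXs⟩ := S.exists_tate_basis L Ω hζΩ b hA hdet
  let co : Ω⟦X⟧ →+* Ω := PowerSeries.constantCoeff
  let γ : O⟦X⟧ →+* Ω := (algebraMap O Ω).comp PowerSeries.constantCoeff
  have hγ (f : O⟦X⟧) : co (algebraMap O⟦X⟧ Ω⟦X⟧ f) = γ f := by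
    rw [PowerSeries.algebraMap_apply'']
    exact constantCoeff_map' _ _
  have hγz : γ (zSub ζ) = - algebraMap O Ω ζ := by simp [γ, zSub]
  let v := (intVal O L Ω).valuation
  have hvz : v (γ (zSub ζ)) = v (algebraMap O Ω π) ^ ramIndex ζ := by
    rw [hγz, Valuation.map_neg, valuation_eq_pow_ramIndex O L Ω hπ hζ]
  have hG := isInertial O L Ω hπ
  let ρ (s : inertia O L Ω) : Matrix (Fin n) (Fin n) F :=
    (LinearMap.toMatrix t t (S.dualTateRep L Ω hζΩ s)).map PowerSeries.constantCoeff
  obtain ⟨R, m, hR, hr₀R, hm, hsum, hchar⟩ := hG.exists_exponents (F := F) (A := A.map γ)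
    (B := B.map γ) (X := X.map co) (β := γ (zSub ζ) ^ h) (N := ramIndex ζ * h)
    (a := ramIndex ζ * a) (fun i j => valuation_algebraMap_le O L Ω _)
    (fun i j => valuation_algebraMap_le O L Ω _) (fun s i j => smul_algebraMap s _)
    (by
      rw [← Matrix.map_mul, hAB, Matrix.map_smul' _ _ _ (map_mul γ), Matrix.map_one _ (map_zero _)
        (map_one _), map_pow])
    (by rw [map_pow, hvz, pow_mul])
    (by
      rw [← RingHom.mapMatrix_apply, ← RingHom.map_det, hau, map_mul, map_mul, map_pow, map_pow,
        hvz, pow_mul]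
      have : v (γ u) = 1 := valuation_algebraMap_unit O L Ω
        (Units.map (PowerSeries.constantCoeff (R := O)).toMonoidHom u)
      rw [this, mul_one])
    (by
      conv_lhs => rw [hX]
      rw [Matrix.map_mul]
      congr 1)
    (by
      rw [← RingHom.mapMatrix_apply, ← RingHom.map_det]
      exact (hXdet.map co).ne_zero)
    ρ (fun s => by
      have h1 := congrArg (fun M : Matrix (Fin n) (Fin n) Ω⟦X⟧ => M.map co) (hXs s)
      simp only [Matrix.map_mul] at h1
      convert h1 using 1
      · ext i j
        exact (constantCoeff_map' ((s : Ω ≃ₐ[L] Ω) : Ω →+* Ω) (X i j)).symm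
      · congr 1)
    hr₀
  refine ⟨a, R, m, fun d => ?_, hR, hr₀R, hm, hsum, Module.Finite.of_basis t,
    Module.Free.of_basis t, ?_⟩
  · rw [S.τMatrix_eq b hA, ← RingHom.mapMatrix_apply, ← RingHom.map_det, hau]
    exact zSubUnit_zpow_eq_iff hζm a u d
  · intro T _ hT _ ϖ hϖ s
    have : Module.Finite F⟦X⟧ (S.dualTate Ω hζΩ) := Module.Finite.of_basis t
    have : Module.Free F⟦X⟧ (S.dualTate Ω hζΩ) := Module.Free.of_basis t
    rw [← hchar ϖ hϖ s]
    rw [Matrix.charpoly_map]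
    congr 1
    exact charpoly_residualRep _ hT s _ (S.charpoly_ratTateRep L Ω hζΩ t s)

end Glue

/-! ### Digits and cyclic shifts -/

section Digits

/-- With `w + 1 = q^(r-l)` and `u + 1 = q^l` this is the rotation of base-`q` digits modulo `Q = q^r
- 1`: `n q^l = a Q + (a + b q^l)`. The second term is below `Q` unless all digits are `q - 1`, the
case `n = Q` excluded by `hn`. -/
theorem mul_pow_div_aux {n a b u w Q : ℕ} (hQ : (w + 1) * (u + 1) = Q + 1)
    (hdm : (w + 1) * a + b = n) (ha : a < u + 1) (hb : b < w + 1) (hn : n < Q) :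
    n * (u + 1) / Q = a := by
  have h1 : n * (u + 1) = (a + b * (u + 1)) + a * Q := by
    rw [← hdm]
    linear_combination a * hQ
  have h2 : a + b * (u + 1) < Q := by
    by_contra! h
    have hbw : b = w := by
      by_contra hne
      have : b + 1 ≤ w := by omega
      nlinarith
    subst hbw
    have hau : a = u := by nlinarith
    subst hau
    have : n = Q := by nlinarith
    omega
  rw [h1, Nat.add_mul_div_right _ _ (by omega), Nat.div_eq_of_lt h2, zero_add]

theorem mul_pow_div_eq {q r n l : ℕ} (hq : 2 ≤ q) (hn : n < q ^ r - 1) (hl : l ≤ r) :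
    n * q ^ l / (q ^ r - 1) = n / q ^ (r - l) := by
  have hqr : q ^ (r - l) * q ^ l = q ^ r := by rw [← pow_add, Nat.sub_add_cancel hl]
  have hl0 : 0 < q ^ l := by positivity
  have hk0 : 0 < q ^ (r - l) := by positivity
  have hdm := Nat.div_add_mod n (q ^ (r - l))
  have hb := Nat.mod_lt n hk0
  have ha : n / q ^ (r - l) < q ^ l := by
    rw [Nat.div_lt_iff_lt_mul hk0, mul_comm, hqr]
    omega
  obtain ⟨Q, hQ⟩ : ∃ Q, q ^ r = Q + 1 := ⟨q ^ r - 1, by omega⟩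
  obtain ⟨u, hu⟩ : ∃ u, q ^ l = u + 1 := ⟨q ^ l - 1, by omega⟩
  obtain ⟨w, hw⟩ : ∃ w, q ^ (r - l) = w + 1 := ⟨q ^ (r - l) - 1, by omega⟩
  rw [hQ, Nat.add_sub_cancel] at hn ⊢
  rw [hw] at ha hb hdm hqr ⊢
  rw [hu] at ha hqr ⊢
  exact mul_pow_div_aux (hqr.trans hQ) hdm ha hb hn

/-- The leading digit of the `l`-th cyclic shift of `n`. -/
theorem shift_div_eq {q r n l : ℕ} (hq : 2 ≤ q) (hn : n < q ^ r - 1) (hl : l < r) :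
    q * (n * q ^ l % (q ^ r - 1)) / (q ^ r - 1) = n / q ^ (r - 1 - l) % q := by
  have h1 := mul_pow_div_eq hq hn hl.le
  have h2 := mul_pow_div_eq hq hn (show l + 1 ≤ r from hl)
  set Q := q ^ r - 1
  have hQ : 0 < Q := by omega
  have h3 : n * q ^ (l + 1) = q * (n * q ^ l % Q) + Q * (q * (n * q ^ l / Q)) := by
    have := Nat.div_add_mod (n * q ^ l) Q
    calc n * q ^ (l + 1) = q * (n * q ^ l) := by ring
      _ = q * (Q * (n * q ^ l / Q) + n * q ^ l % Q) := by rw [this]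
      _ = _ := by ring
  rw [h3, Nat.add_mul_div_left _ _ hQ, h1] at h2
  rw [show r - 1 - l = r - (l + 1) by omega]
  have h4 : n / q ^ (r - l) = n / q ^ (r - (l + 1)) / q := by
    rw [Nat.div_div_eq_div_mul, ← pow_succ]
    congr 2
    omega
  rw [h4] at h2
  have := Nat.div_add_mod (n / q ^ (r - (l + 1))) q
  omega

/-- The exponents of the conjugates of the `n`-th power of the fundamental character of level `r`,
as exponents of a tame character of higher level. -/
def shifts (q r n c : ℕ) : Multiset ℕ :=
  (Multiset.range r).map fun l => c * (n * q ^ l % (q ^ r - 1))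

/-- The leading digits of the `r` cyclic shifts of `n` are the digits of `n`, from the top down; as
multisets the order is irrelevant. -/
theorem map_shifts {q r n c : ℕ} (hq : 2 ≤ q) (hn : n < q ^ r - 1) (hc : 0 < c) :
    (shifts q r n c).map (fun m => q * m / (c * (q ^ r - 1))) = digits q r n := by
  have h1 : (shifts q r n c).map (fun m => q * m / (c * (q ^ r - 1))) =
      (Multiset.range r).map fun l => n / q ^ (r - 1 - l) % q := by
    rw [shifts, Multiset.map_map]
    refine Multiset.map_congr rfl fun l hl => ?_
    rw [Function.comp_apply, mul_left_comm, Nat.mul_div_mul_left _ _ hc,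
      shift_div_eq hq hn (Multiset.mem_range.mp hl)]
  rw [h1, digits]
  have h2 := Finset.sum_range_reflect (fun k => ({n / q ^ k % q} : Multiset ℕ)) r
  rw [← Multiset.sum_map_singleton ((Multiset.range r).map _),
    ← Multiset.sum_map_singleton ((Multiset.range r).map fun i => n / q ^ i % q),
    Multiset.map_map, Multiset.map_map]
  exact h2

/-- With `x_l` the `l`-th shift, `q x_l = x_{l+1} + Q · digit`. Since `x_r = x_0`, summing over the
cycle leaves `(q - 1) ∑ x_l = Q ∑ digits`. -/
theorem sum_shifts {q r n c : ℕ} (hq : 2 ≤ q) (hn : n < q ^ r - 1) :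
    (q - 1) * (shifts q r n c).sum = c * (q ^ r - 1) * (digits q r n).sum := by
  rcases Nat.eq_zero_or_pos c with rfl | hc
  · simp [shifts]
  rw [← map_shifts hq hn hc]
  set Q := q ^ r - 1 with hQdef
  have hQ : 0 < Q := by omega
  let x (l : ℕ) := n * q ^ l % Q
  have hx0 : x 0 = n := by simp [x, Nat.mod_eq_of_lt hn]
  have hxr : x r = n := by
    have hqr : q ^ r = Q + 1 := by omega
    simp only [x]
    rw [hqr, Nat.mul_add, mul_one, Nat.mul_add_mod_self_right, Nat.mod_eq_of_lt hn]
  have hstep (l) : q * x l = x (l + 1) + Q * (q * x l / Q) := by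
    have h1 : x (l + 1) = q * x l % Q := by
      simp only [x]
      rw [Nat.mul_mod_mod, pow_succ]
      congr 1
      ring
    rw [h1, add_comm]
    exact (Nat.div_add_mod _ _).symm
  have h1 : q * ∑ l ∈ Finset.range r, x l =
      ∑ l ∈ Finset.range r, x l + Q * ∑ l ∈ Finset.range r, q * x l / Q := by
    rw [Finset.mul_sum, Finset.sum_congr rfl fun l _ => hstep l, Finset.sum_add_distrib,
      ← Finset.mul_sum]
    congr 1
    have := Finset.sum_range_succ x r
    rw [Finset.sum_range_succ', hx0, hxr] at this
    omega
  have h2 : (shifts q r n c).sum = c * ∑ l ∈ Finset.range r, x l := by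
    rw [Finset.mul_sum]
    rfl
  have h3 : ((shifts q r n c).map fun m => q * m / (c * Q)).sum =
      ∑ l ∈ Finset.range r, q * x l / Q := by
    rw [shifts, Multiset.map_map]
    change ∑ l ∈ Finset.range r, q * (c * x l) / (c * Q) = _
    exact Finset.sum_congr rfl fun l _ => by rw [mul_left_comm, Nat.mul_div_mul_left _ _ hc]
  rw [h2, h3]
  obtain ⟨q', rfl⟩ : ∃ q', q = q' + 1 := ⟨q - 1, by omega⟩
  rw [Nat.add_sub_cancel]
  linear_combination c * h1

end Digits

/-! ### Characteristic polynomials -/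

section Charpoly

open Module.Basis in
theorem charpoly_eq_charpoly_restrict_mul {K V : Type*} [Field K] [AddCommGroup V] [Module K V]
    [Module.Finite K V] (W : Submodule K V) (e : V →ₗ[K] V) (he : W ≤ W.comap e) :
    e.charpoly = (e.restrict he).charpoly * (W.mapQ W e he).charpoly := by
  let bW := Module.Free.chooseBasis K W
  let bQ := Module.Free.chooseBasis K (V ⧸ W)
  let b := sumQuot bW bQ
  let A := LinearMap.toMatrix bW bW (e.restrict he)
  let B := Matrix.of fun i l ↦ (b.repr (e (b (Sum.inr l)))) (Sum.inl i)
  let D := LinearMap.toMatrix bQ bQ (W.mapQ W e he)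
  suffices LinearMap.toMatrix b b e = Matrix.fromBlocks A B 0 D by
    rw [← LinearMap.charpoly_toMatrix e b, this, ← LinearMap.charpoly_toMatrix _ bW,
      ← LinearMap.charpoly_toMatrix _ bQ, Matrix.charpoly_fromBlocks_zero₂₁]
  ext u v
  cases u with
  | inl i =>
    cases v with
    | inl k =>
      simp only [b, sumQuot_inl, Matrix.fromBlocks_apply₁₁, A, LinearMap.toMatrix_apply]
      apply sumQuot_repr_inl_of_mem
    | inr l => simp [LinearMap.toMatrix_apply, Matrix.fromBlocks_apply₁₂, B]
  | inr j =>
    cases v with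
    | inl k =>
      suffices W.mkQ (e (bW k)) = 0 by simp [LinearMap.toMatrix_apply, b, this]
      rw [← LinearMap.mem_ker, Submodule.ker_mkQ]
      exact he (Submodule.coe_mem (bW k))
    | inr l =>
      simp only [LinearMap.toMatrix_apply, sumQuot_repr_inr, Matrix.fromBlocks_apply₂₂, b, D]
      rw [← sumQuot_inr bW bQ l, W.mapQ_apply]
      simp

theorem charpoly_eq_mul_of_exact {K V V' V'' : Type*} [Field K] [AddCommGroup V] [Module K V]
    [Module.Finite K V] [AddCommGroup V'] [Module K V'] [Module.Finite K V']
    [AddCommGroup V''] [Module K V''] [Module.Finite K V''] {ι : V' →ₗ[K] V} {φ : V →ₗ[K] V''}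
    (hι : Function.Injective ι) (hφ : Function.Surjective φ)
    (hex : LinearMap.ker φ = LinearMap.range ι) {f' : V' →ₗ[K] V'} {f : V →ₗ[K] V}
    {f'' : V'' →ₗ[K] V''} (h' : ∀ x, f (ι x) = ι (f' x)) (h'' : ∀ x, φ (f x) = f'' (φ x)) :
    f.charpoly = f'.charpoly * f''.charpoly := by
  let W := LinearMap.ker φ
  have hW : W ≤ W.comap f := fun x hx => by
    rw [Submodule.mem_comap, LinearMap.mem_ker, h'', LinearMap.mem_ker.mp hx, map_zero]
  rw [charpoly_eq_charpoly_restrict_mul W f hW]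
  let e' : V' ≃ₗ[K] W := (LinearEquiv.ofInjective ι hι).trans (LinearEquiv.ofEq _ _ hex.symm)
  let e'' : (V ⧸ W) ≃ₗ[K] V'' := φ.quotKerEquivOfSurjective hφ
  have he' (x) : ((e' x : W) : V) = ι x := rfl
  rw [← e'.charpoly_conj f', ← e''.charpoly_conj]
  congr 2
  · ext x
    obtain ⟨x, rfl⟩ := e'.surjective x
    simp [he', h']
  · ext x
    obtain ⟨x, rfl⟩ := hφ x
    have : e''.symm (φ x) = Submodule.Quotient.mk x := by
      rw [LinearEquiv.symm_apply_eq]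
      rfl
    rw [LinearEquiv.conj_apply_apply, this, ← h'']
    rfl

/-- The matrix of Frobenius conjugates of a basis is invertible by independence of embeddings, and
it conjugates multiplication by `α` into the diagonal matrix of conjugates of `α`. -/
theorem charpoly_mulLeft_map_self (F : Type*) [Field F] [Fintype F] {E : Type*} [Field E]
    [Algebra F E] [FiniteDimensional F E] (α : E) :
    (LinearMap.mulLeft F α).charpoly.map (algebraMap F E) =
      ∏ l : Fin (Module.finrank F E),
        (Polynomial.X - Polynomial.C (α ^ Fintype.card F ^ (l : ℕ))) := by
  have : Finite E := Module.finite_of_finite F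
  let e := Module.finBasis F E
  let f (i : Fin (Module.finrank F E)) : E →ₐ[F] E := FiniteField.frobeniusAlgHom F E ^ (i : ℕ)
  have hf (i x) : f i x = x ^ Fintype.card F ^ (i : ℕ) := by
    simp only [f]
    rw [AlgHom.coe_pow, FiniteField.coe_frobeniusAlgHom, pow_iterate]
  let D : Matrix (Fin (Module.finrank F E)) (Fin (Module.finrank F E)) E :=
    Matrix.of fun i j => f i (e j)
  let P := LinearMap.toMatrix e e (LinearMap.mulLeft F α)
  have hD : IsUnit D := by
    rw [← Matrix.linearIndependent_rows_iff_isUnit]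
    have h1 := (linearIndependent_toLinearMap F E E).comp f
      (FiniteField.bijective_frobeniusAlgHom_pow F E).1
    rw [Fintype.linearIndependent_iff] at h1 ⊢
    intro g hg
    refine h1 g (e.ext fun j => ?_)
    have := congrFun hg j
    simpa [D] using this
  have hDP : D * P.map (algebraMap F E) =
      Matrix.diagonal (fun i => f i α) * D := by
    ext i j
    rw [Matrix.diagonal_mul, Matrix.mul_apply]
    have h2 : α * e j = ∑ k, P k j • e k := by
      conv_lhs => rw [← e.sum_repr (α * e j)]
      refine Finset.sum_congr rfl fun k _ => ?_
      rw [show P k j = e.repr (α * e j) k from LinearMap.toMatrix_apply _ _ _ _ _]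
    have h3 := congrArg (f i) h2
    rw [map_mul, map_sum] at h3
    rw [show D i j = f i (e j) from rfl, h3]
    refine Finset.sum_congr rfl fun k _ => ?_
    rw [map_smul, Algebra.smul_def, mul_comm]
    rfl
  obtain ⟨u, hu⟩ := hD
  have h4 : u.val * P.map (algebraMap F E) * u⁻¹.val = Matrix.diagonal (fun i => f i α) := by
    rw [hu, hDP, ← hu, mul_assoc, Units.mul_inv, mul_one]
  have h5 := Matrix.charpoly_units_conj u (P.map (algebraMap F E))
  rw [← Matrix.coe_units_inv, h4, Matrix.charpoly_diagonal] at h5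
  rw [← LinearMap.charpoly_toMatrix _ e, ← Matrix.charpoly_map]
  refine h5.symm.trans ?_
  simp only [hf]

/-- The characteristic polynomial of multiplication by an element of a finite field. -/
theorem charpoly_mulLeft_map {F : Type*} [Field F] [Fintype F] {Ω : Type*} [Field Ω] [Algebra F Ω]
    (E : IntermediateField F Ω) [FiniteDimensional F E] (α : E) :
    (LinearMap.mulLeft F α).charpoly.map (algebraMap F Ω) =
      ((Multiset.range (Module.finrank F E)).map fun l =>
        Polynomial.X - Polynomial.C ((α : Ω) ^ Fintype.card F ^ l)).prod := by
  rw [IsScalarTower.algebraMap_eq F E Ω, ← Polynomial.map_map, charpoly_mulLeft_map_self,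
    Polynomial.map_prod, Fin.prod_univ_eq_prod_range
      (fun l => Polynomial.map (algebraMap E Ω)
        (Polynomial.X - Polynomial.C (α ^ Fintype.card F ^ l)))]
  change _ = ∏ l ∈ Finset.range _, _
  refine Finset.prod_congr rfl fun l _ => ?_
  simp [IntermediateField.algebraMap_apply]

end Charpoly

/-! ### The weights are determined by the characteristic polynomials -/

section Weights

theorem multiset_eq_of_map_pow_eq {Ω : Type*} [CommMonoid Ω] {ε : Ω} {Q : ℕ}
    (hε : IsPrimitiveRoot ε Q) {A B : Multiset ℕ} (hA : ∀ a ∈ A, a < Q) (hB : ∀ a ∈ B, a < Q)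
    (h : A.map (ε ^ ·) = B.map (ε ^ ·)) : A = B := by
  let f : Ω → ℕ := Function.invFunOn (ε ^ ·) {a | a < Q}
  have hf {a : ℕ} (ha : a < Q) : f (ε ^ a) = a := by
    have h1 : ∃ b ∈ {a | a < Q}, ε ^ b = ε ^ a := ⟨a, ha, rfl⟩
    exact hε.pow_inj (Function.invFunOn_mem h1) ha (Function.invFunOn_eq h1)
  have key {A : Multiset ℕ} (hA : ∀ a ∈ A, a < Q) : (A.map (ε ^ ·)).map f = A := by
    rw [Multiset.map_map]
    conv_rhs => rw [← Multiset.map_id' A]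
    exact Multiset.map_congr rfl fun a ha => hf (hA a ha)
  rw [← key hA, h, key hB]

theorem lt_of_mem_shifts {q r n c m : ℕ} (hn : n < q ^ r - 1) (hc : 0 < c)
    (hm : m ∈ shifts q r n c) : m < c * (q ^ r - 1) := by
  obtain ⟨l, -, rfl⟩ := Multiset.mem_map.mp hm
  exact Nat.mul_lt_mul_of_pos_left (Nat.mod_lt _ (by omega)) hc

theorem pow_sub_one_dvd {q r R : ℕ} (h : r ∣ R) : q ^ r - 1 ∣ q ^ R - 1 := by
  obtain ⟨k, rfl⟩ := h
  simpa [pow_mul] using Nat.sub_dvd_pow_sub_pow (q ^ r) 1 k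

theorem exists_pow_card_sub_one_eq (F : Type*) [Field F] [Fintype F] {Ω : Type*} [Field Ω]
    [Algebra F Ω] [IsSepClosed Ω] {R : ℕ} (hR : 0 < R) (x : Ω) :
    ∃ y : Ω, y ^ (Fintype.card F ^ R - 1) = x := by
  have : NeZero ((Fintype.card F ^ R - 1 : ℕ) : Ω) := by
    refine ⟨?_⟩
    rw [Nat.cast_sub (Nat.one_le_pow _ _ Fintype.card_pos), Nat.cast_pow, card_cast_eq_zero,
      zero_pow hR.ne']
    simp
  exact IsSepClosed.exists_pow_nat_eq x _

variable {O : Type*} [CommRing O] [IsDomain O] [IsDiscreteValuationRing O]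
    [IsAdicComplete (IsLocalRing.maximalIdeal O) O]
    {L : Type*} [Field L] [Algebra O L] [IsFractionRing O L]
    {Ω : Type*} [Field Ω] [Algebra L Ω] [Algebra O Ω] [IsScalarTower O L Ω]
    [IsSepClosure L Ω] [PerfectField (IsLocalRing.ResidueField O)]

/-- Independence of the tame character from the uniformizer and the root: `ϖ' / ϖ` has valuation
`1`, so inertia moves it only within its residue class. The two roots of unity are congruent, hence
equal. -/
theorem smul_root_div_eq (F : Type*) [Field F] [Fintype F] [Algebra F L] [Algebra F Ω]
    [IsScalarTower F L Ω] {π π' : O} (hπ : Irreducible π) (hπ' : Irreducible π') {k : ℕ}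
    (hk : 0 < k) {ϖ ϖ' : Ω} (h : ϖ ^ k = algebraMap O Ω π) (h' : ϖ' ^ k = algebraMap O Ω π')
    (s : inertia O L Ω) : s • ϖ / ϖ = s • ϖ' / ϖ' := by
  have hG := isInertial O L Ω hπ
  have hG' := isInertial O L Ω hπ'
  let v := (intVal O L Ω).valuation
  have h0 := hG.root_ne_zero hk.ne' h
  have h0' := hG'.root_ne_zero hk.ne' h'
  obtain ⟨u, hu⟩ := IsDiscreteValuationRing.associated_of_irreducible O hπ hπ'
  have hw : v (ϖ' / ϖ) = 1 := by
    have h1 : (ϖ' / ϖ) ^ k = algebraMap O Ω u := by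
      rw [div_pow, h, h', ← hu, map_mul, mul_div_cancel_left₀ _ hG.uniformizer_ne_zero]
    have h2 : v (ϖ' / ϖ) ^ k = 1 := by
      rw [← map_pow, h1]
      exact valuation_algebraMap_unit O L Ω u
    exact (pow_eq_one_iff_of_nonneg zero_le hk.ne').mp h2
  have hα := hG.smul_root_div_pow s h
  have hα' := hG'.smul_root_div_pow s h'
  refine eq_of_isAlgebraic_of_valuation_sub_lt (F := F) v (isAlgebraic_of_pow_eq_one F hk hα)
    (isAlgebraic_of_pow_eq_one F hk hα') ?_
  have h3 : s • ϖ / ϖ - s • ϖ' / ϖ' =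
      - ((s • ϖ / ϖ) * (s • (ϖ' / ϖ) - ϖ' / ϖ) / (ϖ' / ϖ)) := by
    have hs : s • ϖ ≠ 0 := by rwa [smul_ne_zero_iff_ne]
    rw [smul_div₀']
    field_simp
    ring
  rw [h3, Valuation.map_neg, map_div₀, map_mul, hw, div_one,
    valuation_eq_one_of_pow_eq_one v hk hα, one_mul]
  exact hG.sub_lt s _ hw.le

variable {F : Type*} [Field F] [Fintype F] [Algebra F L] [Algebra F Ω] [IsScalarTower F L Ω]
  {W : Type*} [AddCommGroup W] [Module F W] [Module.Finite F W]
  {ρ : Representation F (inertia O L Ω) W}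

open Polynomial in
-- On a factor, `s` acts as multiplication by `ψ(s)` on `E`, with eigenvalues the conjugates
-- `ψ(s)^(q^l)`. Since `θ_r = θ_R^c`, these are powers of the level `R` character whose exponents
-- are the shifts of `n` scaled by `c`.
theorem IsFactorWeights.exists_shifts {U U' : Subrepresentation ρ} (hU : U ≤ U') {w : Multiset ℕ}
    (hw : IsFactorWeights O L Ω U U' w) :
    ∃ r n, 0 < r ∧ r ≤ Module.finrank F W ∧ n < Fintype.card F ^ r - 1 ∧
      w = digits (Fintype.card F) r n ∧
      ∀ {R : ℕ}, r ∣ R → ∀ {c : ℕ}, c * (Fintype.card F ^ r - 1) = Fintype.card F ^ R - 1 →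
      ∀ {π : O}, Irreducible π → ∀ {ϖ : Ω},
        ϖ ^ (Fintype.card F ^ R - 1) = algebraMap O Ω π → ∀ s : inertia O L Ω,
        (U'.toRepresentation s).charpoly.map (algebraMap F Ω) =
          (U.toRepresentation s).charpoly.map (algebraMap F Ω) *
          ((shifts (Fintype.card F) r n c).map fun m => X - C ((s • ϖ / ϖ) ^ m)).prod := by
  obtain ⟨E, ψ, φ, hE, hφ, hker, hψ, θ, n, ⟨π', ϖ', hπ', hϖ', hθ⟩, hn, hψθ, rfl⟩ := hw
  have hr : Module.finrank F E ≤ Module.finrank F W :=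
    (LinearMap.finrank_le_finrank_of_surjective hφ).trans (Submodule.finrank_le _)
  refine ⟨Module.finrank F E, n, Module.finrank_pos, hr, hn, rfl, ?_⟩
  intro R hrR c hc π hπ ϖ hϖ s
  have hk : 0 < Fintype.card F ^ Module.finrank F E - 1 := by omega
  set β := s • ϖ / ϖ with hβ
  have hθβ : θ s = β ^ c := by
    have h1 : (ϖ ^ c) ^ (Fintype.card F ^ Module.finrank F E - 1) = algebraMap O Ω π := by
      rw [← pow_mul, hc, hϖ]
    rw [hθ, ← smul_eq_apply, ← smul_root_div_eq F hπ hπ' hk h1 hϖ' s, hβ, div_pow, smul_pow']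
  have hβ1 : (β ^ c) ^ (Fintype.card F ^ Module.finrank F E - 1) = 1 := by
    rw [← pow_mul, hc, hβ, (isInertial O L Ω hπ).smul_root_div_pow s hϖ]
  have h2 := charpoly_eq_mul_of_exact (f := U'.toRepresentation s) (f' := U.toRepresentation s)
    (f'' := LinearMap.mulLeft F (ψ s : E)) (Submodule.inclusion_injective hU) hφ
    (by rw [hker, Submodule.range_inclusion]; rfl) (fun x => rfl) (fun x => hψ s x)
  rw [h2, Polynomial.map_mul, charpoly_mulLeft_map, shifts, Multiset.map_map]
  congr 2
  refine Multiset.map_congr rfl fun l _ => ?_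
  rw [Function.comp_apply, hψθ, hθβ, ← pow_mul, pow_mul β, ← pow_eq_pow_mod _ hβ1]

theorem charpoly_toRepresentation_top (s : inertia O L Ω) :
    ((⊤ : Subrepresentation ρ).toRepresentation s).charpoly = (ρ s).charpoly :=
  ((Submodule.topEquiv (R := F) (M := W)).charpoly_conj
    ((⊤ : Subrepresentation ρ).toRepresentation s)).symm

theorem charpoly_toRepresentation_bot (s : inertia O L Ω) :
    ((⊥ : Subrepresentation ρ).toRepresentation s).charpoly = 1 := by
  refine (LinearMap.charpoly_monic _).natDegree_eq_zero.mp ?_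
  rw [LinearMap.charpoly_natDegree]
  exact finrank_bot F W

open Polynomial in
-- Two factorizations of one characteristic polynomial, one over the `m j` and one over the
-- Jordan–Hölder factors, are compared at an `s` with `ε` of exact order `Q`. All exponents being
-- below `Q`, they are recovered from the roots. Divisibility of `R` by the factorial makes every
-- level `r` that occurs divide `R`.
theorem HasExponents.weights {π : O} (hπ : Irreducible π) {R n : ℕ} {m : Fin n → ℕ}
    (hm : HasExponents O L Ω π ρ R m) (hR : 0 < R) (hRW : (Module.finrank F W).factorial ∣ R)
    {N a : ℕ} (hN : N < Fintype.card F - 1) (hmN : ∀ j, m j ≤ N * geomExp (Fintype.card F) R)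
    (hma : ∑ j, m j = a * geomExp (Fintype.card F) R) {w : Multiset ℕ}
    (hw : IsResidualWeights O L Ω ρ w) : (∀ k ∈ w, k ≤ N) ∧ w.sum = a := by
  have : IsSepClosed Ω := IsSepClosure.sep_closed L
  obtain ⟨l, U, v, hU0, hUl, hcov, hfac, rfl⟩ := hw
  have hq : 2 ≤ Fintype.card F := Fintype.one_lt_card
  obtain ⟨ϖ, hϖ⟩ := exists_pow_card_sub_one_eq F hR (algebraMap O Ω π)
  set q := Fintype.card F
  set Q := q ^ R - 1 with hQdef
  have hg := geomExp_mul (q := q) (by omega) R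
  rw [← hQdef] at hg
  have hQ : 0 < Q := Nat.sub_pos_of_lt (Nat.one_lt_pow hR.ne' hq)
  have hg0 : 0 < geomExp q R := Nat.pos_of_mul_pos_left (hg ▸ hQ)
  obtain ⟨s, hε⟩ := (isInertial O L Ω hπ).exists_isPrimitiveRoot F hQ hϖ
  set ε := s • ϖ / ϖ
  have hstep (i : ℕ) : ∃ B : Multiset ℕ, i < l → (∀ b ∈ B, b < Q) ∧
      B.map (fun b => q * b / Q) = v i ∧ (q - 1) * B.sum = Q * (v i).sum ∧
      ((U (i + 1)).toRepresentation s).charpoly.map (algebraMap F Ω) =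
        ((U i).toRepresentation s).charpoly.map (algebraMap F Ω) *
          (B.map fun b => X - C (ε ^ b)).prod := by
    by_cases hi : i < l
    swap
    · exact ⟨0, fun h => absurd h hi⟩
    obtain ⟨r, n, hr, hrW, hn, hv, h⟩ := (hfac i hi).exists_shifts (hcov i hi).le
    have hrR : r ∣ R := (Nat.dvd_factorial hr hrW).trans hRW
    obtain ⟨c, hc⟩ := pow_sub_one_dvd (q := q) hrR
    rw [mul_comm] at hc
    have hc0 : 0 < c := Nat.pos_of_ne_zero (by
      rintro rfl
      rw [zero_mul] at hc
      exact hQ.ne' hc)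
    refine ⟨shifts q r n c, fun _ => ⟨fun b hb => ?_, ?_, ?_, h hrR hc.symm hπ hϖ s⟩⟩
    · exact (lt_of_mem_shifts hn hc0 hb).trans_eq hc.symm
    · rw [hv, hQdef, hc, map_shifts hq hn hc0]
    · rw [hv, hQdef, hc, sum_shifts hq hn]
  choose B hB using hstep
  have hchar : ∀ i ≤ l, ((U i).toRepresentation s).charpoly.map (algebraMap F Ω) =
      ((∑ j ∈ Finset.range i, B j).map fun b => X - C (ε ^ b)).prod := by
    intro i
    induction i with
    | zero =>
      intro _
      rw [hU0, charpoly_toRepresentation_bot]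
      simp
    | succ i ih =>
      intro hi
      rw [(hB i hi).2.2.2, ih (by omega), Finset.sum_range_succ, Multiset.map_add,
        Multiset.prod_add]
  have h1 := hchar l le_rfl
  rw [hUl, charpoly_toRepresentation_top, hm ϖ hϖ s] at h1
  let A : Multiset ℕ := Finset.univ.val.map m
  have hA : ∑ i ∈ Finset.range l, B i = A := by
    refine multiset_eq_of_map_pow_eq hε (fun b hb => ?_) (fun b hb => ?_) ?_
    · obtain ⟨i, hi, hb⟩ := Multiset.mem_sum.mp hb
      exact (hB i (Finset.mem_range.mp hi)).1 b hb
    · obtain ⟨j, -, rfl⟩ := Multiset.mem_map.mp hb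
      rw [← hg]
      exact (hmN j).trans_lt (Nat.mul_lt_mul_of_pos_right hN hg0)
    · have h2 := congrArg Polynomial.roots h1
      have h3 : ∏ j, (X - C (ε ^ m j)) = ((A.map (ε ^ ·)).map fun a => X - C a).prod := by
        rw [Multiset.map_map, Multiset.map_map]
        rfl
      rw [h3, Polynomial.roots_multiset_prod_X_sub_C,
        ← Function.comp_def (fun a => X - C a) (ε ^ ·), ← Multiset.map_map,
        Polynomial.roots_multiset_prod_X_sub_C] at h2
      exact h2.symm
  have hw : ∑ i ∈ Finset.range l, v i = A.map fun b => q * b / Q := by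
    rw [← hA, ← Multiset.coe_mapAddMonoidHom, map_sum]
    exact Finset.sum_congr rfl fun i hi => (hB i (Finset.mem_range.mp hi)).2.1.symm
  constructor
  · intro k hk
    rw [hw] at hk
    obtain ⟨b, hb, rfl⟩ := Multiset.mem_map.mp hk
    obtain ⟨j, -, rfl⟩ := Multiset.mem_map.mp hb
    refine Nat.le_of_lt_succ ((Nat.div_lt_iff_lt_mul hQ).mpr ?_)
    obtain ⟨q', hq'⟩ : ∃ q', q = q' + 1 := ⟨q - 1, by omega⟩
    calc q * m j ≤ q * (N * geomExp q R) := Nat.mul_le_mul_left _ (hmN j)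
      _ = (q * N) * geomExp q R := (mul_assoc _ _ _).symm
      -- The inequality `q N < (N + 1)(q - 1)` is equivalent to `N < q - 1`.
      _ < ((N + 1) * (q - 1)) * geomExp q R := by
        refine Nat.mul_lt_mul_of_pos_right ?_ hg0
        rw [hq', Nat.add_sub_cancel] at hN ⊢
        linarith
      _ = (N + 1) * Q := by rw [mul_assoc, hg]
  · have hsum : (q - 1) * A.sum = Q * (∑ i ∈ Finset.range l, v i).sum := by
      rw [← hA, ← Multiset.coe_sumAddMonoidHom, map_sum, map_sum, Finset.mul_sum, Finset.mul_sum]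
      exact Finset.sum_congr rfl fun i hi => (hB i (Finset.mem_range.mp hi)).2.2.1
    have hAs : A.sum = a * geomExp q R := hma
    rw [hAs, mul_left_comm, hg, mul_comm] at hsum
    exact (Nat.eq_of_mul_eq_mul_left hQ hsum).symm

end Weights

/-! ### Irreducible representations of the inertia group -/

section Irreducible

theorem exists_ne_zero_fixed {F : Type*} [Field F] [Finite F] {p : ℕ} [Fact p.Prime] [CharP F p]
    {S : Type*} [AddCommGroup S] [Module F S] [Module.Finite F S] [Nontrivial S]
    {G : Type*} [Group G] (σ : Representation F G S) (K : Subgroup G)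
    (hK : ∀ s ∈ K, ∃ k, σ s ^ p ^ k = 1) : ∃ x, x ≠ 0 ∧ ∀ s ∈ K, σ s x = x := by
  have : Finite S := Module.finite_of_finite F
  have : Finite (Module.End F S) := Finite.of_injective _ DFunLike.coe_injective
  let P : Subgroup (Module.End F S)ˣ := K.map σ.asGroupHom
  have hP : IsPGroup p P := by
    rintro ⟨_, s, hs, rfl⟩
    obtain ⟨k, hk⟩ := hK s hs
    refine ⟨k, Subtype.ext (Units.ext ?_)⟩
    rw [SubmonoidClass.coe_pow, Units.val_pow_eq_pow_val, Representation.asGroupHom_apply, hk]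
    rfl
  have hcard : p ∣ Nat.card S := by
    obtain ⟨x, hx⟩ := exists_ne (0 : S)
    have h1 : addOrderOf x = p := by
      refine addOrderOf_eq_prime ?_ hx
      rw [← Nat.cast_smul_eq_nsmul F, CharP.cast_eq_zero, zero_smul]
    rw [← h1]
    exact addOrderOf_dvd_natCard x
  have h0 : (0 : S) ∈ MulAction.fixedPoints P S := fun g => smul_zero g
  obtain ⟨x, hx, hx0⟩ := hP.exists_fixed_point_of_prime_dvd_card_of_fixed_point S hcard h0
  exact ⟨x, hx0.symm, fun s hs => hx ⟨_, s, hs, rfl⟩⟩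

/-- Over the algebraically closed field `k` the transpose of `A` has an eigenvector; restricted to
`S` and scaled to take the value `1`, it intertwines `A` with multiplication by `α`. -/
theorem exists_eigenfunctional {F : Type*} [Field F] {Ω : Type*} [Field Ω] [Algebra F Ω]
    [IsAlgClosed (algebraicClosure F Ω)] {S : Type*} [AddCommGroup S] [Module F S]
    [Module.Finite F S] [Nontrivial S] (A : Module.End F S) :
    ∃ (φ : S →ₗ[F] Ω) (α : Ω) (x : S), φ x = 1 ∧ ∀ y, φ (A y) = α * φ y := by
  let k := algebraicClosure F Ω
  have : Nontrivial (k ⊗[F] S) := by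
    rw [← Module.finrank_pos_iff (R := k), Module.finrank_baseChange]
    exact Module.finrank_pos
  obtain ⟨α, hα⟩ := Module.End.exists_eigenvalue
    (Module.Dual.transpose (R := k) (A.baseChange k))
  obtain ⟨f, hf, hf0⟩ := hα.exists_hasEigenvector
  rw [Module.End.mem_eigenspace_iff] at hf
  obtain ⟨x, hx⟩ : ∃ x : S, f (1 ⊗ₜ x) ≠ 0 := by
    by_contra! h
    refine hf0 (LinearMap.ext fun y => ?_)
    induction y using TensorProduct.induction_on with
    | zero => simp
    | add y z hy hz => rw [map_add, hy, hz, map_add]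
    | tmul a x =>
      rw [← mul_one a, ← smul_eq_mul, ← TensorProduct.smul_tmul', map_smul, h]
      simp
  let φ : S →ₗ[F] Ω := k.val.toLinearMap.comp
    (((f (1 ⊗ₜ x))⁻¹ • f).restrictScalars F ∘ₗ TensorProduct.mk F k S 1)
  have hφ (y) : φ y = ((f (1 ⊗ₜ x))⁻¹ * f (1 ⊗ₜ y) : k) := rfl
  refine ⟨φ, α, x, ?_, fun y => ?_⟩
  · rw [hφ, inv_mul_cancel₀ hx]
    rfl
  · have h1 : f (1 ⊗ₜ A y) = α * f (1 ⊗ₜ y) := LinearMap.congr_fun hf (1 ⊗ₜ y)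
    rw [hφ, hφ, h1, mul_left_comm]
    rfl

/-- Irreducibility under `A` forces the kernel of `φ` to vanish and the preimage of `F(α)` to be
everything. The image contains all `P(α) φ(x) = P(α)`, so it is `F(α)`. -/
theorem exists_equiv_adjoin {F : Type*} [Field F] [Finite F] {Ω : Type*} [Field Ω] [Algebra F Ω]
    {S : Type*} [AddCommGroup S] [Module F S] [Module.Finite F S] {A : Module.End F S}
    (hA : ∀ N : Submodule F S, N ≤ N.comap A → N = ⊥ ∨ N = ⊤) {φ : S →ₗ[F] Ω} {α : Ω} {x : S}
    (hx : φ x = 1) (hφ : ∀ y, φ (A y) = α * φ y) :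
    ∃ e : S ≃ₗ[F] IntermediateField.adjoin F {α}, ∀ y, (e y : Ω) = φ y := by
  have hx0 : x ≠ 0 := by
    rintro rfl
    simp at hx
  let E := IntermediateField.adjoin F {α}
  have hαE : α ∈ E := IntermediateField.mem_adjoin_simple_self F α
  let E' : Submodule F Ω := Subalgebra.toSubmodule E.toSubalgebra
  have h1 : E'.comap φ = ⊤ := by
    refine (hA _ fun y hy => ?_).resolve_left fun h => hx0 ?_
    · change φ (A y) ∈ E
      rw [hφ]
      exact mul_mem hαE hy
    · rw [← Submodule.mem_bot F, ← h]
      change φ x ∈ E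
      rw [hx]
      exact one_mem E
  have hE (y) : φ y ∈ E := (h1.symm ▸ Submodule.mem_top : y ∈ E'.comap φ)
  let f : S →ₗ[F] E := φ.codRestrict E' hE
  have hf (y) : (f y : Ω) = φ y := rfl
  have hinj : Function.Injective f := by
    rw [← LinearMap.ker_eq_bot]
    refine (hA _ fun y hy => ?_).resolve_right fun h => ?_
    · rw [LinearMap.mem_ker] at hy
      rw [Submodule.mem_comap, LinearMap.mem_ker]
      ext
      rw [hf, hφ, ← hf, hy]
      simp
    · have : f x = 0 := by
        rw [← LinearMap.mem_ker, h]
        trivial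
      have := congrArg Subtype.val this
      rw [hf, hx] at this
      exact one_ne_zero this
  have key (P : Polynomial F) (y) : φ (Polynomial.aeval A P y) = Polynomial.aeval α P * φ y := by
    induction P using Polynomial.induction_on' with
    | add P P' h h' => simp [h, h', add_mul]
    | monomial n a =>
      have h (n : ℕ) : φ ((A ^ n) y) = α ^ n * φ y := by
        induction n with
        | zero => simp
        | succ n ih => rw [pow_succ', Module.End.mul_apply, hφ, ih, pow_succ', mul_assoc]
      simp [Polynomial.aeval_monomial, h, Algebra.smul_def, mul_assoc]
  have hα : IsIntegral F α := by
    refine ⟨A.charpoly, A.charpoly_monic, ?_⟩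
    have h2 := key A.charpoly x
    rwa [A.aeval_self_charpoly, hx, mul_one, LinearMap.zero_apply, map_zero, eq_comm] at h2
  have hsurj : Function.Surjective f := by
    rintro ⟨y, hy⟩
    rw [← IntermediateField.mem_toSubalgebra,
      IntermediateField.adjoin_simple_toSubalgebra_of_isAlgebraic hα.isAlgebraic,
      Algebra.adjoin_singleton_eq_range_aeval] at hy
    obtain ⟨P, rfl⟩ := hy
    refine ⟨Polynomial.aeval A P x, Subtype.ext ?_⟩
    rw [hf, key, hx, mul_one]
    rfl
  exact ⟨LinearEquiv.ofBijective f ⟨hinj, hsurj⟩, hf⟩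

variable {O : Type*} [CommRing O] [IsDomain O] [IsDiscreteValuationRing O]
    [IsAdicComplete (IsLocalRing.maximalIdeal O) O]
    {L : Type*} [Field L] [Algebra O L] [IsFractionRing O L]
    {Ω : Type*} [Field Ω] [Algebra L Ω] [Algebra O Ω] [IsScalarTower O L Ω]
    [IsSepClosure L Ω] [PerfectField (IsLocalRing.ResidueField O)]
    {F : Type*} [Field F] [Fintype F] [Algebra F L] [Algebra F Ω] [IsScalarTower F L Ω]

/-- Irreducible tame representations are characters of finite extensions of `F`. -/
theorem exists_character {S : Type*} [AddCommGroup S] [Module F S] [Module.Finite F S]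
    [Nontrivial S] {σ : Representation F (inertia O L Ω) S}
    (hσ : ∀ N : Submodule F S, (∀ s, N ≤ N.comap (σ s)) → N = ⊥ ∨ N = ⊤)
    {π : O} (hπ : Irreducible π) {R : ℕ} (hR : 0 < R) (hSR : Module.finrank F S ∣ R) {ϖ : Ω}
    (hϖ : ϖ ^ (Fintype.card F ^ R - 1) = algebraMap O Ω π) (p : ℕ) [Fact p.Prime] [CharP F p]
    (hK : ∀ s : inertia O L Ω, s • ϖ = ϖ → ∃ k, σ s ^ p ^ k = 1) :
    ∃ (E : IntermediateField F Ω) (ψ : inertia O L Ω →* Eˣ) (e : S ≃ₗ[F] E),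
      (∀ s x, e (σ s x) = ψ s * e x) ∧
      ∃ w, IsCharacterWeights O L Ω F E ψ w := by
  have : IsSepClosed Ω := IsSepClosure.sep_closed L
  have hG := isInertial O L Ω hπ
  set Q := Fintype.card F ^ R - 1 with hQdef
  have hQ : 0 < Q := Nat.sub_pos_of_lt (Nat.one_lt_pow hR.ne' Fintype.one_lt_card)
  have : NeZero Q := ⟨hQ.ne'⟩
  have hϖ0 := hG.root_ne_zero hQ.ne' hϖ
  let χ (s : inertia O L Ω) : Ω := s • ϖ / ϖ
  have hχ (s) : s • ϖ = χ s * ϖ := (div_mul_cancel₀ _ hϖ0).symm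
  have hχQ (s) : χ s ^ Q = 1 := hG.smul_root_div_pow s hϖ
  have hfix {a : Ω} (ha : a ^ Q = 1) (s : inertia O L Ω) : s • a = a :=
    hG.smul_root_of_unity F hQ ha s
  have hχmul (s t) : χ (s * t) = χ s * χ t := by
    apply mul_right_cancel₀ hϖ0
    rw [← hχ, mul_smul, hχ t, smul_mul', hfix (hχQ t), hχ s]
    ring
  have hχone : χ 1 = 1 := by simp [χ, hϖ0]
  let χ' : inertia O L Ω →* Ω := ⟨⟨χ, hχone⟩, hχmul⟩
  let K : Subgroup (inertia O L Ω) := MulAction.stabilizer (inertia O L Ω) ϖ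
  have hKχ (s) : s ∈ K ↔ χ s = 1 := by
    rw [MulAction.mem_stabilizer_iff, hχ]
    exact mul_eq_right₀ hϖ0
  obtain ⟨x₁, hx₁, hx₁K⟩ := exists_ne_zero_fixed σ K hK
  -- the kernel of the tame character acts trivially
  have hKtriv (s) (hs : s ∈ K) (x : S) : σ s x = x := by
    let N : Submodule F S :=
      { carrier := {x | ∀ s ∈ K, σ s x = x}
        zero_mem' := fun s _ => map_zero _
        add_mem' := fun hx hy s hs => by rw [map_add, hx s hs, hy s hs]
        smul_mem' := fun a x hx s hs => by rw [map_smul, hx s hs] }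
    have hN : N = ⊤ := by
      refine (hσ N fun t x hx s hs => ?_).resolve_left fun h => hx₁ ?_
      · have h1 : t⁻¹ * s * t ∈ K := by
          rw [hKχ] at hs ⊢
          have h2 : χ t⁻¹ * χ t = 1 := by rw [← hχmul, inv_mul_cancel, hχone]
          rw [hχmul, hχmul, hs, mul_one, h2]
        rw [← Module.End.mul_apply, ← map_mul, show s * t = t * (t⁻¹ * s * t) by group, map_mul,
          Module.End.mul_apply, hx _ h1]
      · rw [← Submodule.mem_bot F, ← h]
        exact hx₁K
    have hx : x ∈ N := hN ▸ Submodule.mem_top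
    exact hx s hs
  obtain ⟨s₀, hε⟩ := hG.exists_isPrimitiveRoot F hQ hϖ
  -- The action factors through the tame character, whose image is cyclic, so it is generated by `σ
  -- s₀`; stability under `σ s₀` is then stability under the group.
  have hpow (s) : ∃ k : ℕ, χ s = χ s₀ ^ k ∧ σ s = σ s₀ ^ k := by
    obtain ⟨k, -, hk⟩ := hε.eq_pow_of_pow_eq_one (hχQ s)
    refine ⟨k, hk.symm, ?_⟩
    have h1 : (s₀ ^ k)⁻¹ * s ∈ K := by
      have h2 : χ ((s₀ ^ k)⁻¹) * χ (s₀ ^ k) = 1 := by rw [← hχmul, inv_mul_cancel, hχone]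
      have h3 : χ (s₀ ^ k) = χ s := (map_pow χ' s₀ k).trans hk
      rw [hKχ, hχmul, ← h3, h2]
    rw [show s = s₀ ^ k * ((s₀ ^ k)⁻¹ * s) by group, map_mul, map_pow]
    ext x
    rw [Module.End.mul_apply, hKtriv _ h1]
  obtain ⟨φ, α, x, hx, hφ⟩ := exists_eigenfunctional (Ω := Ω) (σ s₀)
  have hφpow (k : ℕ) (y) : φ ((σ s₀ ^ k) y) = α ^ k * φ y := by
    induction k with
    | zero => simp
    | succ k ih => rw [pow_succ', Module.End.mul_apply, hφ, ih, pow_succ', mul_assoc]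
  have hαQ : α ^ Q = 1 := by
    have h1 : s₀ ^ Q ∈ K := by
      rw [hKχ]
      exact (map_pow χ' s₀ Q).trans (hχQ s₀)
    have h2 := hφpow Q x
    rw [← map_pow, hKtriv _ h1, hx, mul_one] at h2
    exact h2.symm
  obtain ⟨m, hm, rfl⟩ := hε.eq_pow_of_pow_eq_one hαQ
  change ∀ y, φ (σ s₀ y) = χ s₀ ^ m * φ y at hφ
  obtain ⟨e, he⟩ := exists_equiv_adjoin (A := σ s₀) (fun N hN => hσ N fun s y hy => by
    obtain ⟨k, -, hk⟩ := hpow s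
    rw [Submodule.mem_comap, hk]
    clear hk
    induction k with
    | zero => exact hy
    | succ k ih =>
      rw [pow_succ', Module.End.mul_apply]
      exact hN ih) hx hφ
  let E := IntermediateField.adjoin F {χ s₀ ^ m}
  change S ≃ₗ[F] E at e
  have hχE (s) : χ s ^ m ∈ E := by
    obtain ⟨k, hk, -⟩ := hpow s
    rw [hk, ← pow_mul, mul_comm, pow_mul]
    exact pow_mem (IntermediateField.mem_adjoin_simple_self F _) k
  let ψ : inertia O L Ω →* Eˣ := MonoidHom.toHomUnits
    { toFun s := ⟨χ s ^ m, hχE s⟩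
      map_one' := Subtype.ext (show χ 1 ^ m = 1 by rw [hχone, one_pow])
      map_mul' s t := Subtype.ext (show χ (s * t) ^ m = χ s ^ m * χ t ^ m by rw [hχmul, mul_pow]) }
  have hψ (s) : ((ψ s : E) : Ω) = χ s ^ m := rfl
  refine ⟨E, ψ, e, fun s y => Subtype.ext ?_, ?_⟩
  · obtain ⟨k, hk, hk'⟩ := hpow s
    rw [he, hk', hφpow, ← he]
    change _ = χ s ^ m * _
    rw [hk, ← pow_mul, ← pow_mul, mul_comm m k]
  · have : Module.Finite F E := Module.Finite.equiv e
    have hrR : Module.finrank F E ∣ R := by rwa [← e.finrank_eq]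
    have hr : 0 < Module.finrank F E := Module.finrank_pos
    obtain ⟨c, hc⟩ := pow_sub_one_dvd (q := Fintype.card F) hrR
    rw [mul_comm] at hc
    change Q = _ at hc
    set k := Fintype.card F ^ Module.finrank F E - 1
    have hk : 0 < k := Nat.sub_pos_of_lt (Nat.one_lt_pow hr.ne' Fintype.one_lt_card)
    have hα : χ s₀ ^ (m * k) = 1 := by
      have : Finite E := Module.finite_of_finite F
      have := Fintype.ofFinite E
      have h1 := FiniteField.pow_card_sub_one_eq_one (ψ s₀ : E) (ψ s₀).ne_zero
      rw [Module.card_eq_pow_finrank (K := F)] at h1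
      have h2 := congrArg Subtype.val h1
      rw [pow_mul]
      exact h2
    -- The character has values in `Eˣ`, of order `k = q^r - 1`. As `χ s₀` has order `Q = c k`, the
    -- exponent `m` is a multiple of `c`, which brings the character down from level `R` to level
    -- `r`.
    have hcm : c * k ∣ m * k := hc ▸ (hε.pow_eq_one_iff_dvd _).mp hα
    obtain ⟨n, rfl⟩ := Nat.dvd_of_mul_dvd_mul_right hk hcm
    refine ⟨_, fun s => s • (ϖ ^ c) / ϖ ^ c, n, ⟨π, ϖ ^ c, hπ, ?_, fun s => rfl⟩, ?_, fun s => ?_,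
      rfl⟩
    · rw [← pow_mul]
      change ϖ ^ (c * k) = _
      rw [← hc, hϖ]
    · rw [hc] at hm
      exact Nat.lt_of_mul_lt_mul_left hm
    · change _ = (s • ϖ ^ c / ϖ ^ c) ^ n
      rw [hψ, pow_mul, smul_pow', ← div_pow]

variable {W : Type*} [AddCommGroup W] [Module F W] [Module.Finite F W]
  {ρ : Representation F (inertia O L Ω) W}

/-- When `s` fixes `ϖ`, all eigenvalues are `1`. By Cayley–Hamilton `ρ s` is unipotent, and `(T -
1)^(p^n) = T^(p^n) - 1` in characteristic `p`, with `p^n ≥ n`. -/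
theorem HasExponents.pow_eq_one {π : O} {R n : ℕ} {m : Fin n → ℕ}
    (hm : HasExponents O L Ω π ρ R m) {ϖ : Ω} (hϖ0 : ϖ ≠ 0)
    (hϖ : ϖ ^ (Fintype.card F ^ R - 1) = algebraMap O Ω π) (p : ℕ) [Fact p.Prime] [CharP F p]
    {s : inertia O L Ω} (hs : s • ϖ = ϖ) : ∃ k, ρ s ^ p ^ k = 1 := by
  have h1 := hm ϖ hϖ s
  simp only [hs, div_self hϖ0, one_pow, Finset.prod_const, Finset.card_univ, Fintype.card_fin]
    at h1
  have h2 : (ρ s).charpoly = (Polynomial.X - Polynomial.C 1) ^ n := by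
    apply Polynomial.map_injective _ (algebraMap F Ω).injective
    rw [h1]
    simp
  refine ⟨n, ?_⟩
  have h3 : (ρ s).charpoly ∣ (Polynomial.X - Polynomial.C 1) ^ p ^ n := by
    rw [h2]
    exact pow_dvd_pow _ (Nat.lt_pow_self (Fact.out : p.Prime).one_lt).le
  rw [sub_pow_char_pow] at h3
  obtain ⟨P, hP⟩ := h3
  have h4 := congrArg (Polynomial.aeval (ρ s)) hP
  rw [map_mul, LinearMap.aeval_self_charpoly, zero_mul] at h4
  simpa [sub_eq_zero] using h4

/-- The cover relation makes the quotient irreducible, and the stabilizer of `ϖ` acts on it by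
elements of `p`-power order, so `exists_character` applies. -/
theorem HasExponents.exists_factorWeights {π : O} (hπ : Irreducible π) {R n : ℕ} {m : Fin n → ℕ}
    (hm : HasExponents O L Ω π ρ R m) (hR : 0 < R) (hRW : (Module.finrank F W).factorial ∣ R)
    {U U' : Subrepresentation ρ} (hU : U ⋖ U') : ∃ w, IsFactorWeights O L Ω U U' w := by
  have : IsSepClosed Ω := IsSepClosure.sep_closed L
  obtain ⟨p, hp⟩ := CharP.exists F
  have : Fact p.Prime := ⟨CharP.char_is_prime F p⟩
  obtain ⟨ϖ, hϖ⟩ := exists_pow_card_sub_one_eq F hR (algebraMap O Ω π)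
  have hϖ0 := (isInertial O L Ω hπ).root_ne_zero
    (Nat.sub_pos_of_lt (Nat.one_lt_pow hR.ne' Fintype.one_lt_card)).ne' hϖ
  let V := U.toSubmodule.submoduleOf U'.toSubmodule
  have hV (s) : V ≤ V.comap (U'.toRepresentation s) := fun x hx =>
    U.apply_mem_toSubmodule s hx
  let σ := U'.toRepresentation.quotient V hV
  have hσmk (s) (x : U'.toSubmodule) :
      σ s (V.mkQ x) = V.mkQ (U'.toRepresentation s x) := rfl
  have hnt : Nontrivial (U'.toSubmodule ⧸ V) := by
    rw [Submodule.Quotient.nontrivial_iff]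
    intro h
    refine hU.lt.not_ge fun x hx => ?_
    have : (⟨x, hx⟩ : U'.toSubmodule) ∈ V := h ▸ Submodule.mem_top
    exact this
  have hirr (N : Submodule F (U'.toSubmodule ⧸ V)) (hN : ∀ s, N ≤ N.comap (σ s)) :
      N = ⊥ ∨ N = ⊤ := by
    let N' : Subrepresentation ρ :=
      ⟨(N.comap V.mkQ).map U'.toSubmodule.subtype, by
        rintro s _ ⟨x, hx, rfl⟩
        exact ⟨U'.toRepresentation s x, hN s hx, rfl⟩⟩
    have h1 : U ≤ N' := fun x hx => by
      refine ⟨⟨x, hU.le hx⟩, ?_, rfl⟩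
      have h2 : V.mkQ ⟨x, hU.le hx⟩ = 0 := (Submodule.Quotient.mk_eq_zero V).mpr hx
      change V.mkQ _ ∈ N
      rw [h2]
      exact N.zero_mem
    have h2 : N' ≤ U' := by
      rintro _ ⟨x, -, rfl⟩
      exact x.2
    rcases hU.eq_or_eq h1 h2 with h | h
    · left
      rw [eq_bot_iff]
      intro y hy
      obtain ⟨x, rfl⟩ := V.mkQ_surjective y
      have hx : (x : W) ∈ N' := ⟨x, hy, rfl⟩
      rw [h] at hx
      exact (Submodule.Quotient.mk_eq_zero V).mpr hx
    · right
      rw [eq_top_iff]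
      intro y _
      obtain ⟨x, rfl⟩ := V.mkQ_surjective y
      have hx : (x : W) ∈ N' := h.ge x.2
      obtain ⟨x', hx', hxx⟩ := hx
      obtain rfl : x' = x := Subtype.ext hxx
      exact hx'
  have hfin : Module.finrank F (U'.toSubmodule ⧸ V) ≤ Module.finrank F W :=
    (Submodule.finrank_quotient_le V).trans (Submodule.finrank_le _)
  obtain ⟨E, ψ, e, he, w, hw⟩ := exists_character hirr hπ hR
    ((Nat.dvd_factorial Module.finrank_pos hfin).trans hRW) hϖ p (fun s hs => by
      obtain ⟨k, hk⟩ := hm.pow_eq_one hϖ0 hϖ p hs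
      refine ⟨k, LinearMap.ext fun y => ?_⟩
      obtain ⟨x, rfl⟩ := V.mkQ_surjective y
      rw [← map_pow, hσmk, Module.End.one_apply]
      congr 1
      ext
      change ρ (s ^ p ^ k) (x : W) = x
      rw [map_pow, hk, Module.End.one_apply])
  refine ⟨w, E, ψ, e.toLinearMap.comp V.mkQ, Module.Finite.equiv e,
    e.surjective.comp V.mkQ_surjective, ?_, fun s x => he s (V.mkQ x), hw⟩
  rw [LinearEquiv.ker_comp, Submodule.ker_mkQ]

theorem HasExponents.exists_residualWeights {π : O} (hπ : Irreducible π) {R n : ℕ}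
    {m : Fin n → ℕ} (hm : HasExponents O L Ω π ρ R m) (hR : 0 < R)
    (hRW : (Module.finrank F W).factorial ∣ R) : ∃ w, IsResidualWeights O L Ω ρ w := by
  have : Finite W := Module.finite_of_finite F
  have : Finite (Subrepresentation ρ) := Finite.of_injective _ SetLike.coe_injective
  obtain ⟨U, hU0, l, hUl, hU⟩ :=
    exists_covBy_seq_of_wellFoundedLT_wellFoundedGT (Subrepresentation ρ)
  choose v hv using fun i => show ∃ w, i < l → IsFactorWeights O L Ω (U i) (U (i + 1)) w by
    by_cases hi : i < l
    · obtain ⟨w, hw⟩ := hm.exists_factorWeights hπ hR hRW (hU i hi)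
      exact ⟨w, fun _ => hw⟩
    · exact ⟨0, fun h => absurd h hi⟩
  exact ⟨_, l, U, v, isMin_iff_eq_bot.mp hU0, isMax_iff_eq_top.mp hUl, hU, hv, rfl⟩

end Irreducible

/-! ### Tame inertia weights of a local shtuka -/

section Final

variable {O : Type*} [CommRing O] [IsDomain O] [IsDiscreteValuationRing O]
    [IsAdicComplete (IsLocalRing.maximalIdeal O) O]
    {L : Type*} [Field L] [Algebra O L] [IsFractionRing O L]
    {Ω : Type*} [Field Ω] [Algebra L Ω] [Algebra O Ω] [IsScalarTower O L Ω]
    [IsSepClosure L Ω] [PerfectField (IsLocalRing.ResidueField O)]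
    {F : Type*} [Field F] [Fintype F] [Algebra F L] [Algebra F Ω] [IsScalarTower F L Ω]

theorem HasExponents.finrank_eq {W : Type*} [AddCommGroup W] [Module F W] [Module.Finite F W]
    {ρ : Representation F (inertia O L Ω) W} {π : O} {R n : ℕ} {m : Fin n → ℕ}
    (hm : HasExponents O L Ω π ρ R m) (hR : 0 < R) : Module.finrank F W = n := by
  have : IsSepClosed Ω := IsSepClosure.sep_closed L
  obtain ⟨ϖ, hϖ⟩ := exists_pow_card_sub_one_eq F hR (algebraMap O Ω π)
  have h := congrArg Polynomial.natDegree (hm ϖ hϖ 1)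
  rw [Polynomial.natDegree_map, LinearMap.charpoly_natDegree,
    Polynomial.natDegree_prod_of_monic _ _ fun j _ => Polynomial.monic_X_sub_C _] at h
  simp only [Polynomial.natDegree_X_sub_C] at h
  simpa using h

variable (L Ω) [Algebra F O] [IsScalarTower F O L] [IsScalarTower F O Ω] {ζ : O}

/-- The determinant of `τ` with respect to a basis has an order at `z - ζ`, the tame inertia
weights exist, are bounded, and their sum is the product of the order with the ramification
index. -/
theorem LocalShtuka.tameInertiaWeights_of_basis (S : LocalShtuka F O ζ) {h : ℕ}
    (hS : S.IsEffectiveOfHeightLE h) (hζ : ζ ≠ 0) (hζm : ζ ∈ IsLocalRing.maximalIdeal O)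
    (heh : ramIndex ζ * h < Fintype.card F - 1) {n : ℕ} (b : Module.Basis (Fin n) O⟦X⟧ S.M) :
    ∃ a : ℕ, (∀ d : ℤ, (∃ u : O⟦X⟧ˣ, (S.τMatrix b).det =
        ((zSubUnit ζ ^ d : (ZSubLoc ζ)ˣ) : ZSubLoc ζ) * algebraMap O⟦X⟧ (ZSubLoc ζ) u) ↔ d = a) ∧
      (∃ w, IsTameInertiaWeights O L Ω (S.ratTateRep L Ω (algebraMap_ne_zero L Ω hζ)) w) ∧
      ∀ w, IsTameInertiaWeights O L Ω (S.ratTateRep L Ω (algebraMap_ne_zero L Ω hζ)) w →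
        (∀ k ∈ w, k ≤ ramIndex ζ * h) ∧ w.sum = ramIndex ζ * a := by
  obtain ⟨π, hπ⟩ := IsDiscreteValuationRing.exists_irreducible O
  -- Asking for `n! ∣ R` makes every degree at most the rank `n` divide `R`.
  obtain ⟨a, R, m, had, hR, hnR, hmN, hma, hfin, hfree, hexp⟩ :=
    S.exists_exponents L Ω hS hζ hζm hπ b n.factorial_pos
  refine ⟨a, had, ?_, ?_⟩
  · have hlat := S.isLattice_tateLattice Ω (algebraMap_ne_zero L Ω hζ)
    have := finite_residual (S.tateLattice Ω (algebraMap_ne_zero L Ω hζ))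
    have hm := hexp (S.tateLattice Ω (algebraMap_ne_zero L Ω hζ))
      (S.ratTateRep_mem_tateLattice L Ω (algebraMap_ne_zero L Ω hζ))
    obtain ⟨w, hw⟩ := hm.exists_residualWeights hπ hR (by rwa [hm.finrank_eq hR])
    exact ⟨w, _, hlat, _, hw⟩
  · rintro w ⟨T, hlat, hT, hw⟩
    have := finite_residual T
    have hm := hexp T hT
    exact hm.weights hπ hR (by rwa [hm.finrank_eq hR]) heh hmN hma hw

end Final

end LocalTame

end

theorem mainTheorem6
    -- the residue field `F = 𝔽_𝔭` of `A_𝔭 = F⟦z⟧`, with `q̂` elements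
    {F : Type*} [Field F] [Fintype F]
    -- the complete discrete valuation ring `O` with perfect residue field, and `γ : A_𝔭 → O`
    {O : Type*} [CommRing O] [IsDomain O] [IsDiscreteValuationRing O]
    [IsAdicComplete (IsLocalRing.maximalIdeal O) O]
    [PerfectField (IsLocalRing.ResidueField O)]
    [Algebra F O] {ζ : O} (hζ : ζ ≠ 0) (hζm : ζ ∈ IsLocalRing.maximalIdeal O)
    -- the fraction field `L` of `O` and a separable closure `Ω` of `L`
    (L : Type*) [Field L] [Algebra O L] [IsFractionRing O L] [Algebra F L] [IsScalarTower F O L]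
    (Ω : Type*) [Field Ω] [Algebra L Ω] [IsSepClosure L Ω] [Algebra O Ω] [IsScalarTower O L Ω]
    [Algebra F Ω] [IsScalarTower F O Ω] [IsScalarTower F L Ω]
    -- an effective local shtuka of height `≤ h`
    (S : LocalTame.LocalShtuka F O ζ) (h : ℕ) (hS : S.IsEffectiveOfHeightLE h)
    (heh : LocalTame.ramIndex ζ * h < Fintype.card F - 1) :
    (∃ d : ℤ, S.HasDimension d) ∧
    (∃ w : Multiset ℕ, LocalTame.IsTameInertiaWeights O L Ω
      (S.ratTateRep L Ω (LocalTame.algebraMap_ne_zero L Ω hζ)) w) ∧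
    ∀ (d : ℤ) (w : Multiset ℕ), S.HasDimension d →
      LocalTame.IsTameInertiaWeights O L Ω
        (S.ratTateRep L Ω (LocalTame.algebraMap_ne_zero L Ω hζ)) w →
      (∀ n ∈ w, n ≤ LocalTame.ramIndex ζ * h) ∧ (w.sum : ℤ) = LocalTame.ramIndex ζ * d := by
  have b := Module.finBasis O⟦X⟧ S.M
  obtain ⟨a, had, ⟨w₀, hw₀⟩, hw⟩ := S.tameInertiaWeights_of_basis L Ω hS hζ hζm heh b
  refine ⟨⟨a, fun r b' => ?_⟩, ⟨w₀, hw₀⟩, fun d w hd hwd => ?_⟩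
  · obtain ⟨a', had', -, hw'⟩ := S.tameInertiaWeights_of_basis L Ω hS hζ hζm heh b'
    -- Independence of the basis without a base change: the orders for `b` and `b'`, multiplied by
    -- `e > 0`, both equal the sum of the same weights `w₀`.
    have h1 : LocalTame.ramIndex ζ * a = LocalTame.ramIndex ζ * a' :=
      (hw w₀ hw₀).2.symm.trans (hw' w₀ hw₀).2
    have h2 : a = a' :=
      Nat.eq_of_mul_eq_mul_left (LocalTame.ramIndex_pos O hζ hζm) h1
    exact (had' a).mpr (congrArg Nat.cast h2)
  · obtain ⟨h1, h2⟩ := hw w hwd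
    refine ⟨h1, ?_⟩
    rw [h2, (had d).mp (hd _ b), Nat.cast_mul]
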